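/- **Lemma 4.4 (Neighborhood estimate).** Setting. Let $\Omega\subset\mathbb R^3$ be open, and let $\Gamma\subset\Omega$ be a closed (compact, without boundary) embedded $C^2$ surface with a unit normal field, extended to a $C^1$ vector field $\mathbf n$ on an open neighbourhood $\mathcal O$ of $\Gamma$, with $\|\nabla\mathbf n\|\le\kappa$ on $\mathcal O$. Let $\mathcal T_h$ be a finite face-to-face triangulation of $\overline\Omega$ into closed tetrahedra which is shape regular with constant $\sigma$: every $T\in\mathcal T_h$ contains a ball of some radius $r>0$ with $h_T:=\operatorname{diam}T\le\sigma r$. Put $$\mathcal T_h^\Gamma=\{T\in\mathcal T_h: T\cap\Gamma\ne\emptyset\},\qquad \Omega_h^\Gamma=\operatorname{int}\bigcup_{T\in\mathcal T_h^\Gamma}T,\qquad \omega(T)=\{T'\in\mathcal T_h^\Gamma: T'\cap T\neq\emptyset\},$$ $$\mathcal T^\Gamma_{\rm reg}=\{T\in\mathcal T_h^\Gamma: |\Gamma\cap T|\ge\hat c\,h_T^2\},$$ where $|\cdot|$ is surface area, and write $L^2(\omega(T))$ for $L^2$ of the union of the tetrahedra in $\omega(T)$. For $k\ge1$ let $Q_h$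 be the space of all continuous functions $q$ on $\Omega_h^\Gamma$ that are polynomials of degree at most $k$ on each $T\in\mathcal T_h^\Gamma$ and satisfy $\int_\Gamma q\,ds=0$. Claim. For every $\sigma$ there is a threshold $\hat c>0$, depending only on $\sigma$, and for all $k\ge1$ and $\kappa$ there is a constant $c>0$, depending only on $\sigma$, $k$ and $\kappa$, such that the following holds. For all $\Omega,\Gamma,\mathcal O,\mathbf n$ as above there is $h_0>0$ such that for every triangulation $\mathcal T_h$ as above with $h=\max_{T\in\mathcal T_h^\Gamma}h_T\le h_0$ and every $T\in\mathcal T_h^\Gamma$: all tetrahedra in $\omega(T)$ lie in $\mathcal O$, and there is a regular element $T'\in\omega(T)\cap\mathcal T^\Gamma_{\rm reg}$ with $$\|q\|_{L^2(T)}\le c\Big(\|q\|_{L^2(T')}+h_T\,\|\mathbf n\cdot\nabla q\|_{L^2(\omega(T))}+h_T^2\,\|\nabla q\|_{L^2(\omega(T))}\Big)\qquad\text{for all }q\in Q_h .$$ -/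

import Mathlib

open MeasureTheory Set

namespace TraceFEM

/-- Euclidean three-space. -/
abbrev E3 : Type := EuclideanSpace ℝ (Fin 3)

/-! ### The surface -/

/-- `φ` is a `C²` function on the open neighbourhood `U` of `x`, without critical points there,
whose zero set in `U` is `Γ ∩ U`. -/
structure IsDefiningFunction (Γ : Set E3) (x : E3) (U : Set E3) (φ : E3 → ℝ) : Prop where
  isOpen : IsOpen U
  mem : x ∈ U
  contDiffOn : ContDiffOn ℝ 2 φ U
  gradient_ne_zero : ∀ y ∈ U, gradient φ y ≠ 0
  inter_eq : Γ ∩ U = {y | y ∈ U ∧ φ y = 0}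

/-- A closed (compact, without boundary) embedded surface of class `C²`. -/
structure IsClosedSurface (Γ : Set E3) : Prop where
  isCompact : IsCompact Γ
  exists_definingFunction : ∀ x ∈ Γ, ∃ U φ, IsDefiningFunction Γ x U φ

/-- `n` restricts to a unit normal field on `Γ`: at each point of `Γ` it is a unit vector, and the
gradient of a local defining function is a multiple of it. -/
def IsUnitNormal (Γ : Set E3) (n : E3 → E3) : Prop :=
  ∀ x ∈ Γ, ‖n x‖ = 1 ∧ ∃ U φ, IsDefiningFunction Γ x U φ ∧ ∃ a : ℝ, gradient φ x = a • n x

/-- `n` is a continuously differentiable extension, to an open neighbourhood `O` of `Γ`, of a unit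
normal field on `Γ`, with `‖∇n‖ ≤ κ` on `O`. -/
structure IsNormalExtension (Γ O : Set E3) (n : E3 → E3) (κ : ℝ) : Prop where
  isOpen : IsOpen O
  subset : Γ ⊆ O
  contDiffOn : ContDiffOn ℝ 1 n O
  norm_fderiv_le : ∀ x ∈ O, ‖fderiv ℝ n x‖ ≤ κ
  isUnitNormal : IsUnitNormal Γ n

/-! ### The mesh -/

/-- The closed tetrahedron with vertex set `s`. -/
abbrev tet (s : Finset E3) : Set E3 := convexHull ℝ (s : Set E3)

/-- The diameter `h_T` of the tetrahedron with vertex set `s`. -/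
noncomputable def tetDiam (s : Finset E3) : ℝ := Metric.diam (tet s)

/-- The tetrahedra of a simplicial complex (each given by its set of four vertices). -/
def tetrahedra (K : Geometry.SimplicialComplex ℝ E3) : Set (Finset E3) :=
  {s | s ∈ K.faces ∧ s.card = 4}

/-- The finite simplicial complex `K` is a (face-to-face) tetrahedral triangulation of `Ω`. -/
structure IsTriangulation (K : Geometry.SimplicialComplex ℝ E3) (Ω : Set E3) : Prop where
  finite : K.faces.Finite
  pure : ∀ s ∈ K.faces, ∃ t ∈ tetrahedra K, s ⊆ t
  space_eq : K.space = closure Ω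

/-- Shape regularity with constant `σ`: every tetrahedron `T` contains a ball whose radius `r`
satisfies `h_T ≤ σ r`. -/
def IsShapeRegular (K : Geometry.SimplicialComplex ℝ E3) (σ : ℝ) : Prop :=
  ∀ s ∈ tetrahedra K, ∃ z r, 0 < r ∧ Metric.closedBall z r ⊆ tet s ∧ tetDiam s ≤ σ * r

/-- The active mesh `𝒯_h^Γ`: the tetrahedra that meet `Γ`. -/
def cutTetrahedra (K : Geometry.SimplicialComplex ℝ E3) (Γ : Set E3) : Set (Finset E3) :=
  {s | s ∈ tetrahedra K ∧ (tet s ∩ Γ).Nonempty}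

/-- The patch `ω(T)`: the cut tetrahedra that meet `T`. -/
def patch (K : Geometry.SimplicialComplex ℝ E3) (Γ : Set E3) (s : Finset E3) :
    Set (Finset E3) :=
  {t | t ∈ cutTetrahedra K Γ ∧ (tet t ∩ tet s).Nonempty}

/-- The region covered by a set of tetrahedra. -/
def region (S : Set (Finset E3)) : Set E3 := ⋃ s ∈ S, tet s

/-- The regular elements with threshold `χ`: cut tetrahedra `T` with `|Γ ∩ T| ≥ χ h_T ^ 2`, the
area being the two-dimensional Hausdorff measure, normalized to agree with Lebesgue measure on
planes. -/
def regularTetrahedra (K : Geometry.SimplicialComplex ℝ E3) (Γ : Set E3) (χ : ℝ) :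
    Set (Finset E3) :=
  {s | s ∈ cutTetrahedra K Γ ∧ ENNReal.ofReal (χ * tetDiam s ^ 2) ≤ μHE[2] (Γ ∩ tet s)}

/-! ### The finite element spaces -/

/-- The bulk finite element space `V_h^k`: continuous functions on
`Ω_h^Γ = int (⋃ T)`, the union being over the cut tetrahedra, that are polynomials of degree at
most `k` on each cut tetrahedron. -/
def bulkSpace (K : Geometry.SimplicialComplex ℝ E3) (Γ : Set E3) (k : ℕ) : Set (E3 → ℝ) :=
  {q | ContinuousOn q (interior (region (cutTetrahedra K Γ))) ∧
    ∀ s ∈ cutTetrahedra K Γ, ∃ p : MvPolynomial (Fin 3) ℝ, p.totalDegree ≤ k ∧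
      ∀ x ∈ tet s ∩ interior (region (cutTetrahedra K Γ)),
        q x = MvPolynomial.eval (fun i => x i) p}

/-- The pressure space `Q_h = V_h^k ∩ L²_0(Γ)`. -/
def pressureSpace (K : Geometry.SimplicialComplex ℝ E3) (Γ : Set E3) (k : ℕ) : Set (E3 → ℝ) :=
  {q | q ∈ bulkSpace K Γ k ∧ MemLp q 2 ((μHE[2] : Measure E3).restrict Γ) ∧
    ∫ x in Γ, q x ∂(μHE[2] : Measure E3) = 0}

/-- The norm of `L²(S)`, for scalar or vector valued functions. For a piecewise polynomial `q`,
the pointwise gradient `gradient q` is the piecewise gradient, up to a null set. -/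
noncomputable def l2Norm {F : Type*} [NormedAddCommGroup F] (S : Set E3) (f : E3 → F) : ℝ :=
  Real.sqrt (∫ x in S, ‖f x‖ ^ 2)

end TraceFEM

/-! At the scale of a fine mesh, Γ is almost a plane. Pick x in T ∩ Γ and put ν = ±n(x). Near x, Γ
is the zero set of a function φ with |φ(y) − φ(y') − ν·(y − y')| ≤ η|y − y'|, where η is as small as
σ requires; compactness of Γ makes the scale uniform (`exists_uniform_flat`). The sign is chosen so
that φ ≥ 0 at the centre z of an inscribed ball of T; "above" means φ > 0.

If φ is clearly negative somewhere on T, then Γ cuts T in area comparable to h_T², and T' = T works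
(`mem_regularTetrahedra_of_lt`). Otherwise T lies almost entirely above Γ and the regular element
must be found below it. Take a face τ of T with the fewest vertices among those meeting {φ ≤ 0}; by
minimality φ is nearly nonpositive on all of τ (`IsNearlyAffine.exists_face`). Every tetrahedron
having τ as a face contains a point with φ ≤ 0, so it is cut as soon as it also contains a point
above Γ. These tetrahedra cover a ball of radius comparable to h_T about the barycenter of τ
(`exists_mem_star`). Hence lines in direction −ν, started in a small ball of T near that barycenter,
reach Γ through cut elements only.

The star has boundedly many elements, so a fixed proportion of these lines meets Γ in one and the
same T'. Projection along ν then bounds |Γ ∩ T'| from below: T' is regular. After discarding the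
lines close to the edge of the shadow of T', the starting points form a set E of volume comparable
to h_T³ whose lines have chords of length comparable to h_T in T' (`exists_transfer`).

Along such a line q(a)² ≤ 2 q(a − sν)² + 2|s| ∫ |∂_ν q|². Averaging over E and the chords controls q
on E by q on T' and ∂_ν q on the patch (`sq_l2Norm_le_of_isTransfer`), and a polynomial of bounded
degree on T is controlled by its values on E (`exists_lintegral_closedBall_le`). Finally ∂_ν q =
±n·∇q + O(κ h_T)|∇q| on the patch, which produces the term of order h_T².

The constants depend on σ only because tetrahedra at an interior vertex are boundedly many, by
packing, and are linked through common edges, by connectedness of a small sphere, so their diameters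
are comparable (`tetDiam_le_of_common_vertex`). -/

namespace TraceFEM

/-! ### Polynomials on sets of positive measure -/

/-- The zero set of a nonzero polynomial is a null set. -/
theorem volume_zeroSet_mvPolynomial {n : ℕ} (p : MvPolynomial (Fin n) ℝ) (hp : p ≠ 0) :
    volume {x : Fin n → ℝ | MvPolynomial.eval x p = 0} = 0 := by
  induction n with
  | zero =>
    have : {x : Fin 0 → ℝ | MvPolynomial.eval x p = 0} = ∅ := by
      ext x
      simp only [mem_ofPred_eq, mem_empty_iff_false, iff_false]
      intro h
      refine hp (MvPolynomial.funext fun y => ?_)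
      rw [Subsingleton.elim y x, h, map_zero]
    rw [this, measure_empty]
  | succ n ih =>
    have hcont : Continuous fun x : Fin (n + 1) → ℝ => MvPolynomial.eval x p :=
      MvPolynomial.continuous_eval p
    have hmeas : MeasurableSet {x : Fin (n + 1) → ℝ | MvPolynomial.eval x p = 0} :=
      (isClosed_eq hcont continuous_const).measurableSet
    have hmp := ((volume_preserving_piFinSuccAbove (fun _ : Fin (n + 1) => ℝ) 0).symm).comp
      (Measure.measurePreserving_swap (μ := (volume : Measure (Fin n → ℝ)))
        (ν := (volume : Measure ℝ)))
    rw [← hmp.measure_preimage hmeas.nullMeasurableSet]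
    set P := MvPolynomial.finSuccEquiv ℝ n p with hP
    have hP0 : P ≠ 0 := by
      rw [hP]; simpa using hp
    -- View p as a polynomial in one variable over the others. Off the zero set of a nonzero
    -- coefficient, null by induction, each slice has finitely many roots; Fubini concludes.
    obtain ⟨i, hi⟩ : ∃ i, P.coeff i ≠ 0 := by
      by_contra! h
      exact hP0 (Polynomial.ext (by simpa using h))
    have hae := ih (P.coeff i) hi
    refine Measure.measure_prod_null_of_ae_null (hmp.measurable hmeas) ?_
    have hae' : ∀ᵐ x : Fin n → ℝ, MvPolynomial.eval x (P.coeff i) ≠ 0 := by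
      rw [ae_iff]; simpa using hae
    filter_upwards [hae'] with x hx
    have hQ : P.map (MvPolynomial.eval x) ≠ 0 := by
      intro h
      apply hx
      rw [← Polynomial.coeff_map, h, Polynomial.coeff_zero]
    refine Set.Finite.measure_zero ((P.map (MvPolynomial.eval x)).roots.toFinset.finite_toSet.subset
      fun y hy => ?_) _
    have hy' : MvPolynomial.eval (Fin.cons y x : Fin (n + 1) → ℝ) p = 0 := by
      simpa [MeasurableEquiv.piFinSuccAbove, Fin.insertNthEquiv] using hy
    rw [MvPolynomial.eval_eq_eval_mv_eval'] at hy'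
    simpa [hQ] using hy'

/-- Precomposition with an affine scaling does not raise the total degree. -/
theorem exists_mvPolynomial_comp_affine (p : MvPolynomial (Fin 3) ℝ) (x : E3) (h : ℝ) :
    ∃ p' : MvPolynomial (Fin 3) ℝ, p'.totalDegree ≤ p.totalDegree ∧ ∀ y : E3,
      MvPolynomial.eval (fun i => y i) p' = MvPolynomial.eval (fun i => (x + h • y) i) p := by
  set g : Fin 3 → MvPolynomial (Fin 3) ℝ :=
    fun i => MvPolynomial.C (x i) + MvPolynomial.C h * MvPolynomial.X i with hg
  have hgd : ∀ i, (g i).totalDegree ≤ 1 := fun i => by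
    refine (MvPolynomial.totalDegree_add _ _).trans (max_le (by simp) ?_)
    refine (MvPolynomial.totalDegree_mul _ _).trans ?_
    simp
  refine ⟨MvPolynomial.eval₂ MvPolynomial.C g p, ?_, fun y => ?_⟩
  · rw [MvPolynomial.eval₂_eq']
    refine (MvPolynomial.totalDegree_finsetSum _ _).trans (Finset.sup_le fun d hd => ?_)
    refine (MvPolynomial.totalDegree_mul _ _).trans ?_
    rw [MvPolynomial.totalDegree_C, zero_add]
    refine (MvPolynomial.totalDegree_finsetProd _ _).trans ?_
    refine le_trans ?_ (MvPolynomial.le_totalDegree hd)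
    rw [Finsupp.sum_fintype _ _ (by simp)]
    refine Finset.sum_le_sum fun i _ => (MvPolynomial.totalDegree_pow _ _).trans ?_
    calc d i * (g i).totalDegree ≤ d i * 1 := Nat.mul_le_mul_left _ (hgd i)
      _ = d i := mul_one _
  · rw [MvPolynomial.eval₂_eq', map_sum, MvPolynomial.eval_eq']
    simp [hg]

/-- The polynomial function with coefficients `c` in the monomial basis. -/
noncomputable def monomialSum {k : ℕ} (c : (Fin 3 → Fin (k + 1)) → ℝ) (x : E3) : ℝ :=
  ∑ m, c m * ∏ i, x i ^ (m i : ℕ)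

theorem continuous_monomialSum {k : ℕ} (c : (Fin 3 → Fin (k + 1)) → ℝ) :
    Continuous (monomialSum c) := by
  unfold monomialSum; fun_prop

theorem monomialSum_sub {k : ℕ} (c d : (Fin 3 → Fin (k + 1)) → ℝ) (x : E3) :
    monomialSum (c - d) x = monomialSum c x - monomialSum d x := by
  simp [monomialSum, sub_mul]

theorem monomialSum_smul {k : ℕ} (a : ℝ) (c : (Fin 3 → Fin (k + 1)) → ℝ) (x : E3) :
    monomialSum (a • c) x = a * monomialSum c x := by
  simp [monomialSum, Finset.mul_sum, mul_assoc]

theorem abs_monomialSum_le {k : ℕ} (c : (Fin 3 → Fin (k + 1)) → ℝ) {x : E3}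
    (hx : x ∈ Metric.closedBall (0 : E3) 1) :
    |monomialSum c x| ≤ Fintype.card (Fin 3 → Fin (k + 1)) * ‖c‖ := by
  have hx' : ∀ i, |x i| ≤ 1 := fun i =>
    (PiLp.norm_apply_le x i).trans (mem_closedBall_zero_iff.mp hx)
  refine (Finset.abs_sum_le_sum_abs _ _).trans ?_
  have : ∀ m ∈ (Finset.univ : Finset (Fin 3 → Fin (k + 1))),
      |c m * ∏ i, x i ^ (m i : ℕ)| ≤ ‖c‖ := fun m _ => by
    rw [abs_mul, Finset.abs_prod]
    have h1 : ∏ i, |x i ^ (m i : ℕ)| ≤ 1 :=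
      Finset.prod_le_one (fun _ _ => abs_nonneg _) fun i _ => by
        rw [abs_pow]; exact pow_le_one₀ (abs_nonneg _) (hx' i)
    calc |c m| * ∏ i, |x i ^ (m i : ℕ)| ≤ |c m| * 1 :=
          mul_le_mul_of_nonneg_left h1 (abs_nonneg _)
      _ ≤ ‖c‖ := by rw [mul_one]; exact norm_le_pi_norm c m
  refine (Finset.sum_le_card_nsmul _ _ _ this).trans ?_
  simp

/-- Total degree at most k forces every single exponent to be at most k. The larger box of exponents
provides a finite-dimensional coefficient space, whose unit sphere is compact. -/
theorem exists_eq_monomialSum {k : ℕ} (p : MvPolynomial (Fin 3) ℝ) (hp : p.totalDegree ≤ k) :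
    ∃ c : (Fin 3 → Fin (k + 1)) → ℝ, ∀ x : E3,
      MvPolynomial.eval (fun i => x i) p = monomialSum c x := by
  classical
  refine ⟨fun m => p.coeff (Finsupp.equivFunOnFinite.symm fun i => (m i : ℕ)), fun x => ?_⟩
  rw [MvPolynomial.eval_eq', monomialSum]
  -- `Fin.ofNat` reduces modulo k + 1, which changes nothing on the support since the exponents are
  -- at most k.
  refine Finset.sum_of_injOn (fun d i => Fin.ofNat (k + 1) (d i)) ?_ (fun _ _ => by simp) ?_ ?_
  · intro d hd e he hde
    have hle : ∀ d ∈ p.support, ∀ i, d i < k + 1 := fun d hd i => by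
      have h1 := (MvPolynomial.le_totalDegree hd).trans hp
      rw [Finsupp.sum_fintype _ _ (by simp)] at h1
      have := Finset.single_le_sum (f := fun i => d i) (fun _ _ => Nat.zero_le _)
        (Finset.mem_univ i)
      omega
    ext i
    have := congrArg Fin.val (congrFun hde i)
    simpa [Fin.ofNat, Nat.mod_eq_of_lt (hle d hd i), Nat.mod_eq_of_lt (hle e he i)] using this
  · intro m _ hm
    rw [MvPolynomial.notMem_support_iff.mp, zero_mul]
    intro hd
    refine hm ⟨_, hd, ?_⟩
    ext i
    simpa [Fin.ofNat] using Nat.lt_succ_iff.mp (m i).isLt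
  · intro d hd
    have hle : ∀ i, d i < k + 1 := fun i => by
      have h1 := (MvPolynomial.le_totalDegree hd).trans hp
      rw [Finsupp.sum_fintype _ _ (by simp)] at h1
      have := Finset.single_le_sum (f := fun i => d i) (fun _ _ => Nat.zero_le _)
        (Finset.mem_univ i)
      omega
    have : (Finsupp.equivFunOnFinite.symm fun i => ((Fin.ofNat (k + 1) (d i) : Fin (k+1)) : ℕ)) = d := by
      ext i
      simp [Fin.ofNat, Nat.mod_eq_of_lt (hle i)]
    simp only [this]
    simp [Fin.ofNat, Nat.mod_eq_of_lt (hle _)]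

theorem volume_zeroSet_monomialSum {k : ℕ} (c : (Fin 3 → Fin (k + 1)) → ℝ) (hc : c ≠ 0) :
    volume {x : E3 | monomialSum c x = 0} = 0 := by
  classical
  set p : MvPolynomial (Fin 3) ℝ :=
    ∑ m, MvPolynomial.monomial (Finsupp.equivFunOnFinite.symm fun i => (m i : ℕ)) (c m) with hp
  have hp0 : p ≠ 0 := by
    intro h
    apply hc
    ext m
    have h2 := congrArg (MvPolynomial.coeff (Finsupp.equivFunOnFinite.symm fun i => (m i : ℕ))) h
    rw [hp, MvPolynomial.coeff_sum, Finset.sum_eq_single m] at h2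
    · simpa using h2
    · intro b _ hb
      rw [MvPolynomial.coeff_monomial, if_neg]
      intro hbm
      refine hb (funext fun i => Fin.ext ?_)
      simpa using DFunLike.congr_fun hbm i
    · simp
  have hev : ∀ x : E3, MvPolynomial.eval (fun i => x i) p = monomialSum c x := fun x => by
    rw [hp, map_sum, monomialSum]
    refine Finset.sum_congr rfl fun m _ => ?_
    rw [MvPolynomial.eval_monomial, Finsupp.prod_fintype _ _ (by simp)]
    simp
  have h := (EuclideanSpace.volume_preserving_symm_measurableEquiv_toLp (Fin 3)).measure_preimage
    (s := {x : Fin 3 → ℝ | MvPolynomial.eval x p = 0})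
    (isClosed_eq (MvPolynomial.continuous_eval p) continuous_const).measurableSet.nullMeasurableSet
  rw [volume_zeroSet_mvPolynomial p hp0] at h
  rw [← h]
  congr 1
  ext x
  simp only [mem_ofPred_eq, mem_preimage, ← hev]
  rfl

/-- For fixed coefficients the sublevel sets decrease to the zero set, which is null, so some δ
works. Compactness of the unit sphere of coefficients makes δ uniform. -/
theorem exists_volume_sublevel_le (k : ℕ) {m : ℝ} (hm : 0 < m) :
    ∃ δ : ℝ, 0 < δ ∧ ∀ c : (Fin 3 → Fin (k + 1)) → ℝ, ‖c‖ = 1 →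
      volume {x ∈ Metric.closedBall (0 : E3) 1 | |monomialSum c x| ≤ δ} ≤ ENNReal.ofReal m := by
  classical
  have key : ∀ c : (Fin 3 → Fin (k + 1)) → ℝ, ‖c‖ = 1 → ∃ δ : ℝ, 0 < δ ∧
      volume {x ∈ Metric.closedBall (0 : E3) 1 | |monomialSum c x| ≤ δ} ≤ ENNReal.ofReal m := by
    intro c hc
    have hc0 : c ≠ 0 := by rintro rfl; simp at hc
    set S : ℕ → Set E3 := fun n =>
      {x ∈ Metric.closedBall (0 : E3) 1 | |monomialSum c x| ≤ 1 / ((n : ℝ) + 1)} with hS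
    have hmeas : ∀ n, MeasurableSet (S n) := fun n =>
      (Metric.isClosed_closedBall.inter
        (isClosed_le (continuous_monomialSum c).abs continuous_const)).measurableSet
    have hanti : Antitone S := fun n n' hn x hx =>
      ⟨hx.1, hx.2.trans (one_div_le_one_div_of_le (by positivity) (by exact_mod_cast by omega))⟩
    have hlim := tendsto_measure_iInter_atTop (μ := (volume : Measure E3)) (s := S)
      (fun n => (hmeas n).nullMeasurableSet) hanti ⟨0, ((measure_mono fun x hx => hx.1).trans_lt
        (measure_closedBall_lt_top (x := (0 : E3)) (r := 1))).ne⟩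
    have hnull : volume (⋂ n, S n) = 0 := by
      refine measure_mono_null (fun x hx => ?_) (volume_zeroSet_monomialSum c hc0)
      rw [mem_iInter] at hx
      by_contra hne
      have hpos : 0 < |monomialSum c x| := abs_pos.mpr hne
      obtain ⟨n, hn⟩ := exists_nat_one_div_lt hpos
      exact absurd (hx n).2 (not_le.mpr hn)
    rw [hnull] at hlim
    have hev := hlim.eventually (gt_mem_nhds (ENNReal.ofReal_pos.mpr hm))
    obtain ⟨n, hn⟩ := hev.exists
    exact ⟨1 / ((n : ℝ) + 1), by positivity, le_of_lt hn⟩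
  choose! δ hδ0 hδ using key
  set N : ℝ := (Fintype.card (Fin 3 → Fin (k + 1)) : ℝ) with hN
  have hN0 : 0 < N := by rw [hN]; exact_mod_cast Fintype.card_pos
  -- A change of coefficients by δ c / (2N) moves the values on the unit ball by at most δ c / 2,
  -- which is why half of the smallest δ survives. The value `univ` off the sphere is a dummy.
  obtain ⟨t, ht, hcover⟩ := (isCompact_sphere (0 : (Fin 3 → Fin (k + 1)) → ℝ) 1).elim_nhds_subcover
    (fun c => if ‖c‖ = 1 then Metric.ball c (δ c / (2 * N)) else univ) (fun c hc => by
      have hc' : ‖c‖ = 1 := by simpa using hc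
      rw [if_pos hc']
      exact Metric.ball_mem_nhds _ (by have := hδ0 c hc'; positivity))
  have ht1 : ∀ c ∈ t, ‖c‖ = 1 := fun c hc => by simpa using ht c hc
  rcases t.eq_empty_or_nonempty with rfl | htne
  · refine ⟨1, one_pos, fun c hc => ?_⟩
    have := hcover (show c ∈ Metric.sphere (0 : (Fin 3 → Fin (k + 1)) → ℝ) 1 by simpa using hc)
    simp at this
  · obtain ⟨c₀, hc₀, hmin⟩ := t.exists_min_image δ htne
    refine ⟨δ c₀ / 2, half_pos (hδ0 c₀ (ht1 c₀ hc₀)), fun c hc => ?_⟩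
    have := hcover (show c ∈ Metric.sphere (0 : (Fin 3 → Fin (k + 1)) → ℝ) 1 by simpa using hc)
    rw [mem_iUnion₂] at this
    obtain ⟨d, hd, hcd⟩ := this
    rw [if_pos (ht1 d hd), Metric.mem_ball, dist_eq_norm] at hcd
    refine (measure_mono (t := {x ∈ Metric.closedBall (0 : E3) 1 | |monomialSum d x| ≤ δ d})
      fun x hx => ⟨hx.1, ?_⟩).trans (hδ d (ht1 d hd))
    have h1 := abs_monomialSum_le (c - d) hx.1
    rw [monomialSum_sub, ← hN] at h1
    have h2 : N * ‖c - d‖ ≤ δ d / 2 := by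
      rw [lt_div_iff₀ (by positivity)] at hcd
      nlinarith
    have h3 := abs_sub_abs_le_abs_sub (monomialSum d x) (monomialSum c x)
    rw [abs_sub_comm] at h3
    have h4 := hmin d hd
    have h5 := hx.2
    linarith

/-- On the unit ball, the `L²` norm of a polynomial is controlled by that on a subset of positive
measure. -/
theorem exists_lintegral_unitBall_le (k : ℕ) {m : ℝ} (hm : 0 < m) :
    ∃ C : ℝ, 0 < C ∧ ∀ E : Set E3, MeasurableSet E → E ⊆ Metric.closedBall 0 1 →
      ENNReal.ofReal m ≤ volume E → ∀ c : (Fin 3 → Fin (k + 1)) → ℝ,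
      ∫⁻ y in Metric.closedBall (0 : E3) 1, ENNReal.ofReal (monomialSum c y ^ 2) ≤
        ENNReal.ofReal C * ∫⁻ y in E, ENNReal.ofReal (monomialSum c y ^ 2) := by
  obtain ⟨δ, hδ0, hδ⟩ := exists_volume_sublevel_le k (half_pos hm)
  set N : ℝ := (Fintype.card (Fin 3 → Fin (k + 1)) : ℝ) with hN
  have hN0 : 0 < N := by rw [hN]; exact_mod_cast Fintype.card_pos
  set V : ℝ := (volume (Metric.closedBall (0 : E3) 1)).toReal with hV
  have hVe : volume (Metric.closedBall (0 : E3) 1) = ENNReal.ofReal V :=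
    (ENNReal.ofReal_toReal measure_closedBall_lt_top.ne).symm
  -- Quotient of the upper bound (N‖c‖)² V on the ball by the lower bound (δ‖c‖)² m/2 on E: at least
  -- half of E lies outside the sublevel set. The + 1 makes positivity immediate.
  refine ⟨(N ^ 2 * V + 1) / (δ ^ 2 * (m / 2)), by positivity, fun E hE hEB hEm c => ?_⟩
  rcases eq_or_ne c 0 with rfl | hc0
  · simp [monomialSum]
  have hcn : 0 < ‖c‖ := norm_pos_iff.mpr hc0
  have hup : ∫⁻ y in Metric.closedBall (0 : E3) 1, ENNReal.ofReal (monomialSum c y ^ 2) ≤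
      ENNReal.ofReal ((N * ‖c‖) ^ 2 * V) := by
    rw [ENNReal.ofReal_mul (by positivity), ← hVe, ← setLIntegral_const]
    refine setLIntegral_mono measurable_const fun y hy => ENNReal.ofReal_le_ofReal ?_
    rw [← sq_abs]
    exact pow_le_pow_left₀ (abs_nonneg _) (abs_monomialSum_le c hy) 2
  set F : Set E3 := E \ {x ∈ Metric.closedBall (0 : E3) 1 |
    |monomialSum (‖c‖⁻¹ • c) x| ≤ δ} with hF
  have hFm : ENNReal.ofReal (m / 2) ≤ volume F := by
    have h1 := hδ (‖c‖⁻¹ • c) (by rw [norm_smul, norm_inv, norm_norm, inv_mul_cancel₀ hcn.ne'])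
    refine le_trans ?_ le_measure_sdiff
    refine le_trans ?_ (tsub_le_tsub hEm h1)
    rw [← ENNReal.ofReal_sub _ (by positivity)]
    exact ENNReal.ofReal_le_ofReal (by linarith)
  have hlow : ENNReal.ofReal ((δ * ‖c‖) ^ 2 * (m / 2)) ≤
      ∫⁻ y in E, ENNReal.ofReal (monomialSum c y ^ 2) := by
    calc ENNReal.ofReal ((δ * ‖c‖) ^ 2 * (m / 2))
        = ENNReal.ofReal ((δ * ‖c‖) ^ 2) * ENNReal.ofReal (m / 2) :=
          ENNReal.ofReal_mul (by positivity)
      _ ≤ ENNReal.ofReal ((δ * ‖c‖) ^ 2) * volume F := by gcongr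
      _ = ∫⁻ y in F, ENNReal.ofReal ((δ * ‖c‖) ^ 2) := by rw [setLIntegral_const]
      _ ≤ ∫⁻ y in F, ENNReal.ofReal (monomialSum c y ^ 2) := by
          refine setLIntegral_mono ((continuous_monomialSum c).pow 2).measurable.ennreal_ofReal
            fun y hy => ENNReal.ofReal_le_ofReal ?_
          have h2 : ¬ |monomialSum (‖c‖⁻¹ • c) y| ≤ δ := fun h => hy.2 ⟨hEB hy.1, h⟩
          rw [monomialSum_smul, abs_mul, abs_inv, abs_norm, not_le, inv_mul_eq_div,
            lt_div_iff₀ hcn] at h2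
          rw [← sq_abs (monomialSum c y)]
          exact pow_le_pow_left₀ (by positivity) h2.le 2
      _ ≤ _ := lintegral_mono_set sdiff_subset
  refine hup.trans (le_trans ?_ (mul_le_mul_right hlow _))
  rw [← ENNReal.ofReal_mul (by positivity)]
  refine ENNReal.ofReal_le_ofReal ?_
  have : (N ^ 2 * V + 1) / (δ ^ 2 * (m / 2)) * ((δ * ‖c‖) ^ 2 * (m / 2)) =
      (N ^ 2 * V + 1) * ‖c‖ ^ 2 := by field_simp
  rw [this]
  nlinarith [sq_nonneg ‖c‖]

/-- On a ball, the `L²` norm of a polynomial is controlled by that on a subset of comparable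
measure, uniformly in the ball. -/
theorem exists_lintegral_closedBall_le (k : ℕ) {m : ℝ} (hm : 0 < m) :
    ∃ C : ℝ, 0 < C ∧ ∀ (x : E3) (h : ℝ), 0 < h → ∀ E : Set E3, MeasurableSet E →
      E ⊆ Metric.closedBall x h → ENNReal.ofReal (m * h ^ 3) ≤ volume E →
      ∀ p : MvPolynomial (Fin 3) ℝ, p.totalDegree ≤ k →
      ∫⁻ y in Metric.closedBall x h, ENNReal.ofReal (MvPolynomial.eval (fun i => y i) p ^ 2) ≤
        ENNReal.ofReal C * ∫⁻ y in E, ENNReal.ofReal (MvPolynomial.eval (fun i => y i) p ^ 2) := by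
  obtain ⟨C, hC, H⟩ := exists_lintegral_unitBall_le k hm
  refine ⟨C, hC, fun x h hh E hE hEB hEm p hp => ?_⟩
  obtain ⟨p', hp', hev⟩ := exists_mvPolynomial_comp_affine p x h
  obtain ⟨c, hc⟩ := exists_eq_monomialSum p' (hp'.trans hp)
  have hmap : Measure.map (fun y : E3 => x + h • y) volume =
      ENNReal.ofReal (h ^ 3)⁻¹ • (volume : Measure E3) := by
    have h1 : (fun y : E3 => x + h • y) = (fun y => x + y) ∘ fun y => h • y := rfl
    rw [h1, ← Measure.map_map (by fun_prop) (by fun_prop), Measure.map_addHaar_smul _ hh.ne',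
      Measure.map_smul, (measurePreserving_add_left volume x).map_eq, finrank_euclideanSpace,
      Fintype.card_fin, abs_of_pos (by positivity)]
  have hh3 : ENNReal.ofReal (h ^ 3) * ENNReal.ofReal (h ^ 3)⁻¹ = 1 := by
    rw [← ENNReal.ofReal_mul (by positivity), mul_inv_cancel₀ (by positivity), ENNReal.ofReal_one]
  have hcv : ∀ S : Set E3, MeasurableSet S →
      ∫⁻ y in S, ENNReal.ofReal (MvPolynomial.eval (fun i => y i) p ^ 2) =
        ENNReal.ofReal (h ^ 3) * ∫⁻ y in (fun y => x + h • y) ⁻¹' S,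
          ENNReal.ofReal (monomialSum c y ^ 2) := by
    intro S hS
    have hcont : Continuous fun y : E3 => MvPolynomial.eval (fun i => y i) p :=
      (MvPolynomial.continuous_eval p).comp (by fun_prop)
    have h2 := setLIntegral_map (μ := (volume : Measure E3)) (g := fun y : E3 => x + h • y) hS
      ((hcont.pow 2).measurable.ennreal_ofReal) (by fun_prop)
    rw [hmap, Measure.restrict_smul, lintegral_smul_measure] at h2
    simp only [← hc, hev, Pi.pow_apply] at h2 ⊢
    rw [← h2, smul_eq_mul, ← mul_assoc, hh3, one_mul]
  have hball : (fun y : E3 => x + h • y) ⁻¹' Metric.closedBall x h = Metric.closedBall 0 1 := by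
    ext y
    simp only [mem_preimage, Metric.mem_closedBall, dist_self_add_left, dist_zero_right, norm_smul,
      Real.norm_eq_abs, abs_of_pos hh]
    exact ⟨fun h1 => by nlinarith, fun h1 => by nlinarith⟩
  have hme : Measurable fun y : E3 => x + h • y := by fun_prop
  have hvol : ENNReal.ofReal m ≤ volume ((fun y : E3 => x + h • y) ⁻¹' E) := by
    rw [← Measure.map_apply hme hE, hmap, Measure.smul_apply, smul_eq_mul]
    refine le_trans (le_of_eq ?_) (mul_le_mul_right hEm _)
    rw [← ENNReal.ofReal_mul (by positivity)]
    congr 1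
    field_simp
  rw [hcv _ Metric.isClosed_closedBall.measurableSet, hcv _ hE, hball, mul_left_comm]
  refine mul_le_mul_right (H _ (hme hE) ?_ hvol c) _
  rw [← hball]
  exact preimage_mono hEB

end TraceFEM

namespace TraceFEM

/-! ### Orthogonal projection along a unit vector -/

/-- The orthogonal projection onto the plane orthogonal to the unit vector `ν`. -/
noncomputable def planeProj (ν : E3) : E3 →L[ℝ] E3 :=
  ContinuousLinearMap.id ℝ E3 - (innerSL ℝ ν).smulRight ν

theorem planeProj_apply (ν y : E3) : planeProj ν y = y - (inner ℝ ν y) • ν := by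
  simp [planeProj]

variable {ν : E3}

theorem inner_planeProj (hν : ‖ν‖ = 1) (y : E3) : inner ℝ ν (planeProj ν y) = 0 := by
  rw [planeProj_apply, inner_sub_right, inner_smul_right, real_inner_self_eq_norm_sq, hν]
  ring

theorem planeProj_sub_smul (hν : ‖ν‖ = 1) (y : E3) (t : ℝ) :
    planeProj ν (y - t • ν) = planeProj ν y := by
  rw [planeProj_apply, planeProj_apply, inner_sub_right, inner_smul_right,
    real_inner_self_eq_norm_sq, hν]
  module

theorem lipschitzWith_planeProj (hν : ‖ν‖ = 1) : LipschitzWith 1 (planeProj ν) := by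
  refine (planeProj ν).lipschitz.weaken ?_
  rw [← NNReal.coe_le_coe]
  refine (planeProj ν).opNorm_le_bound zero_le_one fun y => ?_
  have h : ‖planeProj ν y‖ ^ 2 = ‖y‖ ^ 2 - (inner ℝ ν y) ^ 2 := by
    rw [planeProj_apply, norm_sub_sq_real, inner_smul_right, norm_smul, hν, real_inner_comm,
      mul_one, Real.norm_eq_abs, sq_abs]
    ring
  rw [NNReal.coe_one, one_mul]
  refine le_of_sq_le_sq ?_ (norm_nonneg _)
  nlinarith [sq_nonneg (inner ℝ ν y)]

theorem euclideanHausdorffMeasure_planeProj_image_le (hν : ‖ν‖ = 1) (S : Set E3) :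
    μHE[2] (planeProj ν '' S) ≤ μHE[2] S := by
  rw [Measure.euclideanHausdorffMeasure_def, Measure.smul_apply, Measure.smul_apply]
  have := (lipschitzWith_planeProj hν).hausdorffMeasure_image_le (d := (2 : ℕ)) (by simp) S
  rw [ENNReal.coe_one, ENNReal.one_rpow, one_mul] at this
  rw [ENNReal.smul_def, ENNReal.smul_def]
  exact mul_le_mul_right this _

/-- The volume of a right cylinder is the area of the base times the height. -/
theorem volume_cylinder (hν : ‖ν‖ = 1) {G : Set E3} (hG : MeasurableSet G)
    (hG0 : ∀ y ∈ G, inner ℝ ν y = 0) (a b : ℝ) :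
    volume {y : E3 | planeProj ν y ∈ G ∧ inner ℝ ν y ∈ Icc a b} =
      ENNReal.ofReal (b - a) * μHE[2] G := by
  have hmeas : MeasurableSet {y : E3 | planeProj ν y ∈ G ∧ inner ℝ ν y ∈ Icc a b} := by
    have h1 : Measurable fun y : E3 => planeProj ν y := (planeProj ν).continuous.measurable
    have h2 : Measurable fun y : E3 => inner ℝ ν y := by fun_prop
    exact (h1 hG).inter (h2 measurableSet_Icc)
  have hν0 : ν ≠ 0 := by rintro rfl; simp at hν
  have hfr : Module.finrank ℝ E3 = 3 := by simp
  have h := EuclideanGeometry.euclideanHausdorffMeasure_eq_lintegral (0 : E3) hν0 hmeas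
  rw [hfr, EuclideanSpace.euclideanHausdorffMeasure_eq_volume] at h
  rw [h]
  have hsl : ∀ x : ℝ, μHE[3 - 1] ({y : E3 | planeProj ν y ∈ G ∧ inner ℝ ν y ∈ Icc a b} ∩
      (AffineSubspace.mk' (x • ν +ᵥ (0 : E3)) (Submodule.span ℝ {ν})ᗮ : Set E3)) =
      (Icc a b).indicator (fun _ => μHE[2] G) x := by
    intro x
    have hmem : ∀ y : E3, y ∈ (AffineSubspace.mk' (x • ν +ᵥ (0 : E3)) (Submodule.span ℝ {ν})ᗮ)
        ↔ inner ℝ ν y = x := fun y => by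
      rw [AffineSubspace.mem_mk', Submodule.mem_orthogonal_singleton_iff_inner_right]
      simp only [vadd_eq_add, add_zero, vsub_eq_sub, inner_sub_right, inner_smul_right,
        real_inner_self_eq_norm_sq, hν]
      constructor <;> intro h <;> linarith
    by_cases hx : x ∈ Icc a b
    · rw [indicator_of_mem hx, ← (isometry_add_right (x • ν)).euclideanHausdorffMeasure_image G]
      congr 1
      ext y
      simp only [mem_inter_iff, mem_ofPred_eq, SetLike.mem_coe, hmem, mem_image]
      constructor
      · rintro ⟨⟨h1, h2⟩, h3⟩
        exact ⟨_, h1, by rw [planeProj_apply, h3]; abel⟩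
      · rintro ⟨g, hg, rfl⟩
        have h3 : inner ℝ ν (g + x • ν) = x := by
          rw [inner_add_right, hG0 g hg, inner_smul_right, real_inner_self_eq_norm_sq, hν]; ring
        refine ⟨⟨?_, by rw [h3]; exact hx⟩, h3⟩
        rw [planeProj_apply, h3, add_sub_cancel_right]
        exact hg
    · rw [indicator_of_notMem hx]
      refine (congrArg _ ?_).trans (measure_empty (μ := (μHE[3 - 1] : Measure E3)))
      ext y
      simp only [mem_inter_iff, mem_ofPred_eq, SetLike.mem_coe, hmem, mem_empty_iff_false,
        iff_false]
      rintro ⟨⟨h1, h2⟩, h3⟩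
      exact hx (h3 ▸ h2)
  simp_rw [hsl]
  rw [lintegral_indicator measurableSet_Icc, setLIntegral_const, Real.volume_Icc,
    ← ofReal_norm, hν, ENNReal.ofReal_one, one_mul, mul_comm]

/-- Projection does not increase area, and A sits in a cylinder of height b − a over the shadow of
S. This converts a volume of lines hitting Γ into a lower bound for the area of Γ. -/
theorem volume_le_of_planeProj_subset (hν : ‖ν‖ = 1) {S A : Set E3} (hS : IsCompact S) {a b : ℝ}
    (hA : ∀ y ∈ A, planeProj ν y ∈ planeProj ν '' S ∧ inner ℝ ν y ∈ Icc a b) :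
    volume A ≤ ENNReal.ofReal (b - a) * μHE[2] S := by
  refine (measure_mono (t := {y : E3 | planeProj ν y ∈ planeProj ν '' S ∧
    inner ℝ ν y ∈ Icc a b}) hA).trans ?_
  rw [volume_cylinder hν (hS.image (planeProj ν).continuous).measurableSet]
  · exact mul_le_mul_right (euclideanHausdorffMeasure_planeProj_image_le hν S) _
  · rintro _ ⟨y, -, rfl⟩
    exact inner_planeProj hν y

/-- A cylinder of height D over the shadow fits into a ball of radius 2D, so the area is at most
(4π/3)·8·D² = (32π/3)D² < 34D². -/
theorem euclideanHausdorffMeasure_planeProj_le (hν : ‖ν‖ = 1) {S : Set E3} (hS : IsCompact S)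
    {c : E3} {D : ℝ} (hD : 0 < D) (hSD : S ⊆ Metric.closedBall c D) :
    μHE[2] (planeProj ν '' S) ≤ ENNReal.ofReal (34 * D ^ 2) := by
  have h0 : ∀ y ∈ planeProj ν '' S, inner ℝ ν y = 0 := by
    rintro _ ⟨y, -, rfl⟩
    exact inner_planeProj hν y
  have h1 := volume_cylinder hν (hS.image (planeProj ν).continuous).measurableSet h0
    (inner ℝ ν c) (inner ℝ ν c + D)
  have h2 : volume {y : E3 | planeProj ν y ∈ planeProj ν '' S ∧
      inner ℝ ν y ∈ Icc (inner ℝ ν c) (inner ℝ ν c + D)} ≤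
      volume (Metric.closedBall c (2 * D)) := by
    refine measure_mono ?_
    rintro y ⟨⟨s, hs, hsy⟩, hy1, hy2⟩
    have h3 : ‖planeProj ν (y - c)‖ ≤ D := by
      rw [map_sub, ← hsy, ← map_sub]
      have := (lipschitzWith_planeProj hν).dist_le_mul (s - c) 0
      simp only [NNReal.coe_one, one_mul, dist_zero_right, map_zero] at this
      exact this.trans (by simpa [dist_eq_norm] using hSD hs)
    have h4 : y - c = planeProj ν (y - c) + (inner ℝ ν (y - c)) • ν := by
      rw [planeProj_apply]; abel
    rw [Metric.mem_closedBall, dist_eq_norm, h4]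
    refine (norm_add_le _ _).trans ?_
    rw [norm_smul, hν, mul_one, inner_sub_right, Real.norm_eq_abs, abs_of_nonneg (by linarith)]
    linarith
  rw [h1, EuclideanSpace.volume_closedBall_fin_three, add_sub_cancel_left] at h2
  have hD' : ENNReal.ofReal D ≠ 0 := by simpa using hD
  rw [← ENNReal.mul_le_mul_iff_right hD' ENNReal.ofReal_ne_top]
  refine h2.trans ?_
  rw [← ENNReal.ofReal_pow (by positivity), ← ENNReal.ofReal_mul (by positivity),
    ← ENNReal.ofReal_mul (by positivity)]
  refine ENNReal.ofReal_le_ofReal ?_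
  nlinarith [Real.pi_lt_d2, pow_pos hD 3]

/-- Shrinking a convex body by a factor close to one loses little of its shadow. -/
theorem volume_shadow_diff_le (hν : ‖ν‖ = 1) {S : Set E3} (hS : IsCompact S) (hconv : Convex ℝ S)
    {c z : E3} (hz : z ∈ S) {D : ℝ} (hD : 0 < D) (hSD : S ⊆ Metric.closedBall c D) {θ : ℝ}
    (hθ0 : 0 < θ) (hθ1 : θ < 1) {a b : ℝ} (hab : a ≤ b) {A : Set E3}
    (hA : ∀ y ∈ A, planeProj ν y ∈ planeProj ν '' S ∧
      planeProj ν y ∉ planeProj ν '' (AffineMap.homothety z (1 - θ) '' S) ∧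
      inner ℝ ν y ∈ Icc a b) :
    volume A ≤ ENNReal.ofReal ((b - a) * (68 * θ * D ^ 2)) := by
  set G := planeProj ν '' S with hG
  set H := planeProj ν '' (AffineMap.homothety z (1 - θ) '' S) with hH
  have hGm : MeasurableSet G := (hS.image (planeProj ν).continuous).measurableSet
  have hHc : IsCompact H := (hS.image (AffineMap.homothety_continuous z (1 - θ))).image
    (planeProj ν).continuous
  have hHG : H ⊆ G := by
    refine image_mono ?_
    rintro _ ⟨y, hy, rfl⟩
    rw [AffineMap.homothety_eq_lineMap]
    exact hconv.segment_subset hz hy (lineMap_mem_segment ℝ z y ⟨by linarith, by linarith⟩)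
  have hHeq : H = AffineMap.homothety (planeProj ν z) (1 - θ) '' G := by
    rw [hH, hG, image_image, image_image]
    refine image_congr fun y _ => ?_
    simp [AffineMap.homothety_apply]
  have hGle := euclideanHausdorffMeasure_planeProj_le hν hS hD hSD
  -- Projection carries the homothety to a homothety of the shadow, so the lost area is at most the
  -- fraction 1 − (1 − θ)² ≤ 2θ of 34D².
  have hHmeas : μHE[2] H = ENNReal.ofReal ((1 - θ) ^ 2) * μHE[2] G := by
    rw [hHeq, euclideanHausdorffMeasure_homothety_image 2 _ (by linarith)]
    rw [ENNReal.smul_def, smul_eq_mul]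
    congr 1
    rw [ENNReal.ofReal_pow (by linarith), ENNReal.coe_pow]
    congr 1
    rw [← Real.enorm_of_nonneg (by linarith)]; rfl
  have hHfin : μHE[2] H ≠ ⊤ := ((measure_mono hHG).trans hGle).trans_lt ENNReal.ofReal_lt_top |>.ne
  have hGfin : μHE[2] G ≠ ⊤ := hGle.trans_lt ENNReal.ofReal_lt_top |>.ne
  refine (measure_mono (t := {y : E3 | planeProj ν y ∈ G \ H ∧ inner ℝ ν y ∈ Icc a b})
    fun y hy => ⟨⟨(hA y hy).1, (hA y hy).2.1⟩, (hA y hy).2.2⟩).trans ?_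
  rw [volume_cylinder hν (hGm.diff hHc.measurableSet), ENNReal.ofReal_mul (by linarith)]
  · refine mul_le_mul_right ?_ _
    rw [measure_sdiff hHG hHc.measurableSet.nullMeasurableSet hHfin, hHmeas,
      ← ENNReal.ofReal_toReal hGfin, ← ENNReal.ofReal_mul (by positivity),
      ← ENNReal.ofReal_sub _ (by positivity)]
    refine ENNReal.ofReal_le_ofReal ?_
    have h5 : (μHE[2] G).toReal ≤ 34 * D ^ 2 :=
      ENNReal.toReal_le_of_le_ofReal (by positivity) hGle
    have h6 : 0 ≤ (μHE[2] G).toReal := ENNReal.toReal_nonneg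
    nlinarith [mul_nonneg hθ0.le h6, mul_nonneg (mul_nonneg hθ0.le hθ0.le) h6]
  · rintro _ ⟨⟨y, -, rfl⟩, -⟩
    exact inner_planeProj hν y

end TraceFEM

namespace TraceFEM

/-! ### Geometry of tetrahedra -/

theorem isCompact_tet (s : Finset E3) : IsCompact (tet s) := s.finite_toSet.isCompact_convexHull ℝ

theorem convex_tet (s : Finset E3) : Convex ℝ (tet s) := convex_convexHull ℝ _

theorem mem_tet_of_mem {s : Finset E3} {u : E3} (hu : u ∈ s) : u ∈ tet s :=
  subset_convexHull ℝ _ hu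

theorem tet_mono {s t : Finset E3} (h : s ⊆ t) : tet s ⊆ tet t :=
  convexHull_mono (Finset.coe_subset.mpr h)

theorem dist_le_tetDiam {s : Finset E3} {x y : E3} (hx : x ∈ tet s) (hy : y ∈ tet s) :
    dist x y ≤ tetDiam s :=
  Metric.dist_le_diam_of_mem (isCompact_tet s).isBounded hx hy

theorem tetDiam_nonneg (s : Finset E3) : 0 ≤ tetDiam s := Metric.diam_nonneg

/-- A convex set containing a ball and a point contains the ball shrunk towards the point. -/
theorem closedBall_subset_of_convex {S : Set E3} (hS : Convex ℝ S) {x z : E3} {r θ : ℝ}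
    (hx : x ∈ S) (hz : Metric.closedBall z r ⊆ S) (h0 : 0 < θ) (h1 : θ ≤ 1) :
    Metric.closedBall (x + θ • (z - x)) (θ * r) ⊆ S := by
  intro y hy
  have hw : z + θ⁻¹ • (y - (x + θ • (z - x))) ∈ S := by
    refine hz ?_
    rw [Metric.mem_closedBall, dist_self_add_left, norm_smul, norm_inv, Real.norm_eq_abs,
      abs_of_pos h0, inv_mul_le_iff₀ h0, ← dist_eq_norm]
    exact hy
  have := hS.add_smul_sub_mem hx hw ⟨h0.le, h1⟩
  convert! this using 1
  rw [smul_sub, smul_add, smul_smul, mul_inv_cancel₀ h0.ne']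
  module

/-- The barycenter of a finite set of points. -/
noncomputable def barycenter (τ : Finset E3) : E3 := (τ.card : ℝ)⁻¹ • ∑ u ∈ τ, u

theorem barycenter_mem_tet {τ : Finset E3} (hτ : τ.Nonempty) : barycenter τ ∈ tet τ := by
  have hc : (0 : ℝ) < τ.card := by exact_mod_cast hτ.card_pos
  rw [barycenter, Finset.smul_sum]
  refine (convex_tet τ).sum_mem (fun _ _ => by positivity) ?_ fun u hu => mem_tet_of_mem hu
  rw [Finset.sum_const, nsmul_eq_mul, mul_inv_cancel₀ hc.ne']

theorem map_barycenter {τ : Finset E3} (hτ : τ.Nonempty) (f : E3 →ᵃ[ℝ] ℝ) :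
    f (barycenter τ) = (τ.card : ℝ)⁻¹ * ∑ u ∈ τ, f u := by
  have hc : (τ.card : ℝ) ≠ 0 := by exact_mod_cast hτ.card_pos.ne'
  have hf : ∀ x, f x = f.linear x + f 0 := fun x => by
    have := congrFun f.decomp x
    simpa using this
  rw [barycenter, hf, Finset.sum_congr rfl fun u _ => hf u, map_smul, map_sum,
    Finset.sum_add_distrib, Finset.sum_const, nsmul_eq_mul, mul_add, ← mul_assoc _ _ (f 0),
    inv_mul_cancel₀ hc, one_mul, smul_eq_mul]

/-- Barycentric coordinates of a nondegenerate tetrahedron. -/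
theorem exists_barycentricCoord {s : Finset E3} (hs : AffineIndependent ℝ ((↑) : s → E3))
    (h4 : s.card = 4) :
    ∃ l : E3 → E3 →ᵃ[ℝ] ℝ, (∀ u ∈ s, l u u = 1) ∧ (∀ u ∈ s, ∀ w ∈ s, u ≠ w → l u w = 0) ∧
      (∀ x, x ∈ tet s ↔ ∀ u ∈ s, 0 ≤ l u x) ∧ ∀ x ∈ tet s, ∀ u ∈ s, l u x ≤ 1 := by
  classical
  have htop : affineSpan ℝ (range ((↑) : s → E3)) = ⊤ := by
    rw [hs.affineSpan_eq_top_iff_card_eq_finrank_add_one]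
    simp [h4]
  let b : AffineBasis s ℝ E3 := ⟨(↑), hs, htop⟩
  have hb : ∀ i : s, b i = i := fun i => rfl
  have hrange : range b = (s : Set E3) := by
    ext x
    simp [hb]
  have hmem : ∀ x, x ∈ tet s ↔ ∀ i : s, 0 ≤ b.coord i x := fun x => by
    rw [← mem_ofPred_eq (p := fun x => ∀ i : s, 0 ≤ b.coord i x), ← b.convexHull_eq_nonneg_coord, hrange]
  refine ⟨fun u => if h : u ∈ s then b.coord ⟨u, h⟩ else 0, ?_, ?_, ?_, ?_⟩
  · intro u hu
    simp only [hu, dite_true]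
    exact b.coord_apply_eq ⟨u, hu⟩
  · intro u hu w hw huw
    simp only [hu, dite_true]
    exact b.coord_apply_ne (i := ⟨u, hu⟩) (j := ⟨w, hw⟩) (by simpa using huw)
  · intro x
    rw [hmem]
    refine ⟨fun h u hu => by simpa only [hu, dite_true] using h ⟨u, hu⟩,
      fun h i => by simpa only [i.2, dite_true] using h i i.2⟩
  · intro x hx u hu
    simp only [hu, dite_true]
    rw [← b.sum_coord_apply_eq_one x]
    exact Finset.single_le_sum (fun i _ => (hmem x).mp hx i) (Finset.mem_univ (⟨u, hu⟩ : s))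

/-- An affine function with values in `[0, 1]` on a ball of radius `r` is `1 / r`-Lipschitz. -/
theorem abs_sub_le_of_affine_ball {f : E3 →ᵃ[ℝ] ℝ} {z : E3} {r : ℝ} (hr : 0 < r)
    (hf : ∀ x ∈ Metric.closedBall z r, 0 ≤ f x ∧ f x ≤ 1) (x y : E3) :
    |f x - f y| ≤ dist x y / r := by
  rcases eq_or_ne x y with rfl | hxy
  · simp
  have hd : 0 < dist x y := dist_pos.mpr hxy
  have h1 : f (z + (r / dist x y) • (x - y)) - f z = (r / dist x y) * (f x - f y) := by
    have h2 : f.linear (x - y) = f x - f y := by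
      rw [← vsub_eq_sub, f.linearMap_vsub, vsub_eq_sub]
    rw [add_comm, ← vadd_eq_add, f.map_vadd, map_smul, h2]
    simp
  have h3 := hf (z + (r / dist x y) • (x - y)) (by
    rw [Metric.mem_closedBall, dist_self_add_left, norm_smul, ← dist_eq_norm, Real.norm_eq_abs,
      abs_of_pos (by positivity), div_mul_cancel₀ _ hd.ne'])
  have h4 := hf z (Metric.mem_closedBall_self hr.le)
  have h5 : |(r / dist x y) * (f x - f y)| ≤ 1 := by
    rw [← h1, abs_le]; constructor <;> linarith
  rw [abs_mul, abs_of_pos (by positivity)] at h5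
  rw [le_div_iff₀ hr]
  rw [div_mul_eq_mul_div, div_le_one hd] at h5
  linarith

/-- The barycentric coordinate of u takes values in [0, 1] on the inscribed ball, hence is
1/r-Lipschitz, yet it drops from 1 to 0 along the edge from u to w. -/
theorem le_dist_of_closedBall_subset {s : Finset E3} (hs : AffineIndependent ℝ ((↑) : s → E3))
    (h4 : s.card = 4) {z : E3} {r : ℝ} (hr : 0 < r) (hball : Metric.closedBall z r ⊆ tet s)
    {u w : E3} (hu : u ∈ s) (hw : w ∈ s) (huw : u ≠ w) : r ≤ dist u w := by
  obtain ⟨l, h1, h0, hmem, hle⟩ := exists_barycentricCoord hs h4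
  have := abs_sub_le_of_affine_ball hr
    (fun x hx => ⟨(hmem x).mp (hball hx) u hu, hle x (hball hx) u hu⟩) u w
  rw [h1 u hu, h0 u hu w hw huw, sub_zero, abs_one, le_div_iff₀ hr, one_mul] at this
  exact this

theorem le_tetDiam_of_closedBall_subset {s : Finset E3}
    (hs : AffineIndependent ℝ ((↑) : s → E3)) (h4 : s.card = 4) {z : E3} {r : ℝ} (hr : 0 < r)
    (hball : Metric.closedBall z r ⊆ tet s) : r ≤ tetDiam s := by
  obtain ⟨u, hu, w, hw, huw⟩ := Finset.one_lt_card.mp (by omega : 1 < s.card)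
  exact (le_dist_of_closedBall_subset hs h4 hr hball hu hw huw).trans
    (dist_le_tetDiam (mem_tet_of_mem hu) (mem_tet_of_mem hw))

theorem volume_tet_eq_zero {s : Finset E3} (h : s.card ≤ 3) : volume (tet s) = 0 := by
  refine measure_mono_null (convexHull_subset_affineSpan _)
    (Measure.addHaar_affineSubspace volume _ fun htop => ?_)
  rcases s.eq_empty_or_nonempty with rfl | hne
  · simp at htop
  · have h2 : Module.finrank ℝ (vectorSpan ℝ (s : Set E3)) ≤ 2 := by
      have hc := hne.card_pos
      have := finrank_vectorSpan_image_finset_le ℝ (id : E3 → E3) s (n := s.card - 1) (by omega)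
      rw [Finset.image_id] at this
      omega
    rw [← direction_affineSpan, htop, AffineSubspace.direction_top, finrank_top] at h2
    simp at h2

/-! ### Stars in a shape regular triangulation -/

variable {K : Geometry.SimplicialComplex ℝ E3} {Ω : Set E3} {σ : ℝ}

theorem finite_tetrahedra (hK : IsTriangulation K Ω) : (tetrahedra K).Finite :=
  hK.finite.subset fun _ h => h.1

theorem exists_tetrahedron_of_mem_space (hK : IsTriangulation K Ω) {x : E3} (hx : x ∈ K.space) :
    ∃ t ∈ tetrahedra K, x ∈ tet t := by
  obtain ⟨s, hs, hxs⟩ := K.mem_space_iff.mp hx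
  obtain ⟨t, ht, hst⟩ := hK.pure s hs
  exact ⟨t, ht, tet_mono hst hxs⟩

/-- By conformity the intersection lies in the hull of the common vertices, and distinct tetrahedra
share at most three. -/
theorem volume_tet_inter_tet {s t : Finset E3} (hs : s ∈ tetrahedra K) (ht : t ∈ tetrahedra K)
    (hst : s ≠ t) : volume (tet s ∩ tet t) = 0 := by
  classical
  refine measure_mono_null (K.inter_subset_convexHull hs.1 ht.1) ?_
  rw [← Finset.coe_inter]
  refine volume_tet_eq_zero ?_
  by_contra! h
  have h1 : s ∩ t = s := Finset.eq_of_subset_of_card_le Finset.inter_subset_left (by rw [hs.2]; omega)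
  have h2 : s ∩ t = t := Finset.eq_of_subset_of_card_le Finset.inter_subset_right (by rw [ht.2]; omega)
  exact hst (h1.symm.trans h2)

/-- Tetrahedra meeting a small ball contain its centre. -/
theorem exists_forall_mem_tet (hK : IsTriangulation K Ω) (x : E3) :
    ∃ ε : ℝ, 0 < ε ∧ ∀ t ∈ tetrahedra K, ∀ y ∈ tet t, dist y x < ε → x ∈ tet t := by
  -- The tetrahedra avoiding x form a finite, hence closed, union, which stays at positive distance
  -- from x.
  set F : Set E3 := ⋃ t ∈ {t ∈ tetrahedra K | x ∉ tet t}, tet t with hF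
  have hcl : IsClosed F := ((finite_tetrahedra hK).subset (sep_subset _ _)).isClosed_biUnion
    fun t _ => (isCompact_tet t).isClosed
  have hx : x ∈ Fᶜ := by
    intro h
    obtain ⟨t, ht, hxt⟩ := mem_iUnion₂.mp h
    exact ht.2 hxt
  obtain ⟨ε, hε, hball⟩ := Metric.isOpen_iff.mp hcl.isOpen_compl x hx
  refine ⟨ε, hε, fun t ht y hy hyx => ?_⟩
  by_contra hxt
  exact hball hyx (mem_iUnion₂.mpr ⟨t, ⟨ht, hxt⟩, hy⟩)

/-- The tetrahedra containing the barycenter of a face are those having it as a face. -/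
theorem subset_of_barycenter_mem {s t τ : Finset E3} (hs : s ∈ tetrahedra K)
    (ht : t ∈ tetrahedra K) (hτ : τ.Nonempty) (hτs : τ ⊆ s) (h : barycenter τ ∈ tet t) : τ ⊆ t := by
  intro u hu
  by_contra hut
  obtain ⟨l, h1, h0, hmem, -⟩ := exists_barycentricCoord (K.indep hs.1) hs.2
  -- If u were not a vertex of t, its coordinate in s would vanish on the common face, which
  -- contains the barycenter of τ; but there it is at least 1 / card τ.
  have hzero : ∀ x ∈ convexHull ℝ ((s : Set E3) ∩ t), l u x = 0 := by
    intro x hx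
    have hsub : ((s : Set E3) ∩ t) ⊆ l u ⁻¹' {0} := fun w hw => by
      refine h0 u (hτs hu) w hw.1 ?_
      rintro rfl
      exact hut hw.2
    exact convexHull_min hsub ((convex_singleton (0 : ℝ)).affine_preimage (l u)) hx
  have h2 := hzero _ (K.inter_subset_convexHull hs.1 ht.1
    ⟨tet_mono hτs (barycenter_mem_tet hτ), h⟩)
  rw [map_barycenter hτ] at h2
  have h3 : (1 : ℝ) ≤ ∑ w ∈ τ, l u w := by
    rw [← h1 u (hτs hu)]
    exact Finset.single_le_sum (f := fun w => l u w)
      (fun w hw => (hmem w).mp (mem_tet_of_mem (hτs hw)) u (hτs hu)) hu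
  have hc : (0 : ℝ) < (τ.card : ℝ)⁻¹ := by
    have := hτ.card_pos
    positivity
  nlinarith

/-- The star of a face covers a ball about its barycenter, of radius comparable to the inradii. -/
theorem exists_mem_star (hK : IsTriangulation K Ω) {τ : Finset E3} (hτ : τ.Nonempty)
    {s : Finset E3} (hs : s ∈ tetrahedra K) (hτs : τ ⊆ s) {y : E3}
    (hseg : segment ℝ (barycenter τ) y ⊆ K.space)
    (hr : ∀ t ∈ tetrahedra K, τ ⊆ t → ∃ z r, 0 < r ∧ Metric.closedBall z r ⊆ tet t ∧
      dist y (barycenter τ) ≤ r / 4) :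
    ∃ t ∈ tetrahedra K, τ ⊆ t ∧ y ∈ tet t := by
  set v := barycenter τ with hv
  obtain ⟨ε, hε, hnear⟩ := exists_forall_mem_tet hK v
  -- The tetrahedron is found infinitesimally: a point of the segment so close to v that any
  -- tetrahedron containing it contains v, hence has τ as a face. The aim is that it contains y as
  -- well.
  set a : ℝ := min 1 (ε / (2 * (dist y v + 1))) with ha
  have hdp : 0 < dist y v + 1 := by positivity
  have ha0 : 0 < a := by rw [ha]; positivity
  have ha1 : a ≤ 1 := min_le_left _ _
  have hp : v + a • (y - v) ∈ segment ℝ v y := by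
    rw [segment_eq_image']
    exact ⟨a, ⟨ha0.le, ha1⟩, rfl⟩
  obtain ⟨t, ht, hpt⟩ := exists_tetrahedron_of_mem_space hK (hseg hp)
  have hvt : v ∈ tet t := by
    refine hnear t ht _ hpt ?_
    rw [dist_self_add_left, norm_smul, ← dist_eq_norm, Real.norm_eq_abs, abs_of_pos ha0]
    have h1 : a * (2 * (dist y v + 1)) ≤ ε := by
      rw [← le_div_iff₀ (by positivity)]; exact min_le_right _ _
    nlinarith [dist_nonneg (x := y) (y := v)]
  have hτt : τ ⊆ t := subset_of_barycenter_mem hs ht hτ hτs hvt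
  refine ⟨t, ht, hτt, ?_⟩
  obtain ⟨l, h1, h0, hmem, hle⟩ := exists_barycentricCoord (K.indep ht.1) ht.2
  rw [hmem]
  intro u hu
  -- Coordinates at vertices of τ are at least 1/4 at v and drop by at most 1/4 on the way to y. The
  -- others vanish at v, so they have the same sign at y as at the nearby point.
  by_cases huτ : u ∈ τ
  · obtain ⟨z, r, hr0, hball, hyr⟩ := hr t ht hτt
    have h2 := abs_sub_le_of_affine_ball hr0
      (fun x hx => ⟨(hmem x).mp (hball hx) u hu, hle x (hball hx) u hu⟩) y v
    have h3 : dist y v / r ≤ 1 / 4 := by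
      rw [div_le_iff₀ hr0]; linarith
    have h4 : (1 : ℝ) / 4 ≤ l u v := by
      rw [hv, map_barycenter hτ]
      have h5 : (1 : ℝ) ≤ ∑ w ∈ τ, l u w := by
        rw [← h1 u hu]
        exact Finset.single_le_sum (f := fun w => l u w)
          (fun w hw => (hmem w).mp (mem_tet_of_mem (hτt hw)) u hu) huτ
      have h6 : (τ.card : ℝ) ≤ 4 := by
        have := Finset.card_le_card hτt
        rw [ht.2] at this
        exact_mod_cast this
      have h7 : (0 : ℝ) < τ.card := by exact_mod_cast hτ.card_pos
      have h8 : (1 : ℝ) / 4 ≤ (τ.card : ℝ)⁻¹ := by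
        rw [one_div]; exact inv_anti₀ h7 h6
      nlinarith
    have := (abs_le.mp (h2.trans h3)).1
    linarith
  · have h2 : l u v = 0 := by
      rw [hv, map_barycenter hτ, Finset.sum_eq_zero, mul_zero]
      intro w hw
      exact h0 u hu w (hτt hw) (by rintro rfl; exact huτ hw)
    have h3 : l u (v + a • (y - v)) = (1 - a) * l u v + a * l u y := by
      have := (l u).apply_lineMap v y a
      rw [AffineMap.lineMap_apply_module', AffineMap.lineMap_apply_module] at this
      rw [add_comm v, this, smul_eq_mul, smul_eq_mul]
    have h4 := (hmem _).mp hpt u hu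
    rw [h3, h2, mul_zero, zero_add] at h4
    exact nonneg_of_mul_nonneg_right h4 ha0

/-- From r ≤ h_T ≤ σ r. For σ < 1 there are no admissible tetrahedra at all. -/
theorem one_le_of_isShapeRegular (hσ : IsShapeRegular K σ) {s : Finset E3}
    (hs : s ∈ tetrahedra K) : 1 ≤ σ := by
  obtain ⟨z, r, hr, hball, hle⟩ := hσ s hs
  have := le_tetDiam_of_closedBall_subset (K.indep hs.1) hs.2 hr hball
  by_contra! h
  nlinarith

theorem tetDiam_pos (hσ : IsShapeRegular K σ) {s : Finset E3} (hs : s ∈ tetrahedra K) :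
    0 < tetDiam s := by
  obtain ⟨z, r, hr, hball, -⟩ := hσ s hs
  exact hr.trans_le (le_tetDiam_of_closedBall_subset (K.indep hs.1) hs.2 hr hball)

/-- Every edge of s is at least as long as its inradius, and the common edge is no longer than the
diameter of t. -/
theorem tetDiam_le_of_common_edge (hσ : IsShapeRegular K σ) {s t : Finset E3}
    (hs : s ∈ tetrahedra K) {u w : E3} (hus : u ∈ s) (hws : w ∈ s)
    (hut : u ∈ t) (hwt : w ∈ t) (huw : u ≠ w) : tetDiam s ≤ σ * tetDiam t := by
  have h1 := one_le_of_isShapeRegular hσ hs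
  obtain ⟨z, r, hr, hball, hle⟩ := hσ s hs
  have h2 := le_dist_of_closedBall_subset (K.indep hs.1) hs.2 hr hball hus hws huw
  have h3 := dist_le_tetDiam (mem_tet_of_mem hut) (mem_tet_of_mem hwt)
  exact hle.trans (by gcongr; linarith)

/-- The number of tetrahedra sharing a point is bounded in terms of the shape regularity. -/
theorem card_le_of_forall_mem_tet (hσ : IsShapeRegular K σ) (x : E3) (S : Finset (Finset E3))
    (hne : S.Nonempty) (hS : ∀ t ∈ S, t ∈ tetrahedra K ∧ x ∈ tet t) : (S.card : ℝ) ≤ 8 * σ ^ 3 := by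
  obtain ⟨t₀, ht₀, hmin⟩ := S.exists_min_image tetDiam hne
  set d := tetDiam t₀ with hd
  have hd0 : 0 < d := tetDiam_pos hσ (hS t₀ ht₀).1
  have hσ1 := one_le_of_isShapeRegular hσ (hS t₀ ht₀).1
  -- Packing: shrinking each tetrahedron towards x to the smallest diameter d gives balls of radius
  -- d/σ inside one ball of radius 2d, with null overlaps.
  have hex : ∀ t ∈ S, ∃ c, Metric.closedBall c (d / σ) ⊆ tet t ∩ Metric.closedBall x (2 * d) := by
    intro t ht
    obtain ⟨z, r, hr, hball, hle⟩ := hσ t (hS t ht).1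
    have hdt := hmin t ht
    have htp : 0 < tetDiam t := hd0.trans_le hdt
    have hrt := le_tetDiam_of_closedBall_subset (K.indep (hS t ht).1.1) (hS t ht).1.2 hr hball
    have hzx : dist z x ≤ tetDiam t :=
      dist_le_tetDiam (hball (Metric.mem_closedBall_self hr.le)) (hS t ht).2
    have h1 := closedBall_subset_of_convex (convex_tet t) (hS t ht).2 hball
      (div_pos hd0 htp) ((div_le_one htp).mpr hdt)
    have h2 : d / σ ≤ d / tetDiam t * r := by
      rw [div_mul_eq_mul_div, div_le_div_iff₀ (by linarith) htp]
      nlinarith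
    refine ⟨x + (d / tetDiam t) • (z - x), subset_inter
      ((Metric.closedBall_subset_closedBall h2).trans h1) ?_⟩
    refine Metric.closedBall_subset_closedBall' ?_
    rw [dist_self_add_left, norm_smul, ← dist_eq_norm, Real.norm_eq_abs, abs_of_pos (by positivity)]
    have h3 : d / tetDiam t * dist z x ≤ d := by
      rw [div_mul_eq_mul_div, div_le_iff₀ htp]; gcongr
    have h4 : d / σ ≤ d := div_le_self hd0.le hσ1
    linarith
  choose! c hc using hex
  have hsum : ∑ t ∈ S, volume (Metric.closedBall (c t) (d / σ)) ≤
      volume (Metric.closedBall x (2 * d)) := by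
    rw [← measure_biUnion_finset₀]
    · exact measure_mono (iUnion₂_subset fun t ht => (hc t ht).trans inter_subset_right)
    · intro t ht t' ht' htt'
      refine measure_mono_null (inter_subset_inter ((hc t ht).trans inter_subset_left)
        ((hc t' ht').trans inter_subset_left))
        (volume_tet_inter_tet (hS t ht).1 (hS t' ht').1 htt')
    · exact fun t _ => Metric.isClosed_closedBall.measurableSet.nullMeasurableSet
  simp_rw [EuclideanSpace.volume_closedBall_fin_three] at hsum
  rw [Finset.sum_const, nsmul_eq_mul, ← ENNReal.ofReal_pow (by positivity),
    ← ENNReal.ofReal_pow (by positivity), ← ENNReal.ofReal_mul (by positivity),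
    ← ENNReal.ofReal_mul (by positivity), ← ENNReal.ofReal_natCast,
    ← ENNReal.ofReal_mul (by positivity), ENNReal.ofReal_le_ofReal_iff (by positivity)] at hsum
  have hpi := Real.pi_pos
  have h5 : (S.card : ℝ) * (d / σ) ^ 3 ≤ (2 * d) ^ 3 := by
    have h6 : 0 < Real.pi * 4 / 3 := by positivity
    nlinarith
  rw [div_pow, mul_div_assoc', div_le_iff₀ (by positivity)] at h5
  have h7 : 0 < d ^ 3 := by positivity
  nlinarith

/-- The link of an interior vertex is connected: the star cannot be split into two parts without
common edges. -/
theorem exists_common_edge (hK : IsTriangulation K Ω) (hσ : IsShapeRegular K σ) {u : E3} {ρ : ℝ}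
    (hρ : 0 < ρ) (hball : Metric.closedBall u ρ ⊆ K.space) {s₁ s₂ : Finset E3}
    (S : Set (Finset E3)) (hS : ∀ t ∈ S, t ∈ tetrahedra K ∧ u ∈ t) (hs₁ : s₁ ∈ S)
    (hs₂ : s₂ ∈ tetrahedra K) (hus₂ : u ∈ s₂) (hs₂S : s₂ ∉ S) :
    ∃ t₁ ∈ S, ∃ t₂ ∈ tetrahedra K, u ∈ t₂ ∧ t₂ ∉ S ∧ ∃ w, w ≠ u ∧ w ∈ t₁ ∧ w ∈ t₂ := by
  obtain ⟨ε, hε, hnear⟩ := exists_forall_mem_tet hK u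
  have hvert : ∀ t ∈ tetrahedra K, u ∈ tet t → u ∈ t := fun t ht h => by
    refine (K.vertex_mem_convexHull_iff (K.down_closed (hS s₁ hs₁).1.1 (t := {u}) ?_ ?_) ht.1).mp h
    · simpa using (hS s₁ hs₁).2
    · simp
  -- The sphere must lie in the mesh, meet only tetrahedra at u, and reach both s₁ and s₂; the last
  -- holds because edges are longer than diameter over σ.
  obtain ⟨δ, hδ0, hδε, hδρ, hδ1, hδ2⟩ : ∃ δ, 0 < δ ∧ δ < ε ∧ δ ≤ ρ ∧ δ < tetDiam s₁ / σ ∧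
      δ < tetDiam s₂ / σ := by
    have h1 := tetDiam_pos hσ (hS s₁ hs₁).1
    have h2 := tetDiam_pos hσ hs₂
    have h3 := one_le_of_isShapeRegular hσ hs₂
    have h4 : 0 < min (min ε ρ) (min (tetDiam s₁ / σ) (tetDiam s₂ / σ)) := by positivity
    refine ⟨min (min ε ρ) (min (tetDiam s₁ / σ) (tetDiam s₂ / σ)) / 2, half_pos h4,
      (half_lt_self h4).trans_le ((min_le_left _ _).trans (min_le_left _ _)),
      (half_lt_self h4).le.trans ((min_le_left _ _).trans (min_le_right _ _)),
      (half_lt_self h4).trans_le ((min_le_right _ _).trans (min_le_left _ _)),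
      (half_lt_self h4).trans_le ((min_le_right _ _).trans (min_le_right _ _))⟩
  have hsph : IsPreconnected (Metric.sphere u δ) := by
    refine isPreconnected_sphere ?_ u δ
    rw [rank_eq_card_basis (EuclideanSpace.basisFun (Fin 3) ℝ).toBasis]
    norm_num
  have hit : ∀ t ∈ tetrahedra K, u ∈ t → δ < tetDiam t / σ → (Metric.sphere u δ ∩ tet t).Nonempty := by
    intro t ht hut hδt
    obtain ⟨z, r, hr, hzr, hle⟩ := hσ t ht
    obtain ⟨w, hw, hwu⟩ := Finset.exists_mem_ne (by rw [ht.2]; norm_num) u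
    have hrd := le_dist_of_closedBall_subset (K.indep ht.1) ht.2 hr hzr hw hut hwu
    have hσ0 : 0 < σ := lt_of_lt_of_le one_pos (one_le_of_isShapeRegular hσ ht)
    have hd0 : 0 < dist w u := hr.trans_le hrd
    have hδd : δ ≤ dist w u := by
      rw [lt_div_iff₀ hσ0] at hδt
      nlinarith
    refine ⟨u + (δ / dist w u) • (w - u), ?_, (convex_tet t).add_smul_sub_mem (mem_tet_of_mem hut)
      (mem_tet_of_mem hw) ⟨by positivity, (div_le_one hd0).mpr hδd⟩⟩
    rw [Metric.mem_sphere, dist_self_add_left, norm_smul, ← dist_eq_norm, Real.norm_eq_abs,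
      abs_of_pos (by positivity), div_mul_cancel₀ _ hd0.ne']
  set F₁ : Set E3 := ⋃ t ∈ S, tet t with hF₁
  set F₂ : Set E3 := ⋃ t ∈ {t | t ∈ tetrahedra K ∧ u ∈ t ∧ t ∉ S}, tet t with hF₂
  have hc₁ : IsClosed F₁ := ((finite_tetrahedra hK).subset fun t ht => (hS t ht).1).isClosed_biUnion
    fun t _ => (isCompact_tet t).isClosed
  have hc₂ : IsClosed F₂ := ((finite_tetrahedra hK).subset fun t ht => ht.1).isClosed_biUnion
    fun t _ => (isCompact_tet t).isClosed
  have hcov : Metric.sphere u δ ⊆ F₁ ∪ F₂ := by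
    intro y hy
    obtain ⟨t, ht, hyt⟩ := exists_tetrahedron_of_mem_space hK
      (hball (Metric.closedBall_subset_closedBall hδρ (Metric.sphere_subset_closedBall hy)))
    have hut := hvert t ht (hnear t ht y hyt (by rw [Metric.mem_sphere.mp hy]; exact hδε))
    by_cases htS : t ∈ S
    · exact Or.inl (mem_iUnion₂.mpr ⟨t, htS, hyt⟩)
    · exact Or.inr (mem_iUnion₂.mpr ⟨t, ⟨ht, hut, htS⟩, hyt⟩)
  obtain ⟨p₁, hp₁, hp₁'⟩ := hit s₁ (hS s₁ hs₁).1 (hS s₁ hs₁).2 hδ1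
  obtain ⟨p₂, hp₂, hp₂'⟩ := hit s₂ hs₂ hus₂ hδ2
  -- The connected sphere is covered by two closed sets, both hit, so they share a point p. If the
  -- two tetrahedra at p had only u in common, conformity would force p = u.
  obtain ⟨p, hp, hpF₁, hpF₂⟩ := isPreconnected_closed_iff.mp hsph F₁ F₂ hc₁ hc₂ hcov
    ⟨p₁, hp₁, mem_iUnion₂.mpr ⟨s₁, hs₁, hp₁'⟩⟩
    ⟨p₂, hp₂, mem_iUnion₂.mpr ⟨s₂, ⟨hs₂, hus₂, hs₂S⟩, hp₂'⟩⟩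
  obtain ⟨t₁, ht₁, hpt₁⟩ := mem_iUnion₂.mp hpF₁
  obtain ⟨t₂, ht₂, hpt₂⟩ := mem_iUnion₂.mp hpF₂
  refine ⟨t₁, ht₁, t₂, ht₂.1, ht₂.2.1, ht₂.2.2, ?_⟩
  by_contra! hno
  have h1 := K.inter_subset_convexHull (hS t₁ ht₁).1.1 ht₂.1.1 ⟨hpt₁, hpt₂⟩
  have h2 : (t₁ : Set E3) ∩ t₂ ⊆ {u} := fun w hw => by
    by_contra hwu
    exact hno w hwu hw.1 hw.2
  have h3 := convexHull_mono h2 h1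
  rw [convexHull_singleton, mem_singleton_iff] at h3
  rw [h3, Metric.mem_sphere, dist_self] at hp
  exact hδ0.ne hp

/-- Tetrahedra sharing an interior vertex have comparable diameters. -/
theorem tetDiam_le_of_common_vertex (hK : IsTriangulation K Ω) (hσ : IsShapeRegular K σ) {u : E3}
    {ρ : ℝ} (hρ : 0 < ρ) (hball : Metric.closedBall u ρ ⊆ K.space) {s t : Finset E3}
    (hs : s ∈ tetrahedra K) (hus : u ∈ s) (ht : t ∈ tetrahedra K) (hut : u ∈ t) :
    tetDiam t ≤ σ ^ ⌈8 * σ ^ 3⌉₊ * tetDiam s := by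
  classical
  have hσ1 := one_le_of_isShapeRegular hσ hs
  have hs0 := tetDiam_nonneg s
  -- Starting from s, one tetrahedron with a common edge is added at a time, at the cost of a factor
  -- σ, until the star is exhausted. The packing bound limits the number of additions.
  have key : ∀ n : ℕ, ∃ S : Finset (Finset E3), s ∈ S ∧
      (∀ t ∈ S, (t ∈ tetrahedra K ∧ u ∈ t) ∧ tetDiam t ≤ σ ^ n * tetDiam s) ∧
      (n + 1 ≤ S.card ∨ ∀ t ∈ tetrahedra K, u ∈ t → t ∈ S) := by
    intro n
    induction n with
    | zero => exact ⟨{s}, by simp, by simp [hs, hus], by simp⟩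
    | succ n ih =>
      obtain ⟨S, hsS, hS, hcard⟩ := ih
      have hmono : ∀ t ∈ S, tetDiam t ≤ σ ^ (n + 1) * tetDiam s := fun t ht =>
        (hS t ht).2.trans (by gcongr; exact Nat.le_succ n)
      by_cases hall : ∀ t ∈ tetrahedra K, u ∈ t → t ∈ S
      · exact ⟨S, hsS, fun t ht => ⟨(hS t ht).1, hmono t ht⟩, Or.inr hall⟩
      · have hcard' := hcard.resolve_right hall
        push Not at hall
        obtain ⟨t', ht', hut', ht'S⟩ := hall
        obtain ⟨t₁, ht₁, t₂, ht₂, hut₂, ht₂S, w, hwu, hw₁, hw₂⟩ :=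
          exists_common_edge hK hσ hρ hball (S : Set (Finset E3)) (fun t ht => (hS t ht).1) hsS
            ht' hut' ht'S
        refine ⟨insert t₂ S, Finset.mem_insert_of_mem hsS, fun t ht => ?_, Or.inl ?_⟩
        · rcases Finset.mem_insert.mp ht with rfl | ht
          · refine ⟨⟨ht₂, hut₂⟩, ?_⟩
            have h1 := tetDiam_le_of_common_edge hσ ht₂ hw₂ hut₂ hw₁ (hS t₁ ht₁).1.2 hwu
            have h2 := (hS t₁ ht₁).2
            calc tetDiam t ≤ σ * tetDiam t₁ := h1
              _ ≤ σ * (σ ^ n * tetDiam s) := by gcongr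
              _ = σ ^ (n + 1) * tetDiam s := by ring
          · exact ⟨(hS t ht).1, hmono t ht⟩
        · rw [Finset.card_insert_of_notMem ht₂S]
          omega
  obtain ⟨S, hsS, hS, hcard⟩ := key ⌈8 * σ ^ 3⌉₊
  rcases hcard with hcard | hall
  · exfalso
    have h1 := card_le_of_forall_mem_tet hσ u S ⟨s, hsS⟩
      fun t ht => ⟨(hS t ht).1.1, mem_tet_of_mem (hS t ht).1.2⟩
    have h2 := Nat.le_ceil (8 * σ ^ 3)
    have h3 : ((⌈8 * σ ^ 3⌉₊ : ℝ) + 1) ≤ S.card := by exact_mod_cast hcard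
    linarith
  · exact (hS t (hall t ht hut)).2

end TraceFEM

namespace TraceFEM

/-! ### Local flatness of the surface -/

variable {Γ O Ω : Set E3} {n : E3 → E3} {κ : ℝ}

theorem inner_gradient_eq_fderiv (f : E3 → ℝ) (x v : E3) :
    inner ℝ (gradient f x) v = fderiv ℝ f x v := by
  rw [gradient, InnerProductSpace.toDual_symm_apply]

/-- With ∇φ(x₀) = a n(x₀), the function φ/a has gradient n(x₀), and strict differentiability
compares it with its linearization between any two nearby points, not just from x₀. -/
theorem exists_local_flat (hΓ : Γ ⊆ Ω) (hΩ : IsOpen Ω) (hn : IsNormalExtension Γ O n κ) {η : ℝ}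
    (hη : 0 < η) {x₀ : E3} (hx₀ : x₀ ∈ Γ) :
    ∃ R : ℝ, 0 < R ∧ Metric.ball x₀ R ⊆ O ∩ Ω ∧ (∀ x ∈ Metric.ball x₀ R, ‖n x - n x₀‖ ≤ η) ∧
      ∃ φ : E3 → ℝ, (∀ y ∈ Metric.ball x₀ R, y ∈ Γ ↔ φ y = 0) ∧
        ∀ y ∈ Metric.ball x₀ R, ∀ y' ∈ Metric.ball x₀ R,
          |φ y - φ y' - inner ℝ (n x₀) (y - y')| ≤ η * dist y y' := by
  obtain ⟨hn1, U, φ, hφ, a, ha⟩ := hn.isUnitNormal x₀ hx₀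
  have ha0 : a ≠ 0 := by
    rintro rfl
    exact hφ.gradient_ne_zero x₀ hφ.mem (by rw [ha, zero_smul])
  have hO : O ∈ nhds x₀ := hn.isOpen.mem_nhds (hn.subset hx₀)
  have hΩ' : Ω ∈ nhds x₀ := hΩ.mem_nhds (hΓ hx₀)
  have hU : U ∈ nhds x₀ := hφ.isOpen.mem_nhds hφ.mem
  have hcont : ContinuousAt n x₀ := hn.contDiffOn.continuousOn.continuousAt hO
  have hnn : ∀ᶠ x in nhds x₀, ‖n x - n x₀‖ ≤ η := by
    filter_upwards [Metric.continuousAt_iff'.mp hcont η hη] with x hx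
    rw [← dist_eq_norm]; exact hx.le
  have hstrict : HasStrictFDerivAt φ (fderiv ℝ φ x₀) x₀ :=
    (hφ.contDiffOn.contDiffAt hU).hasStrictFDerivAt (by norm_num)
  -- The tolerance η|a| becomes η after division by a.
  have hev := hstrict.isLittleO.def (mul_pos hη (abs_pos.mpr ha0))
  obtain ⟨R₁, hR₁, h₁⟩ := Metric.eventually_nhds_iff_ball.mp hnn
  obtain ⟨R₂, hR₂, h₂⟩ := Metric.eventually_nhds_iff_ball.mp hev
  obtain ⟨R₃, hR₃, h₃⟩ := Metric.mem_nhds_iff.mp (Filter.inter_mem hU (Filter.inter_mem hO hΩ'))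
  have hsub : ∀ {y}, y ∈ Metric.ball x₀ (min R₁ (min R₂ R₃)) →
      y ∈ Metric.ball x₀ R₁ ∧ y ∈ Metric.ball x₀ R₂ ∧ y ∈ Metric.ball x₀ R₃ := fun {y} hy => by
    simpa [lt_min_iff] using hy
  refine ⟨min R₁ (min R₂ R₃), by positivity, fun y hy => (h₃ (hsub hy).2.2).2,
    fun y hy => h₁ y (hsub hy).1, fun y => φ y / a, fun y hy => ?_, fun y hy y' hy' => ?_⟩
  · have hyU : y ∈ U := (h₃ (hsub hy).2.2).1
    have := Set.ext_iff.mp hφ.inter_eq y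
    simp only [mem_inter_iff, hyU, and_true, mem_ofPred_eq, true_and] at this
    rw [this, div_eq_zero_iff, or_iff_left ha0]
  · have h4 := h₂ (y, y') (by
      rw [← ball_prod_same]; exact ⟨(hsub hy).2.1, (hsub hy').2.1⟩)
    simp only [← inner_gradient_eq_fderiv, ha, inner_smul_left, Real.norm_eq_abs] at h4
    rw [dist_eq_norm]
    have h5 : φ y / a - φ y' / a - inner ℝ (n x₀) (y - y') =
        (φ y - φ y' - a * inner ℝ (n x₀) (y - y')) / a := by field_simp
    rw [h5, abs_div, div_le_iff₀ (abs_pos.mpr ha0)]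
    refine (le_of_eq ?_).trans (h4.trans (le_of_eq ?_))
    · simp
    · ring

/-- Near each of its points, at a uniform scale, the surface is the zero set of a function that is
close to the affine function given by the normal. -/
theorem exists_uniform_flat (hΓ : IsClosedSurface Γ) (hΓΩ : Γ ⊆ Ω) (hΩ : IsOpen Ω)
    (hn : IsNormalExtension Γ O n κ) {η : ℝ} (hη : 0 < η) :
    ∃ R : ℝ, 0 < R ∧ ∀ x ∈ Γ, Metric.ball x R ⊆ O ∩ Ω ∧
      ∃ φ : E3 → ℝ, (∀ y ∈ Metric.ball x R, y ∈ Γ ↔ φ y = 0) ∧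
        ∀ y ∈ Metric.ball x R, ∀ y' ∈ Metric.ball x R,
          |φ y - φ y' - inner ℝ (n x) (y - y')| ≤ η * dist y y' := by
  -- Half of η is kept to replace the normal at the centre x₀ of a covering ball by the normal at x;
  -- a Lebesgue number gives the common radius.
  have hloc := fun x : Γ => exists_local_flat hΓΩ hΩ hn (half_pos hη) x.2
  choose R hR hsub hnR φ hφ hflat using hloc
  obtain ⟨δ, hδ, hleb⟩ := lebesgue_number_lemma_of_metric (c := fun x : Γ => Metric.ball (x : E3) (R x))
    hΓ.isCompact (fun _ => Metric.isOpen_ball)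
    fun x hx => mem_iUnion.mpr ⟨⟨x, hx⟩, Metric.mem_ball_self (hR _)⟩
  refine ⟨δ, hδ, fun x hx => ?_⟩
  obtain ⟨x₀, hx₀⟩ := hleb x hx
  refine ⟨hx₀.trans (hsub x₀), φ x₀, fun y hy => hφ x₀ y (hx₀ hy), fun y hy y' hy' => ?_⟩
  have h1 := hflat x₀ y (hx₀ hy) y' (hx₀ hy')
  have h2 := hnR x₀ x (hx₀ (Metric.mem_ball_self hδ))
  have h3 : |inner ℝ (n x - n x₀) (y - y')| ≤ η / 2 * dist y y' := by
    refine (abs_real_inner_le_norm _ _).trans ?_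
    rw [dist_eq_norm]
    gcongr
  rw [inner_sub_left] at h3
  have h4 : φ x₀ y - φ x₀ y' - inner ℝ (n x) (y - y') =
      (φ x₀ y - φ x₀ y' - inner ℝ (n x₀) (y - y')) -
        (inner ℝ (n x) (y - y') - inner ℝ (n x₀) (y - y')) := by ring
  rw [h4]
  refine (abs_sub _ _).trans ?_
  linarith

end TraceFEM

namespace TraceFEM

/-! ### Integration along lines -/

/-- Cauchy–Schwarz against the constant 1, read off from 0 ≤ ∫ (Lg − A)² = L(LB − A²). -/
theorem sq_integral_le_of_bounded {J : Set ℝ} (hJ : volume J ≠ ⊤) {g : ℝ → ℝ}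
    (hg : IntegrableOn g J) (hg2 : IntegrableOn (fun t => g t ^ 2) J) :
    (∫ t in J, g t) ^ 2 ≤ volume.real J * ∫ t in J, g t ^ 2 := by
  set L := volume.real J with hL
  set A := ∫ t in J, g t with hA
  set B := ∫ t in J, g t ^ 2 with hB
  have hL0 : 0 ≤ L := measureReal_nonneg
  have hc : IntegrableOn (fun _ : ℝ => A ^ 2) J := integrableOn_const hJ
  have key : 0 ≤ ∫ t in J, (L * g t - A) ^ 2 := integral_nonneg fun t => sq_nonneg _
  have h1 : ∫ t in J, (L * g t - A) ^ 2 = L ^ 2 * B - 2 * L * A * A + A ^ 2 * L := by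
    have h2 : ∀ t, (L * g t - A) ^ 2 = (L ^ 2 * g t ^ 2 - 2 * L * A * g t) + A ^ 2 := fun t => by ring
    simp_rw [h2]
    have h3 : IntegrableOn (fun t => L ^ 2 * g t ^ 2) J := hg2.const_mul _
    have h4 : IntegrableOn (fun t => 2 * L * A * g t) J := hg.const_mul _
    have h5 : IntegrableOn (fun t => L ^ 2 * g t ^ 2 - 2 * L * A * g t) J := h3.sub h4
    rw [integral_add h5 hc, integral_sub h3 h4, integral_const_mul, integral_const_mul,
      setIntegral_const, ← hA, ← hB, ← hL, smul_eq_mul]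
    ring
  rw [h1] at key
  rcases hL0.eq_or_lt with h0 | hpos
  · have hJ0 : volume J = 0 := by
      rw [hL, Measure.real, eq_comm, ENNReal.toReal_eq_zero_iff] at h0
      exact h0.resolve_right hJ
    have : A = 0 := by
      rw [hA, Measure.restrict_eq_zero.mpr hJ0, integral_zero_measure]
    rw [this, ← h0]; simp
  · nlinarith

/-- The values of a continuous, piecewise smooth function at the ends of a segment differ by at most
the integral of its directional derivative. -/
theorem sq_le_of_piecewise {ι : Type*} (S : Finset ι) {C : ι → Set E3} {p : ι → E3 → ℝ}
    (hC : ∀ j ∈ S, IsClosed (C j)) (hconv : ∀ j ∈ S, Convex ℝ (C j))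
    (hp : ∀ j ∈ S, ContDiff ℝ 1 (p j)) {I : Set E3} {q : E3 → ℝ} (hq : ContinuousOn q I)
    (hqp : ∀ j ∈ S, ∀ y ∈ C j ∩ I, q y = p j y) {ν : E3} {G : E3 → ENNReal}
    (hGp : ∀ j ∈ S, ∀ y ∈ C j, ENNReal.ofReal ((fderiv ℝ (p j) y ν) ^ 2) ≤ G y) {a : E3} {s : ℝ}
    (hpath : ∀ t ∈ uIcc 0 s, a - t • ν ∈ I ∧ ∃ j ∈ S, a - t • ν ∈ C j) :
    ENNReal.ofReal (q a ^ 2) ≤ 2 * ENNReal.ofReal (q (a - s • ν) ^ 2) +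
      2 * ENNReal.ofReal |s| * ∫⁻ t in uIcc 0 s, G (a - t • ν) := by
  classical
  set f : ℝ → ℝ := fun t => q (a - t • ν) with hf
  have hline : Continuous fun t : ℝ => a - t • ν := by fun_prop
  have hfc : ContinuousOn f (uIcc 0 s) := hq.comp hline.continuousOn fun t ht => (hpath t ht).1
  set J : ι → Set ℝ := fun j => uIcc 0 s ∩ (fun t : ℝ => a - t • ν) ⁻¹' C j with hJ
  -- Convex closed cells meet the line in compact intervals. Away from their finitely many endpoints
  -- `f` coincides locally with one smooth piece, which suffices for the fundamental theorem of
  -- calculus.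
  set D : Set ℝ := ⋃ j ∈ S, {sInf (J j), sSup (J j)} with hD
  have hDfin : D.Finite := S.finite_toSet.biUnion fun j _ => toFinite _
  have hderiv : ∀ t ∈ Ioo (min 0 s) (max 0 s) \ D, ∃ j ∈ S, a - t • ν ∈ C j ∧
      HasDerivAt f (-(fderiv ℝ (p j) (a - t • ν) ν)) t := by
    rintro t ⟨ht, htD⟩
    have htu : t ∈ uIcc 0 s := Ioo_subset_Icc_self ht
    obtain ⟨j, hj, htj⟩ := (hpath t htu).2
    refine ⟨j, hj, htj, ?_⟩
    have htJ : t ∈ J j := ⟨htu, htj⟩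
    have hJconv : Convex ℝ (J j) := by
      refine (convex_uIcc 0 s).inter ?_
      have h1 : (fun t : ℝ => a - t • ν) = AffineMap.lineMap a (a - ν) := by
        ext t
        simp [AffineMap.lineMap_apply_module', sub_eq_neg_add]
      rw [h1]
      exact (hconv j hj).affine_preimage _
    have hJcomp : IsCompact (J j) := isCompact_uIcc.inter_right ((hC j hj).preimage hline)
    have hJeq := eq_Icc_of_connected_compact ⟨⟨t, htJ⟩, hJconv.isPreconnected⟩ hJcomp
    have htD' : t ≠ sInf (J j) ∧ t ≠ sSup (J j) := by
      constructor <;> rintro h <;> exact htD (mem_iUnion₂.mpr ⟨j, hj, by simp [← h]⟩)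
    have htI : t ∈ Ioo (sInf (J j)) (sSup (J j)) := by
      have h2 := htJ
      rw [hJeq] at h2
      exact ⟨lt_of_le_of_ne h2.1 (Ne.symm htD'.1), lt_of_le_of_ne h2.2 htD'.2⟩
    have hev : f =ᶠ[nhds t] fun t => p j (a - t • ν) := by
      filter_upwards [Ioo_mem_nhds htI.1 htI.2] with t' ht'
      have h3 : t' ∈ J j := by rw [hJeq]; exact Ioo_subset_Icc_self ht'
      exact hqp j hj _ ⟨h3.2, (hpath t' h3.1).1⟩
    have h4 : HasDerivAt (fun t : ℝ => a - t • ν) (-ν) t := by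
      simpa using ((hasDerivAt_id t).smul_const ν).const_sub a
    have h5 := (((hp j hj).differentiable one_ne_zero) (a - t • ν)).hasFDerivAt.comp_hasDerivAt t h4
    rw [map_neg] at h5
    exact h5.congr_of_eventuallyEq hev
  have hbd : ∃ M : ℝ, ∀ j ∈ S, ∀ t ∈ uIcc 0 s, |fderiv ℝ (p j) (a - t • ν) ν| ≤ M := by
    have h1 : ∀ j ∈ S, ∃ M : ℝ, 0 ≤ M ∧ ∀ t ∈ uIcc 0 s, |fderiv ℝ (p j) (a - t • ν) ν| ≤ M := by
      intro j hj
      have hc : Continuous fun t : ℝ => fderiv ℝ (p j) (a - t • ν) ν :=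
        (((hp j hj).continuous_fderiv one_ne_zero).comp hline).clm_apply continuous_const
      obtain ⟨M, hM⟩ := isCompact_uIcc.exists_bound_of_continuousOn (hc.continuousOn (s := uIcc 0 s))
      exact ⟨max M 0, le_max_right _ _, fun t ht => (hM t ht).trans (le_max_left _ _)⟩
    choose! M hM0 hM using h1
    exact ⟨∑ j ∈ S, M j, fun j hj t ht => (hM j hj t ht).trans
      (Finset.single_le_sum (fun i hi => hM0 i hi) hj)⟩
  obtain ⟨M, hM⟩ := hbd
  have hDnull : volume D = 0 := hDfin.measure_zero _
  have hae : ∀ᵐ t ∂volume.restrict (uIoc 0 s), t ∈ Ioo (min 0 s) (max 0 s) \ D := by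
    rw [ae_restrict_iff' measurableSet_uIoc]
    have h1 : ∀ᵐ t : ℝ, t ∉ D := measure_eq_zero_iff_ae_notMem.mp hDnull
    have h2 : ∀ᵐ t : ℝ, t ≠ max 0 s := by simp [ae_iff, measure_singleton]
    filter_upwards [h1, h2] with t ht1 ht2 ht
    exact ⟨⟨ht.1, lt_of_le_of_ne ht.2 ht2⟩, ht1⟩
  have hbound : ∀ᵐ t ∂volume.restrict (uIoc 0 s), ‖deriv f t‖ ≤ M := by
    filter_upwards [hae] with t ht
    obtain ⟨j, hj, -, hd⟩ := hderiv t ht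
    rw [hd.deriv, norm_neg]
    exact hM j hj t (Ioo_subset_Icc_self ht.1)
  have hfin : volume (uIoc 0 s) < ⊤ := by rw [uIoc]; exact measure_Ioc_lt_top
  have hint : IntegrableOn (deriv f) (uIoc 0 s) :=
    Measure.integrableOn_of_bounded hfin.ne (measurable_deriv f).aestronglyMeasurable hbound
  have hint2 : IntegrableOn (fun t => deriv f t ^ 2) (uIoc 0 s) := by
    refine Measure.integrableOn_of_bounded (M := M ^ 2) hfin.ne
      ((measurable_deriv f).pow_const 2).aestronglyMeasurable ?_
    filter_upwards [hbound] with t ht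
    rw [norm_pow]
    exact pow_le_pow_left₀ (norm_nonneg _) ht 2
  have hftc := MeasureTheory.integral_eq_of_hasDerivAt_off_countable f (deriv f) (a := 0) (b := s)
    hDfin.countable hfc (fun t ht => by
      obtain ⟨j, hj, -, hd⟩ := hderiv t ht
      rw [hd.deriv]; exact hd) (intervalIntegrable_iff.mpr hint)
  have hsq : (f s - f 0) ^ 2 ≤ |s| * ∫ t in uIoc 0 s, deriv f t ^ 2 := by
    rw [← hftc, ← sq_abs, intervalIntegral.abs_intervalIntegral_eq, sq_abs]
    refine (sq_integral_le_of_bounded hfin.ne hint hint2).trans (le_of_eq ?_)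
    rw [Measure.real, Real.volume_uIoc, sub_zero, ENNReal.toReal_ofReal (abs_nonneg _)]
  have hle : ENNReal.ofReal (∫ t in uIoc 0 s, deriv f t ^ 2) ≤
      ∫⁻ t in uIcc 0 s, G (a - t • ν) := by
    rw [ofReal_integral_eq_lintegral_ofReal hint2 (Filter.Eventually.of_forall fun t => sq_nonneg _)]
    refine le_trans ?_ (lintegral_mono_set uIoc_subset_uIcc)
    refine lintegral_mono_ae ?_
    filter_upwards [hae] with t ht
    obtain ⟨j, hj, htj, hd⟩ := hderiv t ht
    rw [hd.deriv, neg_sq]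
    exact hGp j hj _ htj
  have hf0 : f 0 = q a := by simp [hf]
  have h6 : q a ^ 2 ≤ 2 * f s ^ 2 + 2 * (|s| * ∫ t in uIoc 0 s, deriv f t ^ 2) := by
    rw [← hf0]
    nlinarith [sq_nonneg (f s - f 0 + f s)]
  calc ENNReal.ofReal (q a ^ 2)
      ≤ ENNReal.ofReal (2 * f s ^ 2 + 2 * (|s| * ∫ t in uIoc 0 s, deriv f t ^ 2)) :=
        ENNReal.ofReal_le_ofReal h6
    _ ≤ ENNReal.ofReal (2 * f s ^ 2) +
        ENNReal.ofReal (2 * (|s| * ∫ t in uIoc 0 s, deriv f t ^ 2)) := ENNReal.ofReal_add_le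
    _ = 2 * ENNReal.ofReal (f s ^ 2) +
        2 * ENNReal.ofReal |s| * ENNReal.ofReal (∫ t in uIoc 0 s, deriv f t ^ 2) := by
      rw [ENNReal.ofReal_mul zero_le_two, ENNReal.ofReal_mul zero_le_two,
        ENNReal.ofReal_mul (abs_nonneg s), ENNReal.ofReal_ofNat, mul_assoc]
    _ ≤ _ := by gcongr

/-- Tonelli and translation invariance: each inner translate has the same integral. -/
theorem lintegral_lintegral_sub_smul {g : E3 → ENNReal} (hg : Measurable g) (ν : E3) (J : Set ℝ) :
    ∫⁻ a, ∫⁻ t in J, g (a - t • ν) = volume J * ∫⁻ y, g y := by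
  rw [lintegral_lintegral_swap]
  · simp_rw [lintegral_sub_right_eq_self g]
    rw [lintegral_const, Measure.restrict_apply_univ, mul_comm]
  · exact (hg.comp (by fun_prop)).aemeasurable

/-- Averaging pointwise estimates over translations in a fixed direction. -/
theorem lintegral_le_of_translates {ν : E3} {E Q : Set E3} (hE : MeasurableSet E)
    (hQ : MeasurableSet Q) {M l : ℝ} (hM : 0 ≤ M) {F H G : E3 → ENNReal}
    (hH : Measurable H) (hG : Measurable G)
    (hl : ∀ a ∈ E, ENNReal.ofReal l ≤ volume {s ∈ Icc (-M) M | a - s • ν ∈ Q})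
    (hpt : ∀ a ∈ E, ∀ s ∈ Icc (-M) M, a - s • ν ∈ Q →
      F a ≤ 2 * H (a - s • ν) + 2 * ENNReal.ofReal M * ∫⁻ t in Icc (-M) M, G (a - t • ν)) :
    ENNReal.ofReal l * ∫⁻ a in E, F a ≤ ENNReal.ofReal (4 * M) * (∫⁻ y in Q, H y) +
      ENNReal.ofReal (8 * M ^ 3) * ∫⁻ y, G y := by
  have hHQ : Measurable (Q.indicator H) := hH.indicator hQ
  have hvol : volume (Icc (-M) M) = ENNReal.ofReal (2 * M) := by
    rw [Real.volume_Icc]; congr 1; ring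
  have hslice : ∀ a, MeasurableSet {s ∈ Icc (-M) M | a - s • ν ∈ Q} := fun a =>
    measurableSet_Icc.inter ((by fun_prop : Measurable fun s : ℝ => a - s • ν) hQ)
  -- Integrate the pointwise bound over the s with a − sν in Q, a set of measure at least l, and
  -- then enlarge the range of s to [−M, M].
  have h1 : ∀ a ∈ E, ENNReal.ofReal l * F a ≤
      2 * (∫⁻ s in Icc (-M) M, Q.indicator H (a - s • ν)) +
        ENNReal.ofReal (2 * M) * (2 * ENNReal.ofReal M * ∫⁻ t in Icc (-M) M, G (a - t • ν)) := by
    intro a ha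
    set R := ∫⁻ t in Icc (-M) M, G (a - t • ν) with hR
    calc ENNReal.ofReal l * F a ≤ volume {s ∈ Icc (-M) M | a - s • ν ∈ Q} * F a := by
          gcongr; exact hl a ha
      _ = ∫⁻ s in {s ∈ Icc (-M) M | a - s • ν ∈ Q}, F a := by
          rw [setLIntegral_const, mul_comm]
      _ ≤ ∫⁻ s in {s ∈ Icc (-M) M | a - s • ν ∈ Q},
            (2 * Q.indicator H (a - s • ν) + 2 * ENNReal.ofReal M * R) := by
          refine setLIntegral_mono' (hslice a) fun s hs => ?_
          rw [indicator_of_mem hs.2]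
          exact hpt a ha s hs.1 hs.2
      _ ≤ ∫⁻ s in Icc (-M) M, (2 * Q.indicator H (a - s • ν) + 2 * ENNReal.ofReal M * R) :=
          lintegral_mono_set (sep_subset _ _)
      _ = _ := by
          have h0 : Measurable fun s : ℝ => Q.indicator H (a - s • ν) := hHQ.comp (by fun_prop)
          rw [lintegral_add_right _ measurable_const, lintegral_const_mul _ h0, lintegral_const, Measure.restrict_apply_univ, hvol, mul_comm
            (ENNReal.ofReal (2 * M))]
  have hm1 : Measurable fun a : E3 => ∫⁻ s in Icc (-M) M, Q.indicator H (a - s • ν) :=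
    (hHQ.comp (by fun_prop : Measurable fun x : E3 × ℝ => x.1 - x.2 • ν)).lintegral_prod_right'
  have hm2 : Measurable fun a : E3 => ∫⁻ t in Icc (-M) M, G (a - t • ν) :=
    (hG.comp (by fun_prop : Measurable fun x : E3 × ℝ => x.1 - x.2 • ν)).lintegral_prod_right'
  calc ENNReal.ofReal l * ∫⁻ a in E, F a ≤ ∫⁻ a in E, ENNReal.ofReal l * F a :=
        lintegral_const_mul_le _ _
    _ ≤ ∫⁻ a in E, (2 * (∫⁻ s in Icc (-M) M, Q.indicator H (a - s • ν)) +
        ENNReal.ofReal (2 * M) * (2 * ENNReal.ofReal M * ∫⁻ t in Icc (-M) M, G (a - t • ν))) :=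
        setLIntegral_mono' hE h1
    _ ≤ ∫⁻ a, (2 * (∫⁻ s in Icc (-M) M, Q.indicator H (a - s • ν)) +
        ENNReal.ofReal (2 * M) * (2 * ENNReal.ofReal M * ∫⁻ t in Icc (-M) M, G (a - t • ν))) :=
        setLIntegral_le_lintegral _ _
    _ = _ := by
      rw [lintegral_add_left (hm1.const_mul 2), lintegral_const_mul _ hm1, lintegral_const_mul _
        (hm2.const_mul _), lintegral_const_mul _ hm2, lintegral_lintegral_sub_smul hHQ,
        lintegral_lintegral_sub_smul hG, hvol, lintegral_indicator hQ]
      have h4 : ENNReal.ofReal (4 * M) = 2 * ENNReal.ofReal (2 * M) := by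
        rw [← ENNReal.ofReal_ofNat 2, ← ENNReal.ofReal_mul (by positivity)]
        congr 1; ring
      have h8 : ENNReal.ofReal (8 * M ^ 3) =
          ENNReal.ofReal (2 * M) * (2 * ENNReal.ofReal M * ENNReal.ofReal (2 * M)) := by
        rw [← ENNReal.ofReal_ofNat 2, ← ENNReal.ofReal_mul (by positivity),
          ← ENNReal.ofReal_mul (by positivity), ← ENNReal.ofReal_mul (by positivity)]
        congr 1; ring
      rw [h4, h8]
      ring

end TraceFEM

namespace TraceFEM

/-! ### Level sets of nearly affine functions -/

/-- On the ball of radius `R` about `x`, the function `φ` differs from a linear functional with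
gradient `ν` by a function with Lipschitz constant `η`. -/
def IsNearlyAffine (φ : E3 → ℝ) (ν : E3) (η : ℝ) (x : E3) (R : ℝ) : Prop :=
  ∀ y ∈ Metric.ball x R, ∀ y' ∈ Metric.ball x R,
    |φ y - φ y' - inner ℝ ν (y - y')| ≤ η * dist y y'

variable {φ : E3 → ℝ} {ν : E3} {η : ℝ} {x : E3} {R : ℝ}

theorem IsNearlyAffine.abs_sub_le (h : IsNearlyAffine φ ν η x R) (hν : ‖ν‖ = 1) {y y' : E3}
    (hy : y ∈ Metric.ball x R) (hy' : y' ∈ Metric.ball x R) :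
    |φ y - φ y'| ≤ (1 + η) * dist y y' := by
  have h1 := h y hy y' hy'
  have h2 : |inner ℝ ν (y - y')| ≤ dist y y' := by
    refine (abs_real_inner_le_norm _ _).trans ?_
    rw [hν, one_mul, dist_eq_norm]
  have h3 : φ y - φ y' = (φ y - φ y' - inner ℝ ν (y - y')) + inner ℝ ν (y - y') := by ring
  rw [h3]
  refine (abs_add_le _ _).trans ?_
  linarith

theorem IsNearlyAffine.continuousOn (h : IsNearlyAffine φ ν η x R) (hν : ‖ν‖ = 1) (hη : 0 ≤ η) :
    ContinuousOn φ (Metric.ball x R) := by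
  refine LipschitzOnWith.continuousOn (K := ⟨1 + η, by positivity⟩)
    (LipschitzOnWith.of_dist_le_mul fun y hy y' hy' => ?_)
  rw [Real.dist_eq]
  exact h.abs_sub_le hν hy hy'

/-- Since |ν| = 1, φ descends along −ν at unit rate up to η. This is what places zeros on vertical
lines. -/
theorem IsNearlyAffine.abs_sub_smul_le (h : IsNearlyAffine φ ν η x R) (hν : ‖ν‖ = 1) {a : E3}
    {s t : ℝ} (hs : a - s • ν ∈ Metric.ball x R) (ht : a - t • ν ∈ Metric.ball x R) :
    |φ (a - s • ν) - φ (a - t • ν) - (t - s)| ≤ η * |t - s| := by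
  have h1 := h _ hs _ ht
  have h2 : a - s • ν - (a - t • ν) = (t - s) • ν := by module
  rw [dist_eq_norm, h2, inner_smul_right, real_inner_self_eq_norm_sq, norm_smul, hν, one_pow,
    mul_one, mul_one, Real.norm_eq_abs] at h1
  exact h1

theorem IsNearlyAffine.exists_zero (h : IsNearlyAffine φ ν η x R) (hν : ‖ν‖ = 1) (hη : 0 ≤ η)
    {S : Set E3} (hS : IsPreconnected S) (hSR : S ⊆ Metric.ball x R) {y y' : E3} (hy : y ∈ S)
    (hy' : y' ∈ S) (h0 : φ y ≤ 0) (h0' : 0 ≤ φ y') : ∃ w ∈ S, φ w = 0 := by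
  obtain ⟨w, hw, hw0⟩ := hS.intermediate_value hy hy' ((h.continuousOn hν hη).mono hSR) ⟨h0, h0'⟩
  exact ⟨w, hw, hw0⟩

theorem IsNearlyAffine.exists_zero_on_line (h : IsNearlyAffine φ ν η x R) (hν : ‖ν‖ = 1)
    (hη : 0 ≤ η) {a : E3} {s t : ℝ} (hst : s ≤ t) (hs : a - s • ν ∈ Metric.ball x R)
    (ht : a - t • ν ∈ Metric.ball x R) (h0 : φ (a - t • ν) ≤ 0) (h0' : 0 ≤ φ (a - s • ν)) :
    ∃ r ∈ Icc s t, φ (a - r • ν) = 0 := by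
  obtain ⟨w, hw, hw0⟩ := h.exists_zero hν hη (convex_segment (a - s • ν) (a - t • ν)).isPreconnected
    ((convex_ball x R).segment_subset hs ht) (right_mem_segment ℝ _ _) (left_mem_segment ℝ _ _) h0 h0'
  rw [segment_eq_image'] at hw
  obtain ⟨θ, hθ, rfl⟩ := hw
  refine ⟨s + θ * (t - s), ⟨by nlinarith [hθ.1], by nlinarith [hθ.2]⟩, ?_⟩
  rw [← hw0]
  congr 1
  module

variable {Γ : Set E3}

/-- If `T` contains a ball centred on the surface, then the surface has area in `T` comparable to the
square of the radius. -/
theorem ofReal_le_area_of_closedBall_subset (h : IsNearlyAffine φ ν η x R) (hν : ‖ν‖ = 1)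
    (hη : 0 ≤ η) (hη' : η ≤ 1 / 4) (hΓ : IsCompact Γ)
    (hφ : ∀ y ∈ Metric.ball x R, y ∈ Γ ↔ φ y = 0) {S : Set E3} (hS : IsCompact S) {m : E3} {w : ℝ}
    (hw : 0 < w) (hmS : Metric.closedBall m w ⊆ S) (hmR : Metric.closedBall m w ⊆ Metric.ball x R)
    (hm : φ m = 0) : ENNReal.ofReal (w ^ 2 / 32) ≤ μHE[2] (Γ ∩ S) := by
  -- Lines through the ball of radius w/8 meet Γ within distance w/2, hence inside S. Comparison
  -- with a cylinder of height w/4 gives area at least (π/96)w² ≥ w²/32.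
  have key : volume (Metric.closedBall m (w / 8)) ≤
      ENNReal.ofReal ((inner ℝ ν m + w / 8) - (inner ℝ ν m - w / 8)) * μHE[2] (Γ ∩ S) := by
    refine volume_le_of_planeProj_subset hν (hΓ.inter_right hS.isClosed) fun a ha => ?_
    rw [Metric.mem_closedBall] at ha
    have hin : ∀ t : ℝ, |t| ≤ w / 2 → a - t • ν ∈ Metric.closedBall m w := fun t ht => by
      rw [Metric.mem_closedBall]
      have h1 : dist (a - t • ν) a = |t| := by
        rw [dist_eq_norm, sub_sub_cancel_left, norm_neg, norm_smul, hν, mul_one, Real.norm_eq_abs]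
      have := dist_triangle (a - t • ν) a m
      linarith
    have ha0 : a - (0 : ℝ) • ν = a := by simp
    have hφa : |φ a| ≤ w / 4 := by
      have h1 := h.abs_sub_le hν (hmR (ha0 ▸ hin 0 (by simp; positivity)))
        (hmR (Metric.mem_closedBall_self hw.le))
      rw [hm, sub_zero] at h1
      nlinarith [dist_nonneg (x := a) (y := m)]
    have h2 := h.abs_sub_smul_le hν (hmR (hin 0 (by simp; positivity)))
      (hmR (hin (w / 2) (by rw [abs_of_pos (by positivity)])))
    have h3 := h.abs_sub_smul_le hν (hmR (hin 0 (by simp; positivity)))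
      (hmR (hin (-(w / 2)) (by rw [abs_neg, abs_of_pos (by positivity)])))
    rw [ha0, sub_zero] at h2 h3
    rw [abs_neg] at h3
    rw [abs_of_pos (a := w / 2) (by positivity)] at h2 h3
    obtain ⟨hφ1, hφ2⟩ := abs_le.mp hφa
    obtain ⟨r, hr, hr0⟩ := h.exists_zero_on_line hν hη (a := a) (s := -(w / 2)) (t := w / 2)
      (by linarith) (hmR (hin _ (by rw [abs_neg, abs_of_pos (by positivity)])))
      (hmR (hin _ (by rw [abs_of_pos (by positivity)])))
      (by nlinarith [(abs_le.mp h2).1]) (by nlinarith [(abs_le.mp h3).2])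
    have hrin := hin r (abs_le.mpr hr)
    refine ⟨⟨a - r • ν, ⟨(hφ _ (hmR hrin)).mpr hr0, hmS hrin⟩, planeProj_sub_smul hν a r⟩, ?_⟩
    have h5 : |inner ℝ ν (a - m)| ≤ w / 8 := by
      refine (abs_real_inner_le_norm _ _).trans ?_
      rw [hν, one_mul, ← dist_eq_norm]; exact ha
    rw [inner_sub_right] at h5
    obtain ⟨h6, h7⟩ := abs_le.mp h5
    exact ⟨by linarith, by linarith⟩
  rw [EuclideanSpace.volume_closedBall_fin_three, ← ENNReal.ofReal_pow (by positivity),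
    ← ENNReal.ofReal_mul (by positivity)] at key
  have hpos : 0 < w / 4 := by positivity
  have h8 : (inner ℝ ν m + w / 8) - (inner ℝ ν m - w / 8) = w / 4 := by ring
  rw [h8] at key
  have hne : ENNReal.ofReal (w / 4) ≠ 0 := by simpa using hpos
  rw [← ENNReal.mul_le_mul_iff_right hne ENNReal.ofReal_ne_top]
  refine le_trans ?_ key
  rw [← ENNReal.ofReal_mul (by positivity)]
  refine ENNReal.ofReal_le_ofReal ?_
  nlinarith [Real.pi_gt_three, pow_pos hw 3]

/-- A simplex meeting `{φ ≤ 0}` has a face meeting `{φ ≤ 0}` on which `φ` is nearly nonpositive. -/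
theorem IsNearlyAffine.exists_face (h : IsNearlyAffine φ ν η x R) (hη : 0 ≤ η)
    {T : Finset E3} (hTR : tet T ⊆ Metric.ball x R) {y : E3} (hy : y ∈ tet T) (hφy : φ y ≤ 0) :
    ∃ τ ⊆ T, τ.Nonempty ∧ (∃ w ∈ tet τ, φ w ≤ 0) ∧ ∀ w ∈ tet τ, φ w ≤ 4 * η * tetDiam T := by
  classical
  have hTne : T.Nonempty := by
    rw [Finset.nonempty_iff_ne_empty]
    rintro rfl
    simp [tet] at hy
  -- By minimality φ is positive on every facet of τ.
  obtain ⟨τ, hτ, hmin⟩ := (T.powerset.filter fun τ => ∃ w ∈ tet τ, φ w ≤ 0).exists_min_image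
    Finset.card ⟨T, by simpa using ⟨y, hy, hφy⟩⟩
  rw [Finset.mem_filter, Finset.mem_powerset] at hτ
  obtain ⟨hτT, w₀, hw₀, hφw₀⟩ := hτ
  have hτne : τ.Nonempty := by
    rw [Finset.nonempty_iff_ne_empty]
    rintro rfl
    simp [tet] at hw₀
  have hsub : tet τ ⊆ tet T := tet_mono hτT
  have hdiam : ∀ y ∈ tet τ, ∀ y' ∈ tet τ, dist y y' ≤ tetDiam T := fun y hy y' hy' =>
    dist_le_tetDiam (hsub hy) (hsub hy')
  have hpos : ∀ u ∈ τ, ∀ b ∈ tet (τ.erase u), 0 < φ b := by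
    intro u hu b hb
    by_contra! hneg
    have := hmin (τ.erase u) (by
      rw [Finset.mem_filter, Finset.mem_powerset]
      exact ⟨(Finset.erase_subset _ _).trans hτT, b, hb, hneg⟩)
    rw [Finset.card_erase_of_mem hu] at this
    have := hτne.card_pos
    omega
  have hh := tetDiam_nonneg T
  have hvert : ∀ u ∈ τ, φ u ≤ 2 * η * tetDiam T := by
    intro u hu
    have huτ : u ∈ tet τ := mem_tet_of_mem hu
    rcases (τ.erase u).eq_empty_or_nonempty with hem | hne
    · have h1 : tet τ = {u} := by
        have h2 : τ = {u} := by
          rw [← Finset.insert_erase hu, hem]; rfl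
        rw [h2]; simp [tet]
      rw [h1, mem_singleton_iff] at hw₀
      rw [← hw₀]
      exact hφw₀.trans (by positivity)
    · have h1 : tet τ = convexJoin ℝ {u} (tet (τ.erase u)) := by
        rw [tet, ← convexHull_insert (by exact_mod_cast hne), ← Finset.coe_insert,
          Finset.insert_erase hu]
      have hw₁ := hw₀
      rw [h1, mem_convexJoin] at hw₁
      obtain ⟨_, hu₁, b, hb, hub⟩ := hw₁
      rw [mem_singleton_iff.mp hu₁] at hub
      have hbτ : b ∈ tet τ := tet_mono (Finset.erase_subset _ _) hb
      have hφb := hpos u hu b hb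
      rw [segment_eq_image'] at hub
      obtain ⟨c, hc, hcw⟩ := hub
      simp only at hcw
      subst hcw
      have hc1 : c < 1 := by
        rcases hc.2.lt_or_eq with h2 | rfl
        · exact h2
        · rw [one_smul, add_sub_cancel] at hφw₀
          linarith
      have h2 := (abs_le.mp (h b (hTR (hsub hbτ)) _ (hTR (hsub hw₀)))).2
      have h3 := (abs_le.mp (h u (hTR (hsub huτ)) _ (hTR (hsub hw₀)))).2
      have e1 : b - (u + c • (b - u)) = (1 - c) • (b - u) := by module
      have e2 : u - (u + c • (b - u)) = (-c) • (b - u) := by module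
      rw [dist_eq_norm, e1, inner_smul_right, norm_smul, Real.norm_eq_abs,
        abs_of_pos (by linarith)] at h2
      rw [dist_eq_norm, e2, inner_smul_right, norm_smul, Real.norm_eq_abs, abs_neg,
        abs_of_nonneg hc.1] at h3
      have h4 : ‖b - u‖ ≤ tetDiam T := by
        rw [← dist_eq_norm]; exact hdiam b hbτ u huτ
      -- On the segment from u through w₀ to b, φ rises from φ(w₀) ≤ 0 to φ(b) > 0, so ν·(b − u) is
      -- almost nonnegative; going back from w₀ to u can therefore raise φ only slightly.
      have h5 : -(η * ‖b - u‖) < inner ℝ ν (b - u) := by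
        have h6 : 0 < (1 - c) * (inner ℝ ν (b - u) + η * ‖b - u‖) := by nlinarith
        have := pos_of_mul_pos_right h6 (by linarith : (0 : ℝ) ≤ 1 - c)
        linarith
      have h6 : φ u ≤ c * (2 * (η * ‖b - u‖)) := by nlinarith [hc.1]
      have h7 : η * ‖b - u‖ ≤ η * tetDiam T := by gcongr
      have h8 : 0 ≤ η * ‖b - u‖ := by positivity
      nlinarith [hc.1, hc.2]
  refine ⟨τ, hτT, hτne, ⟨w₀, hw₀, hφw₀⟩, ?_⟩
  -- Vertex bounds pass to the hull for the linear part; each switch between φ and its linear part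
  -- costs η h_T, and the value φ(w₀) cancels at the end.
  have hlin : tet τ ⊆ {y : E3 | inner ℝ ν y ≤ 3 * η * tetDiam T - φ w₀ + inner ℝ ν w₀} := by
    refine convexHull_min (fun u hu => ?_) (convex_halfSpace_le
      (f := fun y : E3 => inner ℝ ν y) ?_ _)
    · have h1 := hvert u hu
      have h2 := (abs_le.mp (h u (hTR (hsub (mem_tet_of_mem hu))) _ (hTR (hsub hw₀)))).1
      have h3 : η * dist u w₀ ≤ η * tetDiam T := by
        gcongr; exact hdiam _ (mem_tet_of_mem hu) _ hw₀
      rw [inner_sub_right] at h2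
      rw [mem_ofPred_eq]
      linarith
    · exact ((innerSL ℝ ν).toLinearMap).isLinear
  intro y hy
  have h1 := hlin hy
  rw [mem_ofPred_eq] at h1
  have h2 := (abs_le.mp (h y (hTR (hsub hy)) _ (hTR (hsub hw₀)))).2
  have h3 : η * dist y w₀ ≤ η * tetDiam T := by
    gcongr; exact hdiam _ hy _ hw₀
  rw [inner_sub_right] at h2
  linarith

end TraceFEM

namespace TraceFEM

/-! ### Transfer from a cut tetrahedron to a regular one -/

variable {K : Geometry.SimplicialComplex ℝ E3} {Ω Γ : Set E3} {σ : ℝ}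
variable {φ : E3 → ℝ} {ν : E3} {η : ℝ} {x : E3} {R : ℝ}

/-- Bound for the ratio of the diameters of tetrahedra sharing a vertex. -/
noncomputable def starRatio (σ : ℝ) : ℝ := σ ^ ⌈8 * σ ^ 3⌉₊

theorem one_le_starRatio (hσ : 1 ≤ σ) : 1 ≤ starRatio σ := one_le_pow₀ hσ

theorem tetDiam_le_starRatio (hK : IsTriangulation K Ω) (hσ : IsShapeRegular K σ)
    {T : Finset E3} (hT : T ∈ tetrahedra K)
    (hspace : ∀ p ∈ tet T, Metric.closedBall p (tetDiam T) ⊆ K.space) {τ : Finset E3}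
    (hτ : τ.Nonempty) (hτT : τ ⊆ T) {t : Finset E3} (ht : t ∈ tetrahedra K) (hτt : τ ⊆ t) :
    tetDiam t ≤ starRatio σ * tetDiam T ∧ tetDiam T ≤ starRatio σ * tetDiam t := by
  obtain ⟨u, hu⟩ := hτ
  have hball := hspace u (mem_tet_of_mem (hτT hu))
  exact ⟨tetDiam_le_of_common_vertex hK hσ (tetDiam_pos hσ hT) hball hT (hτT hu) ht (hτt hu),
    tetDiam_le_of_common_vertex hK hσ (tetDiam_pos hσ hT) hball ht (hτt hu) hT (hτT hu)⟩

/-- Every tetrahedron of the star contains a ball of radius at least h_T / (σ · `starRatio σ`), and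
a quarter of that is admissible in `exists_mem_star`. -/
theorem exists_mem_star_of_dist_le (hK : IsTriangulation K Ω) (hσ : IsShapeRegular K σ)
    {T : Finset E3} (hT : T ∈ tetrahedra K)
    (hspace : ∀ p ∈ tet T, Metric.closedBall p (tetDiam T) ⊆ K.space) {τ : Finset E3}
    (hτ : τ.Nonempty) (hτT : τ ⊆ T) {y : E3}
    (hy : dist y (barycenter τ) ≤ tetDiam T / (4 * σ * starRatio σ)) :
    ∃ t ∈ tetrahedra K, τ ⊆ t ∧ y ∈ tet t := by
  have hσ1 := one_le_of_isShapeRegular hσ hT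
  have hC1 := one_le_starRatio hσ1
  have hh := tetDiam_pos hσ hT
  have hv : barycenter τ ∈ tet T := tet_mono hτT (barycenter_mem_tet hτ)
  refine exists_mem_star hK hτ hT hτT ?_ fun t ht hτt => ?_
  · refine ((convex_closedBall (barycenter τ) (tetDiam T)).segment_subset
      (Metric.mem_closedBall_self hh.le) ?_).trans (hspace _ hv)
    rw [Metric.mem_closedBall]
    refine hy.trans (div_le_self hh.le ?_)
    nlinarith
  · obtain ⟨z, r, hr, hball, hle⟩ := hσ t ht
    refine ⟨z, r, hr, hball, hy.trans ?_⟩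
    have h1 := (tetDiam_le_starRatio hK hσ hT hspace hτ hτT ht hτt).2
    rw [div_le_div_iff₀ (by positivity) (by norm_num)]
    have h2 : starRatio σ * tetDiam t ≤ starRatio σ * (σ * r) := by gcongr
    nlinarith

/-- Points of the surface inside the mesh are interior points of the cut region. -/
theorem mem_interior_region_of_mem (hK : IsTriangulation K Ω) {w : E3} (hw : w ∈ Γ)
    (hspace : K.space ∈ nhds w) : w ∈ interior (region (cutTetrahedra K Γ)) := by
  obtain ⟨ε, hε, hnear⟩ := exists_forall_mem_tet hK w
  rw [mem_interior_iff_mem_nhds]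
  filter_upwards [hspace, Metric.ball_mem_nhds w hε] with y hy hyw
  obtain ⟨t, ht, hyt⟩ := exists_tetrahedron_of_mem_space hK hy
  exact mem_iUnion₂.mpr ⟨t, ⟨ht, w, hnear t ht y hyt hyw, hw⟩, hyt⟩

/-- A tetrahedron on which `φ` changes sign is cut. -/
theorem mem_cutTetrahedra_of_sign (h : IsNearlyAffine φ ν η x R) (hν : ‖ν‖ = 1) (hη : 0 ≤ η)
    (hφ : ∀ y ∈ Metric.ball x R, y ∈ Γ ↔ φ y = 0) {t : Finset E3} (ht : t ∈ tetrahedra K)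
    (htR : tet t ⊆ Metric.ball x R) {y y' : E3} (hy : y ∈ tet t) (hy' : y' ∈ tet t)
    (h0 : φ y ≤ 0) (h0' : 0 ≤ φ y') : t ∈ cutTetrahedra K Γ := by
  obtain ⟨w, hw, hw0⟩ := h.exists_zero hν hη (convex_tet t).isPreconnected htR hy hy' h0 h0'
  exact ⟨ht, w, hw, (hφ w (htR hw)).mpr hw0⟩

/-- A ball in `T`, near the barycenter `v` of a face, strictly on one side of the surface. -/
theorem IsNearlyAffine.pos_on_closedBall (h : IsNearlyAffine φ ν η x R) (hν : ‖ν‖ = 1)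
    (hη : 0 ≤ η) (hη' : η ≤ 1 / 4) {S : Set E3} (hS : Convex ℝ S) (hSR : S ⊆ Metric.ball x R)
    {z v : E3} {d ρ s w : ℝ} (hd : ∀ y ∈ S, ∀ y' ∈ S, dist y y' ≤ d) (hρ : 0 < ρ) (hρd : ρ ≤ d)
    (hs : 0 < s) (hs' : s ≤ 1 / 64) (hw : w = s * ρ / 16) (hηd : η * d ≤ w / 2)
    (hz : Metric.closedBall z ρ ⊆ S) (hv : v ∈ S) (hlow : ∀ y ∈ S, -(2 * w) ≤ φ y)
    (hφv : φ v ≤ 2 * w) :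
    Metric.closedBall (v + s • (z - v)) w ⊆ S ∧
      ∀ a ∈ Metric.closedBall (v + s • (z - v)) w, 0 < φ a ∧ φ a ≤ 3 * (s * d) ∧
        dist a v ≤ 2 * (s * d) := by
  have hw0 : 0 < w := by rw [hw]; positivity
  have hwρ : s * ρ = 16 * w := by rw [hw]; ring
  have hwd : 16 * w ≤ s * d := by rw [← hwρ]; gcongr
  have hzS : z ∈ S := hz (Metric.mem_closedBall_self hρ.le)
  have hsub : Metric.closedBall (v + s • (z - v)) w ⊆ S :=
    (Metric.closedBall_subset_closedBall (by linarith)).trans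
      (closedBall_subset_of_convex hS hv hz hs (by linarith))
  have ha₀ : v + s • (z - v) ∈ S := hsub (Metric.mem_closedBall_self hw0.le)
  have hz' : z - ρ • ν ∈ S := hz (by
    rw [Metric.mem_closedBall, dist_eq_norm, sub_sub_cancel_left, norm_neg, norm_smul, hν, mul_one,
      Real.norm_eq_abs, abs_of_pos hρ])
  -- Even the lowest point z − ρν of the inscribed ball has φ ≥ −2w, so φ(z) is at least about ρ.
  have hφz : ρ / 2 ≤ φ z := by
    have h1 := h.abs_sub_smul_le hν (a := z) (s := 0) (t := ρ) (by simpa using hSR hzS) (hSR hz')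
    rw [sub_zero, zero_smul, sub_zero, abs_of_pos hρ] at h1
    have h2 := (abs_le.mp h1).1
    have h3 := hlow _ hz'
    nlinarith
  have hzv : ‖z - v‖ ≤ d := by rw [← dist_eq_norm]; exact hd z hzS v hv
  have e1 : v + s • (z - v) - v = s • (z - v) := by abel
  have h1 := h _ (hSR ha₀) v (hSR hv)
  rw [dist_eq_norm, e1, inner_smul_right, norm_smul, Real.norm_eq_abs, abs_of_pos hs] at h1
  have h2 := h z (hSR hzS) v (hSR hv)
  rw [dist_eq_norm] at h2
  have h3 : η * ‖z - v‖ ≤ w / 2 := (mul_le_mul_of_nonneg_left hzv hη).trans hηd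
  have h4 := abs_le.mp h1
  have h5 := abs_le.mp h2
  -- Near-linear interpolation gives at least (1 − s)φ(v) + sφ(z) − sw ≥ −2w + 8w − sw, using sρ =
  -- 16w.
  have hφa₀ : 5 * w ≤ φ (v + s • (z - v)) := by
    have h6 := hlow v hv
    have h7 : s * (φ z - φ v - inner ℝ ν (z - v)) ≤ s * (w / 2) := by gcongr; linarith
    nlinarith
  have hlip := fun a (ha : a ∈ Metric.closedBall (v + s • (z - v)) w) =>
    h.abs_sub_le hν (hSR (hsub ha)) (hSR ha₀)
  have hva : dist (v + s • (z - v)) v ≤ s * d := by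
    rw [dist_eq_norm, e1, norm_smul, Real.norm_eq_abs, abs_of_pos hs]; gcongr
  have hup : φ (v + s • (z - v)) ≤ 2 * w + (1 + η) * (s * d) := by
    have h6 := (abs_le.mp (h.abs_sub_le hν (hSR ha₀) (hSR hv))).2
    have h7 : (1 + η) * dist (v + s • (z - v)) v ≤ (1 + η) * (s * d) := by gcongr
    linarith
  refine ⟨hsub, fun a ha => ?_⟩
  have h6 := abs_le.mp (hlip a ha)
  have h7 : (1 + η) * dist a (v + s • (z - v)) ≤ 5 / 4 * w := by
    have : dist a (v + s • (z - v)) ≤ w := ha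
    have h8 : (0 : ℝ) ≤ dist a (v + s • (z - v)) := dist_nonneg
    nlinarith
  have hsd : 0 ≤ s * d := by linarith
  refine ⟨by linarith, ?_, ?_⟩
  · nlinarith
  · have := dist_triangle a (v + s • (z - v)) v
    have : dist a (v + s • (z - v)) ≤ w := ha
    linarith

/-- Each vertical line through a set `A` at bounded height above the surface meets the surface in
one of finitely many compact sets covering it; one of these sets is met by a definite proportion of
the lines. -/
theorem exists_le_volume_of_cover {A : Set E3} {F : Finset (Finset E3)} {L N : ℝ}
    (hN : 0 < N) (hF : (F.card : ℝ) ≤ N)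
    (hA : ∀ a ∈ A, ∃ t ∈ F, ∃ r ∈ Icc (0 : ℝ) L, a - r • ν ∈ Γ ∩ tet t) {V : ℝ} (hV : 0 < V)
    (hAV : ENNReal.ofReal V ≤ volume A) :
    ∃ t ∈ F, ENNReal.ofReal (V / N) ≤
      volume {a ∈ A | ∃ r ∈ Icc (0 : ℝ) L, a - r • ν ∈ Γ ∩ tet t} := by
  by_contra! hlt
  have h1 : volume A ≤ ∑ t ∈ F, volume {a ∈ A | ∃ r ∈ Icc (0 : ℝ) L, a - r • ν ∈ Γ ∩ tet t} := by
    refine (measure_mono fun a ha => ?_).trans (measure_biUnion_finset_le F _)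
    obtain ⟨t, ht, r, hr, har⟩ := hA a ha
    exact mem_iUnion₂.mpr ⟨t, ht, ha, r, hr, har⟩
  have hFne : F.Nonempty := by
    rw [Finset.nonempty_iff_ne_empty]
    rintro rfl
    rw [Finset.sum_empty] at h1
    have := hAV.trans h1
    rw [nonpos_iff_eq_zero, ENNReal.ofReal_eq_zero] at this
    linarith
  have h2 : ∑ t ∈ F, volume {a ∈ A | ∃ r ∈ Icc (0 : ℝ) L, a - r • ν ∈ Γ ∩ tet t} <
      ∑ t ∈ F, ENNReal.ofReal (V / N) := ENNReal.sum_lt_sum_of_nonempty hFne hlt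
  rw [Finset.sum_const, nsmul_eq_mul, ← ENNReal.ofReal_natCast, ← ENNReal.ofReal_mul (by positivity)]
    at h2
  have h3 : ENNReal.ofReal (F.card * (V / N)) ≤ ENNReal.ofReal V := by
    refine ENNReal.ofReal_le_ofReal ?_
    rw [mul_div_assoc', div_le_iff₀ hN]
    nlinarith
  exact absurd (hAV.trans h1) (not_le.mpr (h2.trans_le h3))

/-- The lines hit Γ ∩ t exactly from the compact set obtained by sweeping Γ ∩ t upwards along ν. -/
theorem measurableSet_vertical {A : Set E3} (hA : IsCompact A) (hΓ : IsCompact Γ) (t : Finset E3)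
    (L : ℝ) : MeasurableSet {a ∈ A | ∃ r ∈ Icc (0 : ℝ) L, a - r • ν ∈ Γ ∩ tet t} := by
  have h1 : IsCompact ((fun p : E3 × ℝ => p.1 + p.2 • ν) '' ((Γ ∩ tet t) ×ˢ Icc (0 : ℝ) L)) :=
    ((hΓ.inter_right (isCompact_tet t).isClosed).prod isCompact_Icc).image
      (by fun_prop : Continuous fun p : E3 × ℝ => p.1 + p.2 • ν)
  have h2 : {a ∈ A | ∃ r ∈ Icc (0 : ℝ) L, a - r • ν ∈ Γ ∩ tet t} =
      A ∩ (fun p : E3 × ℝ => p.1 + p.2 • ν) '' ((Γ ∩ tet t) ×ˢ Icc (0 : ℝ) L) := by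
    ext a
    refine and_congr_right fun _ => ⟨?_, ?_⟩
    · rintro ⟨r, hr, har⟩
      exact ⟨(a - r • ν, r), ⟨har, hr⟩, by simp⟩
    · rintro ⟨⟨g, r⟩, ⟨hg, hr⟩, rfl⟩
      exact ⟨r, hr, by simpa using hg⟩
  rw [h2]
  exact (IsCompact.measurableSet hA).inter (IsCompact.measurableSet h1)

/-- If the shadow of a point lies in the shadow of a shrunk convex body, then the vertical line
through the point meets the interior of the body in a long chord. -/
theorem le_volume_chord (hν : ‖ν‖ = 1) {S : Set E3} (hS : Convex ℝ S) {z a : E3} {r θ M : ℝ}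
    (hr : 0 < r) (hz : Metric.closedBall z r ⊆ S) (hθ0 : 0 < θ) (hθ1 : θ ≤ 1)
    (ha : planeProj ν a ∈ planeProj ν '' (AffineMap.homothety z (1 - θ) '' S))
    (hM : ∀ y ∈ S, dist a y + r ≤ M) :
    ENNReal.ofReal (2 * (θ * r)) ≤ volume {s ∈ Icc (-M) M | a - s • ν ∈ interior S} := by
  obtain ⟨_, ⟨w, hw, rfl⟩, hwa⟩ := ha
  set y := AffineMap.homothety z (1 - θ) w with hy
  have hyeq : y = w + θ • (z - w) := by
    rw [hy, AffineMap.homothety_apply, vsub_eq_sub, vadd_eq_add]; module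
  have hball : Metric.closedBall y (θ * r) ⊆ S := by
    rw [hyeq]; exact closedBall_subset_of_convex hS hw hz hθ0 hθ1
  have hθr : θ * r ≤ r := by nlinarith
  have hyS : y ∈ S := hball (Metric.mem_closedBall_self (by positivity))
  set b := inner ℝ ν (a - y) with hb
  have hay : a - y = b • ν := by
    have h1 : planeProj ν (a - y) = 0 := by rw [map_sub, hwa, sub_self]
    rw [planeProj_apply] at h1
    exact sub_eq_zero.mp h1
  have hbd : |b| = dist a y := by
    rw [dist_eq_norm, hay, norm_smul, hν, mul_one, Real.norm_eq_abs]
  -- The line through a passes through the point y, around which the body contains a ball of radius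
  -- θr; the chord contains a diameter of that ball.
  have hsub : Ioo (b - θ * r) (b + θ * r) ⊆ {s ∈ Icc (-M) M | a - s • ν ∈ interior S} := by
    intro s hs
    have h2 := hM y hyS
    rw [← hbd] at h2
    obtain ⟨h3, h4⟩ := abs_le.mp (le_refl |b|)
    refine ⟨⟨by linarith [hs.1], by linarith [hs.2]⟩, ?_⟩
    have h5 : a - s • ν ∈ Metric.ball y (θ * r) := by
      have h6 : a - s • ν - y = (b - s) • ν := by
        rw [sub_right_comm, hay]; module
      rw [Metric.mem_ball, dist_eq_norm, h6, norm_smul, hν, mul_one, Real.norm_eq_abs, abs_lt]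
      constructor <;> linarith [hs.1, hs.2]
    exact interior_mono hball
      (mem_interior.mpr ⟨_, Metric.ball_subset_closedBall, Metric.isOpen_ball, h5⟩)
  refine le_trans (le_of_eq ?_) (measure_mono hsub)
  rw [Real.volume_Ioo]
  congr 1; ring

end TraceFEM

/-! ### Existence of a regular neighbour reached along long chords -/

namespace TraceFEM

variable {K : Geometry.SimplicialComplex ℝ E3} {Ω Γ : Set E3} {σ : ℝ}
variable {φ : E3 → ℝ} {ν : E3} {η : ℝ} {x : E3} {R : ℝ}

/-- Lines in the direction `ν` through points of `E` have chords of length at least `l` in `T'`, and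
run inside the patch of `T` until they reach them. -/
structure IsTransfer (K : Geometry.SimplicialComplex ℝ E3) (Γ : Set E3) (T T' : Finset E3) (ν : E3)
    (E : Set E3) (l M : ℝ) : Prop where
  measurableSet : MeasurableSet E
  subset : E ⊆ tet T
  le_volume : ∀ a ∈ E, ENNReal.ofReal l ≤
    volume {s ∈ Icc (-M) M | a - s • ν ∈ interior (tet T')}
  path : ∀ a ∈ E, ∀ s ∈ Icc (-M) M, a - s • ν ∈ interior (tet T') → ∀ t ∈ uIcc 0 s,
    a - t • ν ∈ interior (region (cutTetrahedra K Γ)) ∧ ∃ j ∈ patch K Γ T, a - t • ν ∈ tet j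

/-- The ratio by which a tetrahedron is shrunk towards a point near the surface. -/
noncomputable def shrinkRatio (σ : ℝ) : ℝ := 1 / (64 * σ * starRatio σ)

/-- The flatness of the surface required relative to the mesh. -/
noncomputable def flatness (σ : ℝ) : ℝ := shrinkRatio σ / (32 * σ)

/-- The proportion of a tetrahedron near whose boundary chords may be short. -/
noncomputable def chordRatio (σ : ℝ) : ℝ :=
  shrinkRatio σ ^ 2 / (139264 * σ ^ 5 * starRatio σ ^ 2)

theorem shrinkRatio_pos (hσ : 1 ≤ σ) : 0 < shrinkRatio σ := by
  have := one_le_starRatio hσ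
  unfold shrinkRatio; positivity

theorem shrinkRatio_le (hσ : 1 ≤ σ) : shrinkRatio σ ≤ 1 / 64 := by
  have := one_le_starRatio hσ
  unfold shrinkRatio
  exact one_div_le_one_div_of_le (by norm_num) (by nlinarith)

theorem chordRatio_pos (hσ : 1 ≤ σ) : 0 < chordRatio σ := by
  have := one_le_starRatio hσ
  have := shrinkRatio_pos hσ
  unfold chordRatio; positivity

theorem chordRatio_lt_one (hσ : 1 ≤ σ) : chordRatio σ < 1 := by
  have h1 := one_le_starRatio hσ
  have h2 := shrinkRatio_pos hσ
  have h3 := shrinkRatio_le hσ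
  have h4 : 1 ≤ σ ^ 5 := one_le_pow₀ hσ
  have h5 : 1 ≤ starRatio σ ^ 2 := one_le_pow₀ h1
  unfold chordRatio
  rw [div_lt_one (by positivity)]
  have h6 : 1 ≤ σ ^ 5 * starRatio σ ^ 2 := one_le_mul_of_one_le_of_one_le h4 h5
  nlinarith

set_option maxHeartbeats 1600000 in
-- The case in which T lies almost above Γ. Lines descend from a small ball near the barycenter v of
-- the minimal face τ. All elements they cross above Γ contain τ, hence a point with φ ≤ 0, and so
-- are cut; they also meet T in v, so they belong to its patch. Pigeonhole over the star selects T'.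
theorem exists_transfer (hK : IsTriangulation K Ω) (hσ : IsShapeRegular K σ) (hΓ : IsCompact Γ)
    {T : Finset E3} (hT : T ∈ tetrahedra K) (hxT : x ∈ tet T) (hxΓ : x ∈ Γ) (hν : ‖ν‖ = 1)
    (h : IsNearlyAffine φ ν (flatness σ) x R) (hφ : ∀ y ∈ Metric.ball x R, y ∈ Γ ↔ φ y = 0)
    (hspace : Metric.ball x R ⊆ K.space) (hR : (2 + starRatio σ) * tetDiam T < R) {z : E3}
    (hz : Metric.closedBall z (tetDiam T / σ) ⊆ tet T)
    (hlow : ∀ y ∈ tet T, -(2 * (shrinkRatio σ * (tetDiam T / σ) / 16)) ≤ φ y) :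
    ∃ T' ∈ patch K Γ T ∩ regularTetrahedra K Γ
        (shrinkRatio σ ^ 2 / (1024 * σ ^ 5 * starRatio σ ^ 2)),
      ∃ E : Set E3, ENNReal.ofReal ((shrinkRatio σ / (16 * σ)) ^ 3 / (4 * σ ^ 3) * tetDiam T ^ 3) ≤
          volume E ∧
        IsTransfer K Γ T T' ν E (2 * chordRatio σ / (σ * starRatio σ) * tetDiam T)
          ((1 + 2 * starRatio σ) * tetDiam T) := by
  classical
  have hσ1 := one_le_of_isShapeRegular hσ hT
  have hσ0 : 0 < σ := by linarith
  have hh := tetDiam_pos hσ hT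
  have hC1 := one_le_starRatio hσ1
  have hs0 := shrinkRatio_pos hσ1
  have hs1 := shrinkRatio_le hσ1
  have hθ0 := chordRatio_pos hσ1
  have hθ1 := chordRatio_lt_one hσ1
  -- The shrink ratio s is chosen so that 16 s h_T is exactly the radius of the ball covered by the
  -- star.
  have hball4 : shrinkRatio σ * (16 * tetDiam T) = tetDiam T / (4 * σ * starRatio σ) := by
    unfold shrinkRatio; field_simp; norm_num
  have hηdef : flatness σ = shrinkRatio σ / (32 * σ) := rfl
  have hθdef : chordRatio σ = shrinkRatio σ ^ 2 / (139264 * σ ^ 5 * starRatio σ ^ 2) := rfl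
  set η := flatness σ with hη
  set θ := chordRatio σ with hθ
  set s := shrinkRatio σ with hs
  set C := starRatio σ with hC
  set d := tetDiam T with hd
  set ρ := d / σ with hρ
  set w := s * ρ / 16 with hw
  have hρ0 : 0 < ρ := by positivity
  have hρd : ρ ≤ d := div_le_self hh.le hσ1
  have hw0 : 0 < w := by positivity
  have hw' : w = s / (16 * σ) * d := by rw [hw, hρ]; field_simp
  have hη0 : 0 ≤ η := by rw [hηdef]; positivity
  -- The flatness is tuned so that the bound 4ηd on τ becomes 2w.
  have hηd : η * d = w / 2 := by rw [hηdef, hw']; field_simp; norm_num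
  have hη4 : η ≤ 1 / 4 := by
    rw [hηdef, div_le_iff₀ (by positivity)]; nlinarith
  have hdR : ∀ {y p : E3}, p ∈ tet T → dist y p ≤ d → y ∈ Metric.ball x R := fun {y p} hp hyp => by
    have h1 := dist_triangle y p x
    have h2 := dist_le_tetDiam hp hxT
    rw [Metric.mem_ball]
    nlinarith
  have hTR : tet T ⊆ Metric.ball x R := fun y hy => hdR hy (by rw [dist_self]; exact hh.le)
  have hKball : ∀ p ∈ tet T, Metric.closedBall p d ⊆ K.space := fun p hp y hy =>
    hspace (hdR hp hy)
  have hxφ : φ x = 0 := (hφ x (hTR hxT)).mp hxΓ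
  obtain ⟨τ, hτT, hτ, ⟨b, hb, hφb⟩, hτle⟩ := h.exists_face hη0 hTR hxT hxφ.le
  set v := barycenter τ with hv
  have hvτ : v ∈ tet τ := barycenter_mem_tet hτ
  have hvT : v ∈ tet T := tet_mono hτT hvτ
  have hφv : φ v ≤ 2 * w := by
    refine (hτle v hvτ).trans (le_of_eq ?_)
    rw [mul_assoc, ← hd, hηd]; ring
  obtain ⟨hAT, hA⟩ := h.pos_on_closedBall hν hη0 hη4 (convex_tet T) hTR
    (fun y hy y' hy' => dist_le_tetDiam hy hy') hρ0 hρd hs0 hs1 hw hηd.le hz hvT hlow hφv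
  set a₀ := v + s • (z - v) with ha₀
  have hratio := fun {t : Finset E3} (ht : t ∈ tetrahedra K) (hτt : τ ⊆ t) =>
    tetDiam_le_starRatio hK hσ hT hKball hτ hτT ht hτt
  have htR : ∀ {t : Finset E3}, t ∈ tetrahedra K → τ ⊆ t → tet t ⊆ Metric.ball x R := by
    intro t ht hτt y hy
    have h1 := dist_le_tetDiam hy (tet_mono hτt hvτ)
    have h2 := (hratio ht hτt).1
    have h3 := dist_triangle y v x
    have h4 := dist_le_tetDiam hvT hxT
    rw [Metric.mem_ball]
    nlinarith
  -- tetrahedra of the star reaching above the surface are cut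
  have hcut : ∀ {t : Finset E3}, t ∈ tetrahedra K → τ ⊆ t → ∀ {y : E3}, y ∈ tet t → 0 ≤ φ y →
      t ∈ cutTetrahedra K Γ := fun {t} ht hτt {y} hy hy0 =>
    mem_cutTetrahedra_of_sign h hν hη0 hφ ht (htR ht hτt) (tet_mono hτt hb) hy hφb hy0
  have hstar : ∀ {y : E3}, dist y v ≤ s * (16 * d) → ∃ t ∈ tetrahedra K, τ ⊆ t ∧ y ∈ tet t :=
    fun {y} hy => exists_mem_star_of_dist_le hK hσ hT hKball hτ hτT (hball4 ▸ hy)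
  have hsd : s * d ≤ d / 64 := by nlinarith
  have hsd0 : 0 < s * d := by positivity
  have hnearR : ∀ {y : E3}, dist y v ≤ s * (16 * d) → y ∈ Metric.ball x R := fun {y} hy =>
    hdR hvT (by linarith)
  -- On the ball φ ≤ 3sd, and φ falls at rate at least 3/4, so a descent of 6sd crosses Γ. It ends
  -- within 8sd of v, well inside the star ball of radius 16sd.
  set L := 6 * (s * d) with hL
  have hline : ∀ (a : E3) (r : ℝ), dist (a - r • ν) a = |r| := fun a r => by
    rw [dist_eq_norm, sub_sub_cancel_left, norm_neg, norm_smul, hν, mul_one, Real.norm_eq_abs]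
  have hdown : ∀ a ∈ Metric.closedBall a₀ w, ∀ r ∈ Icc (0 : ℝ) L, dist (a - r • ν) v ≤
      8 * (s * d) := fun a ha r hr => by
    have h1 := dist_triangle (a - r • ν) a v
    rw [hline, abs_of_nonneg hr.1] at h1
    linarith [(hA a ha).2.2, hr.2]
  have hdownR : ∀ a ∈ Metric.closedBall a₀ w, ∀ r ∈ Icc (0 : ℝ) L, a - r • ν ∈ Metric.ball x R :=
    fun a ha r hr => hnearR (by linarith [hdown a ha r hr])
  have hL0 : 0 ≤ L := by positivity
  set F : Finset (Finset E3) :=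
    ((finite_tetrahedra hK).subset (sep_subset (tetrahedra K) fun t => τ ⊆ t)).toFinset with hF
  have hFmem : ∀ {t}, t ∈ F ↔ t ∈ tetrahedra K ∧ τ ⊆ t := fun {t} => by simp [hF]
  have hcover : ∀ a ∈ Metric.closedBall a₀ w, ∃ t ∈ F, ∃ r ∈ Icc (0 : ℝ) L,
      a - r • ν ∈ Γ ∩ tet t := by
    intro a ha
    have h1 := h.abs_sub_smul_le hν (a := a) (hdownR a ha 0 ⟨le_rfl, hL0⟩)
      (hdownR a ha L ⟨hL0, le_rfl⟩)
    rw [sub_zero, abs_of_nonneg hL0] at h1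
    have ha0 : a - (0 : ℝ) • ν = a := by simp
    rw [ha0] at h1
    obtain ⟨hp1, hp2, -⟩ := hA a ha
    obtain ⟨r, hr, hr0⟩ := h.exists_zero_on_line hν hη0 hL0 (hdownR a ha 0 ⟨le_rfl, hL0⟩)
      (hdownR a ha L ⟨hL0, le_rfl⟩) (by nlinarith [(abs_le.mp h1).1]) (by rw [ha0]; exact hp1.le)
    obtain ⟨t, ht, hτt, hrt⟩ := hstar (y := a - r • ν) (by linarith [hdown a ha r hr])
    exact ⟨t, hFmem.mpr ⟨ht, hτt⟩, r, hr, (hφ _ (hdownR a ha r hr)).mpr hr0, hrt⟩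
  have hFcard : (F.card : ℝ) ≤ 8 * σ ^ 3 :=
    card_le_of_forall_mem_tet hσ v F ⟨T, hFmem.mpr ⟨hT, hτT⟩⟩
      fun t ht => ⟨(hFmem.mp ht).1, tet_mono (hFmem.mp ht).2 hvτ⟩
  have hvolA : ENNReal.ofReal (4 * w ^ 3) ≤ volume (Metric.closedBall a₀ w) := by
    rw [EuclideanSpace.volume_closedBall_fin_three, ← ENNReal.ofReal_pow hw0.le,
      ← ENNReal.ofReal_mul (by positivity)]
    refine ENNReal.ofReal_le_ofReal ?_
    have h1 : w ^ 3 * 3 ≤ w ^ 3 * Real.pi := by gcongr; exact Real.pi_gt_three.le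
    linarith
  obtain ⟨T', hT'F, hvolT'⟩ := exists_le_volume_of_cover (by positivity) hFcard hcover
    (by positivity) hvolA
  obtain ⟨hT', hτT'⟩ := hFmem.mp hT'F
  set A' := {a ∈ Metric.closedBall a₀ w | ∃ r ∈ Icc (0 : ℝ) L, a - r • ν ∈ Γ ∩ tet T'} with hA'
  have hA'm : MeasurableSet A' := measurableSet_vertical (isCompact_closedBall a₀ w) hΓ T' L
  have hinner : ∀ a ∈ Metric.closedBall a₀ w,
      inner ℝ ν a ∈ Icc (inner ℝ ν a₀ - w) (inner ℝ ν a₀ + w) := by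
    intro a ha
    have h5 : |inner ℝ ν (a - a₀)| ≤ w := by
      refine (abs_real_inner_le_norm _ _).trans ?_
      rw [hν, one_mul, ← dist_eq_norm]; exact ha
    rw [inner_sub_right] at h5
    obtain ⟨h6, h7⟩ := abs_le.mp h5
    exact ⟨by linarith, by linarith⟩
  have hA'pos : 0 < 4 * w ^ 3 / (8 * σ ^ 3) := by positivity
  have hT'cut : T' ∈ cutTetrahedra K Γ := by
    have hne : A'.Nonempty := by
      rw [nonempty_iff_ne_empty]
      intro he
      rw [he, measure_empty, nonpos_iff_eq_zero, ENNReal.ofReal_eq_zero] at hvolT'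
      linarith
    obtain ⟨a, -, r, -, hr⟩ := hne
    exact ⟨hT', _, hr.2, hr.1⟩
  have hvT' : v ∈ tet T' := tet_mono hτT' hvτ
  obtain ⟨hd', hd''⟩ := hratio hT' hτT'
  rw [← hC, ← hd] at hd' hd''
  have hd'0 := tetDiam_pos hσ hT'
  obtain ⟨z', r', hr', hz', hdr'⟩ := hσ T' hT'
  have hr'1 : tetDiam T' / σ ≤ r' := by rw [div_le_iff₀ hσ0]; linarith
  have hr'2 : r' ≤ tetDiam T' := le_tetDiam_of_closedBall_subset (K.indep hT'.1) hT'.2 hr' hz'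
  have hheight : inner ℝ ν a₀ + w - (inner ℝ ν a₀ - w) = 2 * w := by ring
  -- the tetrahedron `T'` is regular
  have hreg : ENNReal.ofReal (s ^ 2 / (1024 * σ ^ 5 * C ^ 2) * tetDiam T' ^ 2) ≤
      μHE[2] (Γ ∩ tet T') := by
    have h1 : volume A' ≤ ENNReal.ofReal (2 * w) * μHE[2] (Γ ∩ tet T') := by
      rw [← hheight]
      refine volume_le_of_planeProj_subset hν (hΓ.inter_right (isCompact_tet T').isClosed)
        fun a ha => ⟨?_, hinner a ha.1⟩
      obtain ⟨-, r, -, hr⟩ := ha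
      exact ⟨_, hr, planeProj_sub_smul hν a r⟩
    have hne : ENNReal.ofReal (2 * w) ≠ 0 := by simpa using hw0
    rw [← ENNReal.mul_le_mul_iff_right hne ENNReal.ofReal_ne_top]
    refine le_trans ?_ (hvolT'.trans h1)
    rw [← ENNReal.ofReal_mul (by positivity)]
    refine ENNReal.ofReal_le_ofReal ?_
    have h2 : tetDiam T' ^ 2 ≤ (C * d) ^ 2 := pow_le_pow_left₀ hd'0.le hd' 2
    calc 2 * w * (s ^ 2 / (1024 * σ ^ 5 * C ^ 2) * tetDiam T' ^ 2)
        ≤ 2 * w * (s ^ 2 / (1024 * σ ^ 5 * C ^ 2) * (C * d) ^ 2) := by gcongr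
      _ = 4 * w ^ 3 / (8 * σ ^ 3) := by
          rw [hw']; field_simp; norm_num
  set E := {a ∈ A' | planeProj ν a ∈
    planeProj ν '' (AffineMap.homothety z' (1 - θ) '' tet T')} with hE
  have hshadow : IsCompact (planeProj ν '' (AffineMap.homothety z' (1 - θ) '' tet T')) :=
    ((isCompact_tet T').image (AffineMap.homothety_continuous z' (1 - θ))).image
      (planeProj ν).continuous
  have hEm : MeasurableSet E := hA'm.inter ((planeProj ν).continuous.measurable hshadow.measurableSet)
  have hEA : ∀ a ∈ E, a ∈ Metric.closedBall a₀ w := fun a ha => ha.1.1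
  have hvolE : ENNReal.ofReal ((s / (16 * σ)) ^ 3 / (4 * σ ^ 3) * d ^ 3) ≤ volume E := by
    -- The chord ratio θ makes this loss equal to w³/(4σ³), half of the volume w³/(2σ³) left by the
    -- pigeonhole argument.
    have hbad : volume (A' \ E) ≤ ENNReal.ofReal (2 * w * (68 * θ * (C * d) ^ 2)) := by
      rw [← hheight]
      refine volume_shadow_diff_le hν (isCompact_tet T') (convex_tet T')
        (hz' (Metric.mem_closedBall_self hr'.le)) (c := v) (D := C * d) (by positivity) ?_ hθ0 hθ1
        (by linarith) fun a ha => ?_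
      · exact fun y hy => (dist_le_tetDiam hy hvT').trans hd'
      · obtain ⟨-, r, -, hr⟩ := ha.1
        exact ⟨⟨_, hr.2, planeProj_sub_smul hν a r⟩, fun hc => ha.2 ⟨ha.1, hc⟩, hinner a ha.1.1⟩
    have hsplit : volume A' ≤ volume E + volume (A' \ E) := by
      refine (measure_mono fun a ha => ?_).trans (measure_union_le _ _)
      by_cases hae : a ∈ E
      · exact Or.inl hae
      · exact Or.inr ⟨ha, hae⟩
    have h1 : 2 * w * (68 * θ * (C * d) ^ 2) = w ^ 3 / (4 * σ ^ 3) := by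
      rw [hθdef, hw']; field_simp; norm_num
    have h2 : 4 * w ^ 3 / (8 * σ ^ 3) - w ^ 3 / (4 * σ ^ 3) =
        (s / (16 * σ)) ^ 3 / (4 * σ ^ 3) * d ^ 3 := by
      rw [hw']; field_simp; norm_num
    rw [h1] at hbad
    rw [← h2, ENNReal.ofReal_sub _ (by positivity), tsub_le_iff_right]
    exact hvolT'.trans (hsplit.trans (by gcongr))
  have hT'patch : T' ∈ patch K Γ T := ⟨hT'cut, v, hvT', hvT⟩
  refine ⟨T', ⟨hT'patch, hT'cut, hreg⟩, E, hvolE, hEm, fun a ha => hAT (hEA a ha), ?_, ?_⟩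
  · intro a ha
    refine le_trans (ENNReal.ofReal_le_ofReal ?_) (le_volume_chord hν (convex_tet T') hr' hz' hθ0
      hθ1.le ha.2 fun y hy => ?_)
    · have h1 : d ≤ C * (σ * r') := hd''.trans (by gcongr)
      rw [div_mul_eq_mul_div, div_le_iff₀ (by positivity)]
      nlinarith
    · have h1 := dist_triangle a v y
      have h2 := dist_le_tetDiam hvT' hy
      have h3 := (hA a (hEA a ha)).2.2
      nlinarith
  · intro a ha r hr hrT' t ht
    obtain ⟨t₀, ht₀, hfoot⟩ := ha.1.2
    have haA := hEA a ha
    rcases eq_or_ne t t₀ with rfl | htne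
    · refine ⟨mem_interior_region_of_mem hK hfoot.1 ?_, T', hT'patch, hfoot.2⟩
      exact Filter.mem_of_superset (Metric.isOpen_ball.mem_nhds (hdownR a haA t ht₀)) hspace
    by_cases hup : t ∈ Ico 0 t₀
    · -- above the surface
      have htL : t ∈ Icc (0 : ℝ) L := ⟨hup.1, hup.2.le.trans ht₀.2⟩
      have hφt : 0 < φ (a - t • ν) := by
        have h1 := h.abs_sub_smul_le hν (hdownR a haA t htL) (hdownR a haA t₀ ht₀)
        rw [(hφ _ (hdownR a haA t₀ ht₀)).mp hfoot.1, abs_of_pos (sub_pos.mpr hup.2)] at h1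
        have := (abs_le.mp h1).1
        nlinarith [hup.2]
      -- Stated for all nearby points above Γ, so that it also yields interiority in the cut region:
      -- a full neighbourhood of the point stays above Γ and in the star ball.
      have hcutnear : ∀ {y : E3}, dist y v ≤ s * (16 * d) → 0 < φ y →
          ∃ j ∈ patch K Γ T, y ∈ tet j := fun {y} hy hy0 => by
        obtain ⟨j, hj, hτj, hyj⟩ := hstar hy
        exact ⟨j, ⟨hcut hj hτj hyj hy0.le, v, tet_mono hτj hvτ, hvT⟩, hyj⟩
      have hdt := hdown a haA t htL
      refine ⟨?_, hcutnear (by linarith) hφt⟩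
      rw [mem_interior_iff_mem_nhds]
      have hφcont : ContinuousAt φ (a - t • ν) :=
        (h.continuousOn hν hη0).continuousAt (Metric.isOpen_ball.mem_nhds (hdownR a haA t htL))
      filter_upwards [hφcont.eventually (lt_mem_nhds hφt),
        Metric.ball_mem_nhds (a - t • ν) hsd0] with y hy1 hy2
      have h1 := dist_triangle y (a - t • ν) v
      rw [Metric.mem_ball] at hy2
      obtain ⟨j, hj, hyj⟩ := hcutnear (y := y) (by linarith) hy1
      exact mem_iUnion₂.mpr ⟨j, hj.1, hyj⟩
    · -- beyond the foot point, inside `T'`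
      have hint : a - t • ν ∈ interior (tet T') := by
        have hne : r - t₀ ≠ 0 := by
          intro h0
          have : r = t₀ := by linarith
          subst this
          rw [uIcc_of_le ht₀.1] at ht
          exact hup ⟨ht.1, lt_of_le_of_ne ht.2 htne⟩
        -- The target r may lie on either side of the foot parameter t₀. In both cases t lies
        -- strictly past t₀ towards r, where convexity puts the point in the interior of T'.
        have hq : (t - t₀) / (r - t₀) ∈ Ioc (0 : ℝ) 1 := by
          rcases le_total 0 r with h0 | h0
          · rw [uIcc_of_le h0] at ht
            have h1 : t₀ < t := by
              by_contra! hlt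
              exact hup ⟨ht.1, lt_of_le_of_ne hlt htne⟩
            have h2 : 0 < r - t₀ := by linarith [ht.2]
            exact ⟨div_pos (by linarith) h2, (div_le_one h2).mpr (by linarith [ht.2])⟩
          · rw [uIcc_of_ge h0] at ht
            have h1 : t < t₀ := lt_of_le_of_ne (ht.2.trans ht₀.1) htne
            have h2 : r - t₀ < 0 := by linarith [ht.1]
            exact ⟨div_pos_of_neg_of_neg (by linarith) h2,
              (div_le_one_of_neg h2).mpr (by linarith [ht.1])⟩
        have h3 := (convex_tet T').add_smul_sub_mem_interior hfoot.2 hrT' hq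
        convert! h3 using 1
        have h4 : a - r • ν - (a - t₀ • ν) = -((r - t₀) • ν) := by module
        rw [h4, smul_neg, smul_smul, div_mul_cancel₀ _ hne]
        module
      refine ⟨interior_mono ?_ hint, T', hT'patch, interior_subset hint⟩
      exact fun y hy => mem_iUnion₂.mpr ⟨T', hT'cut, hy⟩

end TraceFEM

namespace TraceFEM

/-! ### The `L²` estimate -/

variable {K : Geometry.SimplicialComplex ℝ E3} {Ω Γ : Set E3} {σ : ℝ}

theorem l2Norm_nonneg {F : Type*} [NormedAddCommGroup F] (S : Set E3) (f : E3 → F) :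
    0 ≤ l2Norm S f := Real.sqrt_nonneg _

theorem two_mul_ofReal (u : ℝ) : 2 * ENNReal.ofReal u = ENNReal.ofReal (2 * u) := by
  rw [ENNReal.ofReal_mul zero_le_two, ENNReal.ofReal_ofNat]

theorem ofReal_l2Norm_sq {F : Type*} [NormedAddCommGroup F] {S : Set E3} {f : E3 → F}
    (hf : IntegrableOn (fun y => ‖f y‖ ^ 2) S) :
    ENNReal.ofReal (l2Norm S f ^ 2) = ∫⁻ y in S, ENNReal.ofReal (‖f y‖ ^ 2) := by
  rw [l2Norm, Real.sq_sqrt (integral_nonneg fun y => by positivity),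
    ofReal_integral_eq_lintegral_ofReal hf (Filter.Eventually.of_forall fun y => by positivity)]

/-- The `L²` norm over a union of tetrahedra of a piecewise continuous function. -/
theorem ofReal_l2Norm_region_sq {F : Type*} [NormedAddCommGroup F] (S : Finset (Finset E3))
    (hS : ∀ j ∈ S, j ∈ tetrahedra K) {f : E3 → F} {g : Finset E3 → E3 → F}
    (hfg : ∀ j ∈ S, ∀ᵐ y ∂volume.restrict (tet j), f y = g j y)
    (hg : ∀ j ∈ S, ContinuousOn (g j) (tet j)) :
    ENNReal.ofReal (l2Norm (region (S : Set (Finset E3))) f ^ 2) =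
      ∑ j ∈ S, ∫⁻ y in tet j, ENNReal.ofReal (‖g j y‖ ^ 2) := by
  have hreg : region (S : Set (Finset E3)) = ⋃ j ∈ S, tet j := rfl
  have hint : IntegrableOn (fun y => ‖f y‖ ^ 2) (region (S : Set (Finset E3))) := by
    rw [hreg, integrableOn_finset_iUnion]
    intro j hj
    have h1 : IntegrableOn (fun y => ‖g j y‖ ^ 2) (tet j) :=
      ((hg j hj).norm.pow 2).integrableOn_compact (isCompact_tet j)
    refine h1.congr_fun_ae ?_
    filter_upwards [hfg j hj] with y hy
    rw [hy]
  rw [ofReal_l2Norm_sq hint, hreg, lintegral_biUnion_finset₀]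
  · refine Finset.sum_congr rfl fun j hj => lintegral_congr_ae ?_
    filter_upwards [hfg j hj] with y hy
    rw [hy]
  · intro i hi j hj hij
    exact volume_tet_inter_tet (hS i hi) (hS j hj) hij
  · exact fun j _ => (isCompact_tet j).measurableSet.nullMeasurableSet

/-- The polynomial function on `ℝ³` given by `p`. -/
noncomputable def polyFun (p : MvPolynomial (Fin 3) ℝ) (y : E3) : ℝ :=
  MvPolynomial.eval (fun i => y i) p

theorem contDiff_polyFun (p : MvPolynomial (Fin 3) ℝ) : ContDiff ℝ 1 (polyFun p) := by
  have h : polyFun p = fun y : E3 => ∑ d ∈ p.support, p.coeff d * ∏ i, y i ^ d i := by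
    ext y
    rw [polyFun, MvPolynomial.eval_eq']
  rw [h]
  fun_prop

theorem continuous_gradient_polyFun (p : MvPolynomial (Fin 3) ℝ) :
    Continuous (gradient (polyFun p)) := by
  unfold gradient
  exact (LinearIsometryEquiv.continuous _).comp ((contDiff_polyFun p).continuous_fderiv one_ne_zero)

theorem ae_mem_interior_tet (j : Finset E3) :
    ∀ᵐ y ∂volume.restrict (tet j), y ∈ interior (tet j) := by
  rw [ae_restrict_iff' (isCompact_tet j).measurableSet]
  have h := measure_eq_zero_iff_ae_notMem.mp ((convex_tet j).addHaar_frontier volume)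
  filter_upwards [h] with y hy hyj
  by_contra hint
  exact hy ⟨subset_closure hyj, hint⟩

/-- Over a region from which all lines in the direction `ν` reach `T'` inside the patch, the `L²` norm
of a piecewise polynomial is controlled by that on `T'` and by the derivative in a direction `n` close
to `ν`. -/
theorem sq_l2Norm_le_of_isTransfer (hK : IsTriangulation K Ω) {k : ℕ} {q : E3 → ℝ}
    (hq : q ∈ bulkSpace K Γ k) {T T' : Finset E3} (hT : T ∈ cutTetrahedra K Γ)
    (hT' : T' ∈ patch K Γ T) {ν : E3} {E : Set E3} {l M : ℝ} (hl : 0 < l) (hM : 0 ≤ M)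
    (hE : IsTransfer K Γ T T' ν E l M) {C₀ : ℝ} (hC₀ : 0 < C₀)
    (hrem : ∀ p : MvPolynomial (Fin 3) ℝ, p.totalDegree ≤ k →
      ∫⁻ y in tet T, ENNReal.ofReal (polyFun p y ^ 2) ≤
        ENNReal.ofReal C₀ * ∫⁻ y in E, ENNReal.ofReal (polyFun p y ^ 2))
    {n : E3 → E3} (hn : ContinuousOn n (region (patch K Γ T))) {e B : ℝ} (he : e ^ 2 = 1)
    (hB : ∀ y ∈ region (patch K Γ T), ‖e • n y - ν‖ ≤ B) :
    l * l2Norm (tet T) q ^ 2 ≤ C₀ * (4 * M * l2Norm (tet T') q ^ 2 + 8 * M ^ 3 *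
      (2 * l2Norm (region (patch K Γ T)) (fun y => inner ℝ (n y) (gradient q y)) ^ 2 +
        2 * B ^ 2 * l2Norm (region (patch K Γ T)) (gradient q) ^ 2)) := by
  classical
  obtain ⟨hqc, hqp⟩ := hq
  choose! P hPdeg hP using hqp
  set I := interior (region (cutTetrahedra K Γ)) with hI
  have hIsub : ∀ j ∈ cutTetrahedra K Γ, interior (tet j) ⊆ I := fun j hj =>
    interior_mono fun y hy => mem_iUnion₂.mpr ⟨j, hj, hy⟩
  have hqev : ∀ j ∈ cutTetrahedra K Γ, ∀ y ∈ interior (tet j), q =ᶠ[nhds y] polyFun (P j) := by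
    intro j hj y hy
    filter_upwards [isOpen_interior.mem_nhds hy] with y' hy'
    exact hP j hj y' ⟨interior_subset hy', hIsub j hj hy'⟩
  -- The function q is prescribed only in the interior of the cut region; boundaries of convex sets
  -- are null, so the polynomial pieces represent q and ∇q almost everywhere.
  have hqae : ∀ j ∈ cutTetrahedra K Γ, ∀ᵐ y ∂volume.restrict (tet j), q y = polyFun (P j) y := by
    intro j hj
    filter_upwards [ae_mem_interior_tet j] with y hy
    exact (hqev j hj y hy).eq_of_nhds
  have hgae : ∀ j ∈ cutTetrahedra K Γ, ∀ᵐ y ∂volume.restrict (tet j),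
      gradient q y = gradient (polyFun (P j)) y := by
    intro j hj
    filter_upwards [ae_mem_interior_tet j] with y hy
    rw [gradient, gradient, (hqev j hj y hy).fderiv_eq]
  have hpfin : (patch K Γ T).Finite := (finite_tetrahedra hK).subset fun j hj => hj.1.1
  set S := hpfin.toFinset with hS
  have hScoe : (S : Set (Finset E3)) = patch K Γ T := hpfin.coe_toFinset
  have hSmem : ∀ {j}, j ∈ S ↔ j ∈ patch K Γ T := fun {j} => hpfin.mem_toFinset
  have hScut : ∀ j ∈ S, j ∈ cutTetrahedra K Γ := fun j hj => (hSmem.mp hj).1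
  have hSsub : ∀ j ∈ S, tet j ⊆ region (patch K Γ T) := fun j hj y hy =>
    mem_iUnion₂.mpr ⟨j, hSmem.mp hj, hy⟩
  have hsingle : ∀ j ∈ cutTetrahedra K Γ, ENNReal.ofReal (l2Norm (tet j) q ^ 2) =
      ∫⁻ y in tet j, ENNReal.ofReal (polyFun (P j) y ^ 2) := by
    intro j hj
    have h1 := ofReal_l2Norm_region_sq (K := K) {j} (by simpa using hj.1)
      (f := q) (g := fun j => polyFun (P j)) (by simpa using hqae j hj)
      (by simpa using (contDiff_polyFun (P j)).continuous.continuousOn)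
    simpa [region] using h1
  have hgrad : ENNReal.ofReal (l2Norm (region (patch K Γ T)) (gradient q) ^ 2) =
      ∑ j ∈ S, ∫⁻ y in tet j, ENNReal.ofReal (‖gradient (polyFun (P j)) y‖ ^ 2) := by
    rw [← hScoe]
    exact ofReal_l2Norm_region_sq S (fun j hj => (hScut j hj).1) (fun j hj => hgae j (hScut j hj))
      fun j _ => (continuous_gradient_polyFun (P j)).continuousOn
  have hnorm : ENNReal.ofReal (l2Norm (region (patch K Γ T))
      (fun y => inner ℝ (n y) (gradient q y)) ^ 2) =
      ∑ j ∈ S, ∫⁻ y in tet j, ENNReal.ofReal (‖inner ℝ (n y) (gradient (polyFun (P j)) y)‖ ^ 2) := by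
    have h1 := ofReal_l2Norm_region_sq (K := K) S (fun j hj => (hScut j hj).1)
      (f := fun y => inner ℝ (n y) (gradient q y))
      (g := fun j y => inner ℝ (n y) (gradient (polyFun (P j)) y))
      (fun j hj => by
        filter_upwards [hgae j (hScut j hj)] with y hy
        rw [hy])
      fun j hj => (hn.mono (hSsub j hj)).inner (continuous_gradient_polyFun (P j)).continuousOn
    rwa [hScoe] at h1
  have hder : ∀ j, Measurable fun y => ENNReal.ofReal ((fderiv ℝ (polyFun (P j)) y ν) ^ 2) := fun j =>
    ((((contDiff_polyFun (P j)).continuous_fderiv one_ne_zero).clm_apply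
      continuous_const).pow 2).measurable.ennreal_ofReal
  -- Summing over all pieces gives a measurable majorant that is valid at every point, including
  -- common faces where several pieces meet.
  set G : E3 → ENNReal := fun y => ∑ j ∈ S,
    (tet j).indicator (fun y => ENNReal.ofReal ((fderiv ℝ (polyFun (P j)) y ν) ^ 2)) y with hG
  have hGm : Measurable G := Finset.measurable_sum _ fun j _ =>
    (hder j).indicator (isCompact_tet j).measurableSet
  have hGint : ∫⁻ y, G y ≤ 2 * ENNReal.ofReal (l2Norm (region (patch K Γ T))
      (fun y => inner ℝ (n y) (gradient q y)) ^ 2) +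
      ENNReal.ofReal (2 * B ^ 2) *
        ENNReal.ofReal (l2Norm (region (patch K Γ T)) (gradient q) ^ 2) := by
    rw [lintegral_finsetSum _ fun j _ => (hder j).indicator (isCompact_tet j).measurableSet, hnorm,
      hgrad, Finset.mul_sum, Finset.mul_sum, ← Finset.sum_add_distrib]
    refine Finset.sum_le_sum fun j hj => ?_
    have hm : Measurable fun y => ENNReal.ofReal (2 * B ^ 2) *
        ENNReal.ofReal (‖gradient (polyFun (P j)) y‖ ^ 2) :=
      ((continuous_gradient_polyFun (P j)).norm.pow 2).measurable.ennreal_ofReal.const_mul _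
    rw [lintegral_indicator (isCompact_tet j).measurableSet,
      ← lintegral_const_mul' _ _ ENNReal.ofReal_ne_top, ← lintegral_const_mul' 2 _ (by simp),
      ← lintegral_add_right _ hm]
    refine setLIntegral_mono' (isCompact_tet j).measurableSet fun y hy => ?_
    rw [two_mul_ofReal, ← ENNReal.ofReal_mul (by positivity), ← ENNReal.ofReal_add (by positivity) (by positivity)]
    refine ENNReal.ofReal_le_ofReal ?_
    set g := gradient (polyFun (P j)) y with hg
    -- The frozen direction ν is traded for the variable normal; the deviation, at most B, is
    -- charged to the full gradient.
    have h1 : fderiv ℝ (polyFun (P j)) y ν = e * inner ℝ (n y) g - inner ℝ (e • n y - ν) g := by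
      rw [← inner_gradient_eq_fderiv, inner_sub_left, inner_smul_left, real_inner_comm ν]
      simp [hg]
    have h2 : |inner ℝ (e • n y - ν) g| ≤ B * ‖g‖ :=
      (abs_real_inner_le_norm _ _).trans (by gcongr; exact hB y (hSsub j hj hy))
    have h3 : (inner ℝ (e • n y - ν) g) ^ 2 ≤ (B * ‖g‖) ^ 2 := by
      rw [← sq_abs]; exact pow_le_pow_left₀ (abs_nonneg _) h2 2
    have h4 : (e * inner ℝ (n y) g) ^ 2 = (inner ℝ (n y) g) ^ 2 := by rw [mul_pow, he, one_mul]
    rw [h1, Real.norm_eq_abs, sq_abs]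
    nlinarith [sq_nonneg (e * inner ℝ (n y) g + inner ℝ (e • n y - ν) g)]
  have hmain := lintegral_le_of_translates (ν := ν) (F := fun a => ENNReal.ofReal (polyFun (P T) a ^ 2))
    (H := fun a => ENNReal.ofReal (polyFun (P T') a ^ 2)) hE.measurableSet
    (isOpen_interior (s := tet T')).measurableSet hM
    (((contDiff_polyFun (P T')).continuous.pow 2).measurable.ennreal_ofReal) hGm hE.le_volume
    (fun a ha s hs hsT' => by
      have hpath := hE.path a ha s hs hsT'
      have ha0 := (hpath 0 left_mem_uIcc).1
      rw [zero_smul, sub_zero] at ha0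
      have h1 := sq_le_of_piecewise S (C := fun j => tet j) (p := fun j => polyFun (P j))
        (fun j _ => (isCompact_tet j).isClosed) (fun j _ => convex_tet j)
        (fun j _ => contDiff_polyFun (P j)) hqc (fun j hj y hy => hP j (hScut j hj) y hy) (ν := ν)
        (G := G) (fun j hj y hy => by
          rw [hG]
          refine le_trans (le_of_eq ?_) (Finset.single_le_sum (f := fun j => (tet j).indicator
            (fun y => ENNReal.ofReal ((fderiv ℝ (polyFun (P j)) y ν) ^ 2)) y)
            (fun _ _ => zero_le) hj)
          simp only [indicator_of_mem hy])
        (a := a) (s := s) (fun t ht => ⟨(hpath t ht).1, by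
          obtain ⟨j, hj, hyj⟩ := (hpath t ht).2
          exact ⟨j, hSmem.mpr hj, hyj⟩⟩)
      rw [hP T hT a ⟨hE.subset ha, ha0⟩,
        hP T' hT'.1 _ ⟨interior_subset hsT', (hpath s right_mem_uIcc).1⟩] at h1
      change ENNReal.ofReal (polyFun (P T) a ^ 2) ≤ 2 * ENNReal.ofReal (polyFun (P T') (a - s • ν) ^ 2) + _
        at h1
      refine h1.trans ?_
      have h2 : |s| ≤ M := abs_le.mpr hs
      have h3 : uIcc 0 s ⊆ Icc (-M) M := fun t ht => by
        rw [mem_uIcc] at ht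
        obtain ⟨h4, h5⟩ := hs
        rcases ht with ⟨h6, h7⟩ | ⟨h6, h7⟩ <;> constructor <;> linarith
      gcongr)
  have hTle := hrem (P T) (hPdeg T hT)
  rw [← hsingle T hT] at hTle
  have hT'le : ∫⁻ y in interior (tet T'), ENNReal.ofReal (polyFun (P T') y ^ 2) ≤
      ENNReal.ofReal (l2Norm (tet T') q ^ 2) := by
    rw [hsingle T' hT'.1]
    exact lintegral_mono_set interior_subset
  set D₁ := l2Norm (region (patch K Γ T)) (fun y => inner ℝ (n y) (gradient q y)) with hD₁
  set D₂ := l2Norm (region (patch K Γ T)) (gradient q) with hD₂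
  have hfinal : ENNReal.ofReal (l * l2Norm (tet T) q ^ 2) ≤
      ENNReal.ofReal (C₀ * (4 * M * l2Norm (tet T') q ^ 2 + 8 * M ^ 3 *
        (2 * D₁ ^ 2 + 2 * B ^ 2 * D₂ ^ 2))) := by
    calc ENNReal.ofReal (l * l2Norm (tet T) q ^ 2)
        = ENNReal.ofReal l * ENNReal.ofReal (l2Norm (tet T) q ^ 2) := ENNReal.ofReal_mul hl.le
      _ ≤ ENNReal.ofReal l * (ENNReal.ofReal C₀ *
          ∫⁻ y in E, ENNReal.ofReal (polyFun (P T) y ^ 2)) := by gcongr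
      _ = ENNReal.ofReal C₀ * (ENNReal.ofReal l *
          ∫⁻ y in E, ENNReal.ofReal (polyFun (P T) y ^ 2)) := by ring
      _ ≤ ENNReal.ofReal C₀ * (ENNReal.ofReal (4 * M) * ENNReal.ofReal (l2Norm (tet T') q ^ 2) +
          ENNReal.ofReal (8 * M ^ 3) * (2 * ENNReal.ofReal (D₁ ^ 2) +
            ENNReal.ofReal (2 * B ^ 2) * ENNReal.ofReal (D₂ ^ 2))) := by
          refine mul_le_mul_right (hmain.trans ?_) _
          gcongr
      _ = _ := by
          rw [two_mul_ofReal, ← ENNReal.ofReal_mul (by positivity), ← ENNReal.ofReal_mul (by positivity),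
            ← ENNReal.ofReal_add (by positivity) (by positivity),
            ← ENNReal.ofReal_mul (by positivity),
            ← ENNReal.ofReal_add (by positivity) (by positivity),
            ← ENNReal.ofReal_mul (by positivity)]
  exact (ENNReal.ofReal_le_ofReal_iff (by positivity)).mp hfinal

end TraceFEM

namespace TraceFEM

variable {K : Geometry.SimplicialComplex ℝ E3} {Ω Γ O : Set E3} {σ : ℝ} {n : E3 → E3} {κ : ℝ}

/-! ### The neighbourhood estimate -/

/-- The threshold for regular elements. -/
noncomputable def regularRatio (σ : ℝ) : ℝ :=
  min (shrinkRatio σ ^ 2 / (1024 * σ ^ 5 * starRatio σ ^ 2)) (shrinkRatio σ ^ 2 / (8192 * σ ^ 4))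

theorem flatness_pos (hσ : 1 ≤ σ) : 0 < flatness σ := by
  have h1 := shrinkRatio_pos hσ
  unfold flatness
  positivity

theorem flatness_le (hσ : 1 ≤ σ) : flatness σ ≤ 1 / 4 := by
  have h1 := shrinkRatio_le hσ
  rw [flatness, div_le_iff₀ (by positivity)]
  linarith

theorem regularRatio_pos (hσ : 1 ≤ σ) : 0 < regularRatio σ := by
  have h1 := shrinkRatio_pos hσ
  have h2 := one_le_starRatio hσ
  unfold regularRatio
  positivity

theorem regularTetrahedra_anti {χ χ' : ℝ} (h : χ ≤ χ') :
    regularTetrahedra K Γ χ' ⊆ regularTetrahedra K Γ χ := fun s hs =>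
  ⟨hs.1, (ENNReal.ofReal_le_ofReal (by gcongr)).trans hs.2⟩

theorem mem_patch_self {T : Finset E3} (hT : T ∈ cutTetrahedra K Γ) : T ∈ patch K Γ T :=
  ⟨hT, hT.2.mono fun _ hy => ⟨hy.1, hy.1⟩⟩

/-- A tetrahedron on which the defining function changes sign by a definite amount is regular. -/
theorem mem_regularTetrahedra_of_lt {φ : E3 → ℝ} {ν x : E3} {R η : ℝ} (hσ : 1 ≤ σ)
    (hΓ : IsCompact Γ) {T : Finset E3} (hT : T ∈ cutTetrahedra K Γ) (hd : 0 < tetDiam T)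
    (hν : ‖ν‖ = 1) (hη : 0 ≤ η) (hη' : η ≤ 1 / 4) (h : IsNearlyAffine φ ν η x R)
    (hφ : ∀ y ∈ Metric.ball x R, y ∈ Γ ↔ φ y = 0) (hTR : tet T ⊆ Metric.ball x R) {z u : E3}
    (hz : Metric.closedBall z (tetDiam T / σ) ⊆ tet T) (hφz : 0 ≤ φ z) (hu : u ∈ tet T)
    (hφu : φ u < -(2 * (shrinkRatio σ * (tetDiam T / σ) / 16))) :
    T ∈ regularTetrahedra K Γ (shrinkRatio σ ^ 2 / (8192 * σ ^ 4)) := by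
  set d := tetDiam T with hd'
  set w := shrinkRatio σ * (d / σ) / 16 with hw'
  have hsr := shrinkRatio_pos hσ
  have hσ0 : 0 < σ := by linarith
  have hw : 0 < w := by positivity
  have hzT : z ∈ tet T := hz (Metric.mem_closedBall_self (by positivity))
  have hseg : ∀ t ∈ Icc (0 : ℝ) 1, u + t • (z - u) ∈ tet T := fun t ht =>
    (convex_tet T).add_smul_sub_mem hu hzT ht
  have hcont : ContinuousOn (fun t : ℝ => φ (u + t • (z - u))) (Icc 0 1) :=
    (h.continuousOn hν hη).comp (by fun_prop) fun t ht => hTR (hseg t ht)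
  obtain ⟨t, ht, hφt⟩ := intermediate_value_Icc zero_le_one hcont
    (show (0 : ℝ) ∈ _ by constructor <;> simp <;> linarith)
  simp only at hφt
  have hbound := h.abs_sub_le hν (hTR (hseg t ht)) (hTR hu)
  have hdist : dist (u + t • (z - u)) u ≤ t * d := by
    rw [dist_eq_norm, add_sub_cancel_left, norm_smul, Real.norm_of_nonneg ht.1, ← dist_eq_norm]
    exact mul_le_mul_of_nonneg_left (dist_le_tetDiam hzT hu) ht.1
  rw [hφt, zero_sub, abs_neg] at hbound
  -- Climbing from below −2w to 0 at rate at most 1 + η ≤ 2 takes distance at least w. The inscribed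
  -- ball shrunk towards u thus has radius at least w/σ about a point of Γ.
  have htd : w ≤ t * d := by
    have h1 := neg_le_abs (φ u)
    have h2 : (1 + η) * dist (u + t • (z - u)) u ≤ 2 * (t * d) :=
      mul_le_mul (by linarith) hdist dist_nonneg zero_le_two
    linarith
  have ht0 : 0 < t := by
    by_contra hneg
    have : t * d ≤ 0 := mul_nonpos_of_nonpos_of_nonneg (not_lt.mp hneg) hd.le
    linarith
  have hball : Metric.closedBall (u + t • (z - u)) (w / σ) ⊆ tet T := by
    refine (Metric.closedBall_subset_closedBall ?_).trans
      (closedBall_subset_of_convex (convex_tet T) hu hz ht0 ht.2)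
    rw [← mul_div_assoc]
    gcongr
  refine ⟨hT, le_trans (le_of_eq ?_) (ofReal_le_area_of_closedBall_subset h hν hη hη' hΓ hφ
    (isCompact_tet T) (div_pos hw hσ0) hball (hball.trans hTR) hφt)⟩
  rw [hw', ← hd']
  congr 1
  field_simp
  norm_num

/-- The patch of a cut tetrahedron is contained in a ball of comparable size. -/
theorem region_patch_subset (hK : IsTriangulation K Ω) (hσ : IsShapeRegular K σ) {T : Finset E3}
    (hT : T ∈ tetrahedra K) {x : E3} (hx : x ∈ tet T)
    (hspace : ∀ p ∈ tet T, Metric.closedBall p (tetDiam T) ⊆ K.space) :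
    region (patch K Γ T) ⊆ Metric.closedBall x ((1 + starRatio σ) * tetDiam T) := by
  classical
  intro y hy
  obtain ⟨j, hj, hyj⟩ := mem_iUnion₂.mp hy
  obtain ⟨p, hpj, hpT⟩ := hj.2
  -- By conformity a patch element shares a vertex with T, so the diameters are comparable.
  have hp := K.inter_subset_convexHull hj.1.1.1 hT.1 ⟨hpj, hpT⟩
  have hne : ((j : Set E3) ∩ T).Nonempty := convexHull_nonempty_iff.mp ⟨p, hp⟩
  have hle := (tetDiam_le_starRatio hK hσ hT hspace (τ := j ∩ T)
    (by rwa [← Finset.coe_nonempty, Finset.coe_inter]) Finset.inter_subset_right hj.1.1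
    Finset.inter_subset_left).1
  rw [Metric.mem_closedBall]
  have h1 := dist_triangle y p x
  have h2 := dist_le_tetDiam hyj hpj
  have h3 := dist_le_tetDiam hpT hx
  linarith

/-- Scaling: chord length, path length and normal deviation are all proportional to d, so dividing
by d leaves the weights 1, d², d⁴ on the squares. Passing to A + 1 avoids a square root, as A ≤ (A +
1)². -/
theorem le_of_sq_le_combination {l₀ M₀ κ' C₀ d a b D₁ D₂ : ℝ} (hl : 0 < l₀) (hM : 0 ≤ M₀)
    (hC : 0 ≤ C₀) (hd : 0 < d) (hb : 0 ≤ b) (hD₁ : 0 ≤ D₁) (hD₂ : 0 ≤ D₂)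
    (h : l₀ * d * a ^ 2 ≤ C₀ * (4 * (M₀ * d) * b ^ 2 + 8 * (M₀ * d) ^ 3 *
      (2 * D₁ ^ 2 + 2 * (κ' * d) ^ 2 * D₂ ^ 2))) :
    a ≤ (C₀ * (4 * M₀ + 16 * M₀ ^ 3 + 16 * M₀ ^ 3 * κ' ^ 2) / l₀ + 1) *
      (b + d * D₁ + d ^ 2 * D₂) := by
  set X := b + d * D₁ + d ^ 2 * D₂ with hX
  set A := C₀ * (4 * M₀ + 16 * M₀ ^ 3 + 16 * M₀ ^ 3 * κ' ^ 2) / l₀ with hA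
  have hA0 : 0 ≤ A := by positivity
  have hX0 : 0 ≤ X := by positivity
  have hbX : b ^ 2 ≤ X ^ 2 := by
    gcongr
    rw [hX, add_assoc]
    exact le_add_of_nonneg_right (by positivity)
  have h1X : (d * D₁) ^ 2 ≤ X ^ 2 := by
    gcongr
    have : 0 ≤ d ^ 2 * D₂ := by positivity
    linarith
  have h2X : (d ^ 2 * D₂) ^ 2 ≤ X ^ 2 := by
    gcongr
    have : 0 ≤ d * D₁ := by positivity
    linarith
  have h1 : l₀ * a ^ 2 ≤ C₀ * (4 * M₀ * b ^ 2 + 16 * M₀ ^ 3 * (d * D₁) ^ 2 +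
      16 * M₀ ^ 3 * κ' ^ 2 * (d ^ 2 * D₂) ^ 2) := by
    refine le_of_mul_le_mul_left ?_ hd
    calc d * (l₀ * a ^ 2) = l₀ * d * a ^ 2 := by ring
      _ ≤ _ := h
      _ = _ := by ring
  have h2 : l₀ * a ^ 2 ≤ l₀ * (A * X ^ 2) := by
    calc l₀ * a ^ 2 ≤ _ := h1
      _ ≤ C₀ * (4 * M₀ * X ^ 2 + 16 * M₀ ^ 3 * X ^ 2 + 16 * M₀ ^ 3 * κ' ^ 2 * X ^ 2) := by gcongr
      _ = l₀ * (A * X ^ 2) := by rw [hA]; field_simp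
  have h3 : a ^ 2 ≤ A * X ^ 2 := le_of_mul_le_mul_left h2 hl
  refine (le_abs_self a).trans (abs_le_of_sq_le_sq ?_ (by positivity))
  calc a ^ 2 ≤ A * X ^ 2 := h3
    _ ≤ (A + 1) ^ 2 * X ^ 2 := by gcongr; nlinarith
    _ = _ := by ring

/-- Near the surface, the extended normal is close to its value at a point of the surface. -/
theorem IsNormalExtension.norm_sub_le (hn : IsNormalExtension Γ O n κ) {x y : E3} {R : ℝ}
    (hxR : Metric.ball x R ⊆ O) (hy : y ∈ Metric.ball x R) : ‖n y - n x‖ ≤ κ * dist y x := by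
  rw [dist_eq_norm]
  have hR : 0 < R := dist_nonneg.trans_lt hy
  exact (convex_ball x R).norm_image_sub_le_of_norm_fderiv_le (𝕜 := ℝ)
    (fun v hv => ((hn.contDiffOn.contDiffAt (hn.isOpen.mem_nhds (hxR hv))).differentiableAt
      one_ne_zero)) (fun v hv => hn.norm_fderiv_le v (hxR hv)) (Metric.mem_ball_self hR) hy

/-- The neighbourhood estimate on one cut tetrahedron, on which the surface is nearly flat. -/
theorem exists_regular_estimate (hσ : 1 ≤ σ) (k : ℕ) (κ : ℝ) : ∃ c : ℝ, 0 < c ∧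
    ∀ {K : Geometry.SimplicialComplex ℝ E3} {Ω Γ O : Set E3} {n : E3 → E3} {φ : E3 → ℝ} {x : E3}
      {R : ℝ} {T : Finset E3}, IsTriangulation K Ω → IsShapeRegular K σ → IsCompact Γ →
      IsNormalExtension Γ O n κ → Metric.ball x R ⊆ O → Metric.ball x R ⊆ K.space → x ∈ Γ →
      x ∈ tet T → T ∈ tetrahedra K → (∀ y ∈ Metric.ball x R, y ∈ Γ ↔ φ y = 0) →
      IsNearlyAffine φ (n x) (flatness σ) x R → (2 + starRatio σ) * tetDiam T < R →
      region (patch K Γ T) ⊆ O ∧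
      ∃ T' ∈ patch K Γ T ∩ regularTetrahedra K Γ (regularRatio σ), ∀ q ∈ bulkSpace K Γ k,
        l2Norm (tet T) q ≤ c * (l2Norm (tet T') q +
          tetDiam T * l2Norm (region (patch K Γ T)) (fun x => inner ℝ (n x) (gradient q x)) +
          tetDiam T ^ 2 * l2Norm (region (patch K Γ T)) (gradient q)) := by
  have hsr := shrinkRatio_pos hσ
  have hC := one_le_starRatio hσ
  have hch := chordRatio_pos hσ
  have hσ0 : 0 < σ := by linarith
  have hm₀ : 0 < (shrinkRatio σ / (16 * σ)) ^ 3 / (4 * σ ^ 3) := by positivity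
  obtain ⟨C₀, hC₀, hrem⟩ := exists_lintegral_closedBall_le k hm₀
  set l₀ := 2 * chordRatio σ / (σ * starRatio σ) with hl₀
  have hl₀pos : 0 < l₀ := by positivity
  set M₀ := 1 + 2 * starRatio σ with hM₀
  have hM₀pos : 0 ≤ M₀ := by positivity
  set κ' := κ * (1 + starRatio σ) with hκ'
  refine ⟨C₀ * (4 * M₀ + 16 * M₀ ^ 3 + 16 * M₀ ^ 3 * κ' ^ 2) / l₀ + 1, by positivity, ?_⟩
  intro K Ω Γ O n φ x R T hK hs hΓ hn hxO hxK hxΓ hxT hT hφ hflat hR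
  have hd := tetDiam_pos hs hT
  set d := tetDiam T with hd'
  have hcut : T ∈ cutTetrahedra K Γ := ⟨hT, x, hxT, hxΓ⟩
  have hspace : ∀ p ∈ tet T, Metric.closedBall p d ⊆ K.space := by
    intro p hp y hy
    refine hxK ?_
    rw [Metric.mem_ball]
    rw [Metric.mem_closedBall] at hy
    have h1 := dist_le_tetDiam hp hxT
    have h2 := dist_triangle y p x
    nlinarith
  have hpatch := region_patch_subset (Γ := Γ) hK hs hT hxT hspace
  have hpatchR : region (patch K Γ T) ⊆ Metric.ball x R :=
    hpatch.trans (Metric.closedBall_subset_ball (by linarith))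
  have hTR : tet T ⊆ Metric.ball x R := fun y hy =>
    hpatchR (mem_iUnion₂.mpr ⟨T, mem_patch_self hcut, hy⟩)
  refine ⟨hpatchR.trans hxO, ?_⟩
  obtain ⟨z, r, hr, hzr, hrd⟩ := hs T hT
  have hz : Metric.closedBall z (d / σ) ⊆ tet T :=
    (Metric.closedBall_subset_closedBall (by rwa [div_le_iff₀' hσ0])).trans hzr
  -- The sign e orients the surface so that the inscribed centre z is on the nonnegative side.
  obtain ⟨e, he, hφz⟩ : ∃ e : ℝ, e ^ 2 = 1 ∧ 0 ≤ e * φ z := by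
    rcases le_total 0 (φ z) with h | h
    · exact ⟨1, by norm_num, by linarith⟩
    · exact ⟨-1, by norm_num, by linarith⟩
  have he0 : e ≠ 0 := by rintro rfl; norm_num at he
  have hea : |e| = 1 := by rwa [← sq_eq_sq₀ (abs_nonneg e) zero_le_one, sq_abs, one_pow]
  have hν : ‖e • n x‖ = 1 := by
    rw [norm_smul, Real.norm_eq_abs, hea, one_mul, (hn.isUnitNormal x hxΓ).1]
  have hflat' : IsNearlyAffine (fun y => e * φ y) (e • n x) (flatness σ) x R := by
    intro y hy y' hy'
    rw [inner_smul_left, ← mul_sub]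
    simp only [conj_trivial]
    rw [← mul_sub, abs_mul, hea, one_mul]
    exact hflat y hy y' hy'
  have hφ' : ∀ y ∈ Metric.ball x R, y ∈ Γ ↔ e * φ y = 0 := fun y hy => by
    rw [hφ y hy, mul_eq_zero, or_iff_right he0]
  -- Either T is almost above Γ and the estimate is transferred from a neighbour, or Γ cuts T
  -- substantially, T' = T, and the inequality is trivial because the constant is at least 1.
  by_cases hlow : ∀ y ∈ tet T, -(2 * (shrinkRatio σ * (d / σ) / 16)) ≤ e * φ y
  · obtain ⟨T', ⟨hT'p, hT'r⟩, E, hEvol, hE⟩ := exists_transfer hK hs hΓ hT hxT hxΓ hν hflat' hφ' hxK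
      hR hz hlow
    refine ⟨T', ⟨hT'p, regularTetrahedra_anti (min_le_left _ _) hT'r⟩, fun q hq => ?_⟩
    have hTball : tet T ⊆ Metric.closedBall x d := fun y hy => dist_le_tetDiam hy hxT
    refine le_of_sq_le_combination hl₀pos hM₀pos hC₀.le hd (l2Norm_nonneg _ _) (l2Norm_nonneg _ _)
      (l2Norm_nonneg _ _) (sq_l2Norm_le_of_isTransfer hK hq hcut hT'p (by positivity)
        (by positivity) hE hC₀ (fun p hp => (lintegral_mono_set hTball).trans
          (hrem x d hd E hE.measurableSet (hE.subset.trans hTball) hEvol p hp))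
        (hn.contDiffOn.continuousOn.mono (hpatchR.trans hxO)) he fun y hy => ?_)
    rw [← smul_sub, norm_smul, Real.norm_eq_abs, hea, one_mul]
    have hκ : 0 ≤ κ := (norm_nonneg _).trans (hn.norm_fderiv_le x (hn.subset hxΓ))
    refine (hn.norm_sub_le hxO (hpatchR hy)).trans ?_
    rw [hκ', mul_assoc]
    exact mul_le_mul_of_nonneg_left (hpatch hy) hκ
  · push Not at hlow
    obtain ⟨u, hu, hφu⟩ := hlow
    have hreg := mem_regularTetrahedra_of_lt hσ hΓ hcut hd hν (flatness_pos hσ).le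
      (flatness_le hσ) hflat' hφ' hTR hz hφz hu hφu
    refine ⟨T, ⟨mem_patch_self hcut, regularTetrahedra_anti (min_le_right _ _) hreg⟩, fun q _ => ?_⟩
    have h1 := l2Norm_nonneg (tet T) q
    have h2 := l2Norm_nonneg (region (patch K Γ T)) (fun x => inner ℝ (n x) (gradient q x))
    have h3 := l2Norm_nonneg (region (patch K Γ T)) (gradient q)
    have h4 : l2Norm (tet T) q ≤ l2Norm (tet T) q +
        d * l2Norm (region (patch K Γ T)) (fun x => inner ℝ (n x) (gradient q x)) +
        d ^ 2 * l2Norm (region (patch K Γ T)) (gradient q) := by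
      rw [add_assoc]
      exact le_add_of_nonneg_right (by positivity)
    refine h4.trans (le_mul_of_one_le_left (h1.trans h4) (le_add_of_nonneg_left (by positivity)))

end TraceFEM

theorem lemma4p4 (σ : ℝ) :
    -- the threshold for regular elements depends on the shape regularity only
    ∃ χ : ℝ, 0 < χ ∧
    -- the constant depends on shape regularity, the degree and the smoothness bound only
    ∀ (k : ℕ), 1 ≤ k → ∀ (κ : ℝ), ∃ c : ℝ, 0 < c ∧
    ∀ (Ω Γ O : Set TraceFEM.E3) (n : TraceFEM.E3 → TraceFEM.E3),
      IsOpen Ω → Γ ⊆ Ω → TraceFEM.IsClosedSurface Γ → TraceFEM.IsNormalExtension Γ O n κ →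
    -- the mesh size is sufficiently small
    ∃ h₀ : ℝ, 0 < h₀ ∧
    ∀ K : Geometry.SimplicialComplex ℝ TraceFEM.E3,
      TraceFEM.IsTriangulation K Ω → TraceFEM.IsShapeRegular K σ →
      (∀ T ∈ TraceFEM.cutTetrahedra K Γ, TraceFEM.tetDiam T ≤ h₀) →
    ∀ T ∈ TraceFEM.cutTetrahedra K Γ,
      TraceFEM.region (TraceFEM.patch K Γ T) ⊆ O ∧
      ∃ T' ∈ TraceFEM.patch K Γ T ∩ TraceFEM.regularTetrahedra K Γ χ,
      ∀ q ∈ TraceFEM.pressureSpace K Γ k,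
        TraceFEM.l2Norm (TraceFEM.tet T) q ≤
          c * (TraceFEM.l2Norm (TraceFEM.tet T') q
            + TraceFEM.tetDiam T *
              TraceFEM.l2Norm (TraceFEM.region (TraceFEM.patch K Γ T))
                (fun x => inner ℝ (n x) (gradient q x))
            + TraceFEM.tetDiam T ^ 2 *
              TraceFEM.l2Norm (TraceFEM.region (TraceFEM.patch K Γ T)) (gradient q)) := by
  by_cases hσ : 1 ≤ σ
  · refine ⟨TraceFEM.regularRatio σ, TraceFEM.regularRatio_pos hσ, fun k _ κ => ?_⟩
    obtain ⟨c, hc, hest⟩ := TraceFEM.exists_regular_estimate hσ k κ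
    refine ⟨c, hc, fun Ω Γ O n hΩ hΓΩ hΓ hn => ?_⟩
    obtain ⟨R, hR, hflat⟩ := TraceFEM.exists_uniform_flat hΓ hΓΩ hΩ hn (TraceFEM.flatness_pos hσ)
    have hC := TraceFEM.one_le_starRatio hσ
    -- One diameter more than the 2 + `starRatio σ` needed, to make the inequality strict.
    refine ⟨R / (3 + TraceFEM.starRatio σ), by positivity, fun K hK hs hh T hT => ?_⟩
    obtain ⟨x, hxT, hxΓ⟩ := hT.2
    obtain ⟨hball, φ, hφ, hφn⟩ := hflat x hxΓ
    have hd := TraceFEM.tetDiam_pos hs hT.1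
    have hle := hh T hT
    rw [le_div_iff₀' (by positivity)] at hle
    obtain ⟨hO, T', hT', hq⟩ := hest hK hs hΓ.isCompact hn (hball.trans inter_subset_left)
      (hK.space_eq ▸ (hball.trans inter_subset_right).trans subset_closure) hxΓ hxT hT.1 hφ hφn
      (by linarith)
    exact ⟨hO, T', hT', fun q hqQ => hq q hqQ.1⟩
  -- For σ < 1 no tetrahedron is shape regular, so the constants are arbitrary.
  · refine ⟨1, one_pos, fun k _ κ => ⟨1, one_pos, fun Ω Γ O n _ _ _ _ => ⟨1, one_pos, ?_⟩⟩⟩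
    exact fun K _ hs _ T hT => absurd (TraceFEM.one_le_of_isShapeRegular hs hT.1) hσ
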